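/- Let $p\ge 5$ be a prime. Fix an algebraic closure $\mathbb Q_p^{\mathrm{alg}}$ of $\mathbb Q_p$, with metric completion $\mathbb C_p$; let $\mathbb Q_p^{\mathrm{ur}}\subset\mathbb Q_p^{\mathrm{alg}}$ be the maximal unramified extension of $\mathbb Q_p$, with valuation ring $\mathbb Z_p^{\mathrm{ur}}$; let $K$ be the closure of $\mathbb Q_p^{\mathrm{ur}}$ in $\mathbb C_p$ (its metric completion), $K^{\mathrm{alg}}$ the algebraic closure of $K$ in $\mathbb C_p$, and $R$, $R^{\mathrm{alg}}$ the valuation rings of $K$, $K^{\mathrm{alg}}$. Let $k$ be the residue field of $R^{\mathrm{alg}}$ (which is also that of $R$). Fix an automorphism $\phi$ of $K^{\mathrm{alg}}$ that restricts to an automorphism of $R$ whose reduction mod $p$ is the $p$-power Frobenius. Let $\Pi$ be the set of all roots $\pi\in\mathbb Q_p^{\mathrm{alg}}$ of Eisenstein polynomials with coefficients in $\mathbb Z_p^{\mathrm{ur}}$ such that $\mathbb Q_p(\pi)/\mathbb Q_p$ is Galois. For $\pi\in\Pi$ let $K_\pi=K(\pi)$, let $R_\pi$ be its valuation ring, and put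 $\delta_\pi x=(\phi(x)-x^p)/\pi$ for $x\in R_\pi$; this is a map $R_\pi\to R_\pi$. Let $V$ be a smooth scheme over $R$. If $V$ is affine, with a closed embedding $V\subset\mathbb A^d$ over $R$, a function $h:V(R_\pi)\to R_\pi$ is a $\delta_\pi$-function if there are $r\ge 0$ and a restricted power series $F\in R_\pi[x,x',\dots,x^{(r)}]^{\widehat{\ }}$ in $r+1$ $d$-tuples of variables (coefficients tending to $0$ $p$-adically) with $h(a)=F(a,\delta_\pi a,\dots,\delta_\pi^r a)$ for all $a\in V(R_\pi)\subset R_\pi^d$; this does not depend on the embedding. For general $V$, a function $h:V(R_\pi)\to R_\pi$ is a $\delta_\pi$-function if its restriction to $U(R_\pi)$ is one for each affine open $U\subset V$. A function $g:V(R^{\mathrm{alg}})\to K^{\mathrm{alg}}$ is a $\delta^{\mathrm{alg}}$-function if for each $\pi\in\Pi$ there are an integer $\nu\ge 0$ and a $\delta_\pi$-function $g_{\pi,\nu}:V(R_\pi)\to R_\pi$ such that $g=p^{-\nu}g_{\pi,\nu}$ on $V(R_\pi)$. For $\overline P\in V(k)$ let $\mathbb B(V,\overline P,R^{\mathrm{alg}})$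 be the set of all $P\in V(R^{\mathrm{alg}})$ whose image in $V(k)$ is $\overline P$. Let $g:V(R^{\mathrm{alg}})\to K^{\mathrm{alg}}$ be a $\delta^{\mathrm{alg}}$-function. Assume that the reduction $V\otimes_R R/pR$ of $V$ mod $p$ is connected in the Zariski topology and that $g$ vanishes on $\mathbb B(V,\overline P,R^{\mathrm{alg}})$ for one $\overline P\in V(k)$. Then $g(P)=0$ for all $P\in V(R^{\mathrm{alg}})$. -/

import Mathlib

open AlgebraicGeometry CategoryTheory Filter Topology

noncomputable section

namespace ArithDiff

/-! ### The fields and rings, all realised inside `ℂ_[p]` -/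

/-- A subextension of `ℚ_p^alg / ℚ_p` has ramification index one over `ℚ_p`: each of its nonzero
elements has the absolute value of a power of `p`. As the residue field of `ℚ_p` is perfect, a
finite extension is unramified if and only if this holds. -/
def IsUnramifiedExt (p : ℕ) [Fact p.Prime] (L : IntermediateField ℚ_[p] (PadicAlgCl p)) : Prop :=
  ∀ x ∈ L, x ≠ 0 → ∃ n : ℤ, ‖x‖ = (p : ℝ) ^ n

/-- `ℚ_p^ur`, the maximal unramified extension of `ℚ_p` in `ℚ_p^alg`: the compositum of all finite
unramified extensions. -/
def Qur (p : ℕ) [Fact p.Prime] : IntermediateField ℚ_[p] (PadicAlgCl p) :=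
  sSup {L | FiniteDimensional ℚ_[p] L ∧ IsUnramifiedExt p L}

/-- `ℤ_p^ur`, the valuation ring of `ℚ_p^ur`. -/
def Zur (p : ℕ) [Fact p.Prime] : Subring (PadicAlgCl p) where
  carrier := {x | x ∈ Qur p ∧ ‖x‖ ≤ 1}
  mul_mem' := fun {a b} ha hb => ⟨mul_mem ha.1 hb.1, by
    rw [norm_mul]; exact mul_le_one₀ ha.2 (norm_nonneg _) hb.2⟩
  one_mem' := ⟨one_mem _, by simp⟩
  add_mem' := fun {a b} ha hb => ⟨add_mem ha.1 hb.1,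
    (IsUltrametricDist.norm_add_le_max a b).trans (max_le ha.2 hb.2)⟩
  zero_mem' := ⟨zero_mem _, by simp⟩
  neg_mem' := fun {a} ha => ⟨neg_mem ha.1, by rw [norm_neg]; exact ha.2⟩

/-- `K`, the metric completion of `ℚ_p^ur`, realised as its closure in `ℂ_p`. -/
def K (p : ℕ) [Fact p.Prime] : IntermediateField ℚ_[p] ℂ_[p] :=
  (((Qur p).toSubfield.map (algebraMap (PadicAlgCl p) ℂ_[p])).topologicalClosure).toIntermediateField
    fun x => Subfield.le_topologicalClosure _
      ⟨algebraMap ℚ_[p] (PadicAlgCl p) x, (Qur p).algebraMap_mem x,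
        (IsScalarTower.algebraMap_apply ℚ_[p] (PadicAlgCl p) ℂ_[p] x).symm⟩

/-- `K^alg`, the algebraic closure of `K` in `ℂ_p`. -/
def Kalg (p : ℕ) [Fact p.Prime] : IntermediateField (K p) ℂ_[p] :=
  algebraicClosure (K p) ℂ_[p]

/-- `K_π = K(π)`, for `π` in `ℚ_p^alg`. -/
def Kpi (p : ℕ) [Fact p.Prime] (π : PadicAlgCl p) : IntermediateField (K p) ℂ_[p] :=
  IntermediateField.adjoin (K p) {(π : ℂ_[p])}

/-- The valuation ring of a subfield of `ℂ_p`. -/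
def valRing {p : ℕ} [Fact p.Prime] (F : Subfield ℂ_[p]) : Subring ℂ_[p] where
  carrier := {x | x ∈ F ∧ ‖x‖ ≤ 1}
  mul_mem' := fun {a b} ha hb => ⟨mul_mem ha.1 hb.1, by
    rw [norm_mul]; exact mul_le_one₀ ha.2 (norm_nonneg _) hb.2⟩
  one_mem' := ⟨one_mem _, by simp⟩
  add_mem' := fun {a b} ha hb => ⟨add_mem ha.1 hb.1,
    (IsUltrametricDist.norm_add_le_max a b).trans (max_le ha.2 hb.2)⟩
  zero_mem' := ⟨zero_mem _, by simp⟩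
  neg_mem' := fun {a} ha => ⟨neg_mem ha.1, by rw [norm_neg]; exact ha.2⟩

theorem valRing_mono {p : ℕ} [Fact p.Prime] {F G : Subfield ℂ_[p]} (h : F ≤ G) :
    valRing F ≤ valRing G := fun _ hx => ⟨h hx.1, hx.2⟩

theorem valRing_isUnit_iff {p : ℕ} [Fact p.Prime] {F : Subfield ℂ_[p]} (x : valRing F) :
    IsUnit x ↔ ‖(x : ℂ_[p])‖ = 1 := by
  constructor
  · rintro ⟨u, rfl⟩
    have h : ((u : valRing F) : ℂ_[p]) * ((u⁻¹ : (valRing F)ˣ) : valRing F) = 1 := by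
      exact_mod_cast congrArg Subtype.val u.mul_inv
    have h1 := congrArg norm h
    rw [norm_mul, norm_one] at h1
    refine le_antisymm (u : valRing F).2.2 ?_
    rw [← h1]
    exact mul_le_of_le_one_right (norm_nonneg _) ((u⁻¹ : (valRing F)ˣ) : valRing F).2.2
  · intro h
    have hx : (x : ℂ_[p]) ≠ 0 := by rw [← norm_ne_zero_iff, h]; exact one_ne_zero
    exact IsUnit.of_mul_eq_one ⟨(x : ℂ_[p])⁻¹, inv_mem x.2.1, by rw [norm_inv, h, inv_one]⟩
      (Subtype.ext (mul_inv_cancel₀ hx))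

instance valRing_isLocalRing {p : ℕ} [Fact p.Prime] (F : Subfield ℂ_[p]) :
    IsLocalRing (valRing F) :=
  IsLocalRing.of_nonunits_add fun a b ha hb => by
    rw [mem_nonunits_iff, valRing_isUnit_iff] at *
    have h := IsUltrametricDist.norm_add_le_max (a : ℂ_[p]) (b : ℂ_[p])
    exact ne_of_lt (h.trans_lt (max_lt (lt_of_le_of_ne a.2.2 ha) (lt_of_le_of_ne b.2.2 hb)))

/-- `R`, the valuation ring of `K`. -/
abbrev R (p : ℕ) [Fact p.Prime] : Subring ℂ_[p] := valRing (K p).toSubfield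

/-- `R^alg`, the valuation ring of `K^alg`. -/
abbrev Ralg (p : ℕ) [Fact p.Prime] : Subring ℂ_[p] := valRing (Kalg p).toSubfield

/-- `R_π`, the valuation ring of `K_π`. -/
abbrev Rpi (p : ℕ) [Fact p.Prime] (π : PadicAlgCl p) : Subring ℂ_[p] :=
  valRing (Kpi p π).toSubfield

/-- `k`, the residue field of `R^alg`. -/
abbrev k (p : ℕ) [Fact p.Prime] : Type := IsLocalRing.ResidueField (Ralg p)

theorem K_le (p : ℕ) [Fact p.Prime] (F : IntermediateField (K p) ℂ_[p]) :
    (K p).toSubfield ≤ F.toSubfield := fun x hx => F.algebraMap_mem ⟨x, hx⟩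

theorem Kpi_le (p : ℕ) [Fact p.Prime] (π : PadicAlgCl p) :
    (Kpi p π).toSubfield ≤ (Kalg p).toSubfield := by
  have h : Kpi p π ≤ Kalg p := by
    refine IntermediateField.adjoin_le_iff.2 (Set.singleton_subset_iff.2 ?_)
    have h1 : IsAlgebraic ℚ_[p] (algebraMap (PadicAlgCl p) ℂ_[p] π) :=
      (Algebra.IsAlgebraic.isAlgebraic π).algebraMap
    exact mem_algebraicClosure_iff.2 (h1.extendScalars (algebraMap ℚ_[p] (K p)).injective)
  exact h

/-- The inclusion `R → R_π`. -/
def RtoRpi (p : ℕ) [Fact p.Prime] (π : PadicAlgCl p) : R p →+* Rpi p π :=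
  Subring.inclusion (valRing_mono (K_le p _))

/-- The inclusion `R → R^alg`. -/
def RtoRalg (p : ℕ) [Fact p.Prime] : R p →+* Ralg p :=
  Subring.inclusion (valRing_mono (K_le p _))

/-- The inclusion `R_π → R^alg`. -/
def RpiToRalg (p : ℕ) [Fact p.Prime] (π : PadicAlgCl p) : Rpi p π →+* Ralg p :=
  Subring.inclusion (valRing_mono (Kpi_le p π))

/-- The inclusion `R_π → K^alg`. -/
def RpiToKalg (p : ℕ) [Fact p.Prime] (π : PadicAlgCl p) (x : Rpi p π) : Kalg p :=
  ⟨x, Kpi_le p π x.2.1⟩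

/-- The set `Π` of all roots `π ∈ ℚ_p^alg` of Eisenstein polynomials with coefficients in `ℤ_p^ur`
such that `ℚ_p(π) / ℚ_p` is Galois. -/
def PiSet (p : ℕ) [Fact p.Prime] : Set (PadicAlgCl p) :=
  {π | (∃ P : Polynomial (Zur p), P.Monic ∧ P.IsEisensteinAt (Ideal.span {(p : Zur p)}) ∧
      Polynomial.aeval π P = 0) ∧
    IsGalois ℚ_[p] (IntermediateField.adjoin ℚ_[p] {π})}

/-- `φ` is an automorphism of `K^alg` that restricts to an automorphism of `R` whose reduction
mod `p` is the `p`-power Frobenius. -/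
structure IsFrobenius {p : ℕ} [Fact p.Prime] (φ : Kalg p ≃+* Kalg p) : Prop where
  image_R : φ '' {x : Kalg p | (x : ℂ_[p]) ∈ R p} = {x : Kalg p | (x : ℂ_[p]) ∈ R p}
  frob : ∀ x : Kalg p, (x : ℂ_[p]) ∈ R p →
    ∃ y : Kalg p, (y : ℂ_[p]) ∈ R p ∧ φ x - x ^ p = p * y

/-- The Fermat quotient operator `δ_π x = (φ(x) - x ^ p) / π`. For `π ∈ Π` it maps `R_π` to
itself. -/
def fermatQuotient {p : ℕ} [Fact p.Prime] (φ : Kalg p ≃+* Kalg p) (π : PadicAlgCl p)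
    (x : Kalg p) : Kalg p :=
  (φ x - x ^ p) / ⟨(π : ℂ_[p]), Kpi_le p π (IntermediateField.mem_adjoin_simple_self _ _)⟩

/-! ### Points of schemes over `R` -/

/-- `V(B)` for an `A`-scheme `f : V → Spec A` and an `A`-algebra `ι : A → B`. -/
def Points {A B : Type} [CommRing A] [CommRing B] {V : Scheme.{0}}
    (f : V ⟶ Spec (CommRingCat.of A)) (ι : A →+* B) : Type :=
  {x : Spec (CommRingCat.of B) ⟶ V // x ≫ f = Spec.map (CommRingCat.ofHom ι)}

/-- The map `V(B) → V(C)` induced by a homomorphism `B → C` of `A`-algebras. -/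
def Points.map {A B C : Type} [CommRing A] [CommRing B] [CommRing C] {V : Scheme.{0}}
    {f : V ⟶ Spec (CommRingCat.of A)} {ι : A →+* B} (x : Points f ι) (j : B →+* C) :
    Points f (j.comp ι) :=
  ⟨Spec.map (CommRingCat.ofHom j) ≫ x.1, by
    rw [Category.assoc, x.2, ← Spec.map_comp, CommRingCat.ofHom_comp]⟩

/-- The inclusion `U(B) → V(B)` for `U` open in `V`. -/
def Points.ofOpen {A B : Type} [CommRing A] [CommRing B] {V : Scheme.{0}}
    {f : V ⟶ Spec (CommRingCat.of A)} {ι : A →+* B} {U : V.Opens} (x : Points (U.ι ≫ f) ι) :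
    Points f ι :=
  ⟨x.1 ≫ U.ι, by rw [Category.assoc, x.2]⟩

/-- The value in `B` of a global function `s` at a `B`-point. -/
def Points.value {A B : Type} [CommRing A] [CommRing B] {V : Scheme.{0}}
    {f : V ⟶ Spec (CommRingCat.of A)} {ι : A →+* B} (x : Points f ι) (s : Γ(V, ⊤)) : B :=
  (Scheme.ΓSpecIso (CommRingCat.of B)).hom (x.1.appTop s)

/-- The structure map `A → 𝒪(V)` of an `A`-scheme. -/
def structureMap {A : Type} [CommRing A] {V : Scheme.{0}} (f : V ⟶ Spec (CommRingCat.of A)) :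
    A →+* Γ(V, ⊤) :=
  ((Scheme.ΓSpecIso (CommRingCat.of A)).inv ≫ f.appTop).hom

/-- The reduction mod `p` of an `R`-scheme, `V ⊗_R R/pR`. -/
def reductionModP {p : ℕ} [Fact p.Prime] {V : Scheme.{0}} (f : V ⟶ Spec (CommRingCat.of (R p))) :
    Scheme.{0} :=
  Limits.pullback f
    (Spec.map (CommRingCat.ofHom (Ideal.Quotient.mk (Ideal.span {(p : R p)}))))

/-- The map `V(R_π) → V(R^alg)`. -/
def toAlg {p : ℕ} [Fact p.Prime] {V : Scheme.{0}} {f : V ⟶ Spec (CommRingCat.of (R p))}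
    {π : PadicAlgCl p} (x : Points f (RtoRpi p π)) : Points f (RtoRalg p) :=
  x.map (RpiToRalg p π)

/-- The map `R → k`, which makes `k` an `R`-algebra. -/
def RtoResidue (p : ℕ) [Fact p.Prime] : R p →+* k p :=
  (IsLocalRing.residue (Ralg p)).comp (RtoRalg p)

/-- The unit ball `𝔹(V, P̄, R^alg)`: all points of `V(R^alg)` whose image in `V(k)` is `P̄`. -/
def unitBall {p : ℕ} [Fact p.Prime] {V : Scheme.{0}} {f : V ⟶ Spec (CommRingCat.of (R p))}
    (Pbar : Points f (RtoResidue p)) : Set (Points f (RtoRalg p)) :=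
  {P | P.map (IsLocalRing.residue (Ralg p)) = Pbar}

/-! ### `δ_π`-functions and `δ^alg`-functions -/

/-- `δ_π`-functions `W(R_π) → R_π` on an affine `R`-scheme `W`. The functions `s 1, …, s d` generate
`𝒪(W)` as an `R`-algebra, that is, they define a closed embedding of `W` in affine `d`-space; the
`i`-th coordinate of a point `a` is the value of `s i` at `a`. The series
`F ∈ R_π[x, x', …, x^(r)]^` is a restricted power series, with variable `(j, i)` standing for the
`i`-th component of `x^(j)`, and `h a = F(a, δ_π a, …, δ_π^r a)`, the series being summed in the
`p`-adic topology. -/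
def IsDeltaPiFunctionAffine {p : ℕ} [Fact p.Prime] (φ : Kalg p ≃+* Kalg p) (π : PadicAlgCl p)
    {W : Scheme.{0}} (f : W ⟶ Spec (CommRingCat.of (R p)))
    (h : Points f (RtoRpi p π) → Rpi p π) : Prop :=
  ∃ (d : ℕ) (s : Fin d → Γ(W, ⊤)),
    Function.Surjective (MvPolynomial.eval₂Hom (structureMap f) s) ∧
    ∃ (r : ℕ) (F : MvPowerSeries (Fin (r + 1) × Fin d) (Rpi p π)),
      MvPowerSeries.IsRestricted (fun _ => 1) F ∧
      ∀ a : Points f (RtoRpi p π),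
        HasSum (fun m : Fin (r + 1) × Fin d →₀ ℕ =>
          ((MvPowerSeries.coeff m F : Rpi p π) : ℂ_[p]) *
            ∏ ji : Fin (r + 1) × Fin d,
              ((((fermatQuotient φ π)^[(ji.1 : ℕ)] (RpiToKalg p π (a.value (s ji.2))) : Kalg p) :
                ℂ_[p])) ^ m ji)
          ((h a : Rpi p π) : ℂ_[p])

/-- `δ_π`-functions `V(R_π) → R_π` on an arbitrary `R`-scheme `V`: the restriction to the
`R_π`-points of any affine open subset is a `δ_π`-function. -/
def IsDeltaPiFunction {p : ℕ} [Fact p.Prime] (φ : Kalg p ≃+* Kalg p) (π : PadicAlgCl p)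
    {V : Scheme.{0}} (f : V ⟶ Spec (CommRingCat.of (R p)))
    (h : Points f (RtoRpi p π) → Rpi p π) : Prop :=
  ∀ U : V.Opens, IsAffineOpen U →
    IsDeltaPiFunctionAffine φ π (U.ι ≫ f) fun a => h a.ofOpen

/-- `δ^alg`-functions `g : V(R^alg) → K^alg`: for each `π ∈ Π` there are `ν ≥ 0` and a
`δ_π`-function `g_{π,ν}` such that `g = p^{-ν} g_{π,ν}` on `V(R_π)`. -/
def IsDeltaAlgFunction {p : ℕ} [Fact p.Prime] (φ : Kalg p ≃+* Kalg p)
    {V : Scheme.{0}} (f : V ⟶ Spec (CommRingCat.of (R p)))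
    (g : Points f (RtoRalg p) → Kalg p) : Prop :=
  ∀ π ∈ PiSet p, ∃ (ν : ℕ) (gν : Points f (RtoRpi p π) → Rpi p π),
    IsDeltaPiFunction φ π f gν ∧
    ∀ P : Points f (RtoRpi p π), g (toAlg P) = ((p : Kalg p) ^ ν)⁻¹ * RpiToKalg p π (gν P)

end ArithDiff

end

/-! The theorem combines an identity principle for a single π with a propagation argument along the
closed fibre.

Identity principle. Near a point of the closed fibre, V is étale over affine space with coordinates
t, and after shrinking its reduction mod p is integral. Fix π, write O = R_π and ϖ = π, and let A be
the coordinate ring. Since φ(t) = t^p + ϖ δt and the coordinates are étale, φ is determined on all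
sections, and every δ^j s is a ϖ-adic limit of polynomials in δt, ..., δ^j t over A
(`δ_iterate_mem`). Restricted power series in such functions stay of this kind, so a δ_π-function is
h = ∑ ϖ^l H_l with H_l polynomials over A in the derivatives of t. Suppose h vanishes on the residue
disk of an R-point P with t(P) = 0. Each tuple in (ϖO)^d is the coordinate tuple of a point of that
disk, so one may evaluate at t = p^m b and replace the coefficients of the H_l by their Taylor
expansions at P. For each n, the part of degree less than n of the resulting series in the jets
vanishes to order n at the origin. It is therefore zero: δ^j(p^m b)/p^m tends to a nonzero multiple
of φ^j(b), and distinct monomials in the φ^j are distinct characters, hence independent by Dedekind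
(`jetIndependent`). So all Taylor coefficients of H_0 are divisible by p. As A/p is a Noetherian
domain, Krull's intersection theorem makes H_0 itself divisible by p, and h = ϖ h' with h' of the
same form and again zero on the disk (`exists_div_of_vanish`). Iterating, h is divisible by every
power of ϖ, so h = 0 (`eq_zero_of_vanish`).

From R_π to R^alg. A point over an affine open of finite type involves finitely many elements of
K^alg. By Krasner's lemma each lies in some K(β) with β algebraic over ℚ_p. A finite Galois
extension of ℚ_p is generated by a uniformizer, which is a root of an Eisenstein polynomial over
ℤ_p^ur; hence all these elements lie in one K_π (`exists_forall_mem_Kpi`). The identity principle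
for that π then shows that vanishing on one ball inside a coordinate open forces g to vanish on the
whole open (`IsCoordinateOpen.eq_zero`).

Propagation. Coordinate opens cover the closed fibre. If two of them meet there, the Nullstellensatz
gives a k-point in the intersection, and its ball carries vanishing from one to the other.
Connectedness of the fibre does the rest (`eq_zero_of_vanish_unitBall`). -/

namespace ArithDiff

/-! ### Lifting homomorphisms along formally étale homomorphisms -/

section EtaleLifting

variable {B A C : Type*} [CommRing B] [CommRing A] [CommRing C] {θ : B →+* A}

/-- Formal smoothness lifts through each C/I^n and completeness takes the limit. This is Hensel's
lemma for étale coordinates: the images of the coordinates and the reduction mod I may be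
prescribed. -/
theorem exists_lift_of_isAdicComplete (hθ : θ.FormallyEtale) (I : Ideal C) [IsAdicComplete I C]
    (α : B →+* C) (β : A →+* C ⧸ I) (h : β.comp θ = (Ideal.Quotient.mk I).comp α) :
    ∃ γ : A →+* C, γ.comp θ = α ∧ (Ideal.Quotient.mk I).comp γ = β := by
  algebraize [θ, α]
  have hA : Algebra.FormallyEtale B A := hθ
  let β' : A →ₐ[B] C ⧸ I := { β with commutes' := fun b => RingHom.congr_fun h b }
  obtain ⟨g, hg⟩ := Algebra.FormallySmooth.exists_mkₐ_comp_eq_of_isAdicComplete β'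
  refine ⟨g.toRingHom, RingHom.ext fun b => g.commutes b, RingHom.ext fun x => ?_⟩
  exact DFunLike.congr_fun hg x

theorem exists_lift_of_isNilpotent {D : Type*} [CommRing D] (hθ : θ.FormallyEtale) (q : C →+* D)
    (hq : Function.Surjective q) (hn : IsNilpotent (RingHom.ker q))
    (α : B →+* C) (β : A →+* D) (h : β.comp θ = q.comp α) :
    ∃ γ : A →+* C, γ.comp θ = α ∧ q.comp γ = β := by
  algebraize [θ, α, q.comp α]
  have hA : Algebra.FormallyEtale B A := hθ
  let β' : A →ₐ[B] D := { β with commutes' := fun b => RingHom.congr_fun h b }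
  let q' : C →ₐ[B] D := { q with commutes' := fun b => rfl }
  refine ⟨(Algebra.FormallySmooth.liftOfSurjective β' q' hq hn).toRingHom,
    RingHom.ext fun b => AlgHom.commutes _ b, RingHom.ext fun x => ?_⟩
  exact Algebra.FormallySmooth.liftOfSurjective_apply β' q' hq hn x

/-- The uniqueness half, from formal unramifiedness. It serves below to identify two homomorphisms
known only on coordinates and modulo an ideal. -/
theorem eq_of_comp_eq_of_sub_mem (hθ : θ.FormallyEtale) (I : Ideal C) (hI : ⨅ n : ℕ, I ^ n = ⊥)
    {γ₁ γ₂ : A →+* C} (h : γ₁.comp θ = γ₂.comp θ) (hsub : ∀ x, γ₁ x - γ₂ x ∈ I) : γ₁ = γ₂ := by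
  algebraize [θ, γ₁.comp θ]
  have hA : Algebra.FormallyEtale B A := hθ
  let g₁ : A →ₐ[B] C := { γ₁ with commutes' := fun b => rfl }
  let g₂ : A →ₐ[B] C := { γ₂ with commutes' := fun b => (RingHom.congr_fun h b).symm }
  have := Algebra.FormallyUnramified.ext_of_iInf I hI (g₁ := g₁) (g₂ := g₂)
    fun x => Ideal.Quotient.eq.2 (hsub x)
  exact RingHom.ext fun x => DFunLike.congr_fun this x

theorem iInf_pow_eq_bot_of_isNilpotent {I : Ideal C} (h : IsNilpotent I) :
    ⨅ n : ℕ, I ^ n = ⊥ := by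
  obtain ⟨n, hn⟩ := h
  exact eq_bot_iff.2 ((iInf_le _ n).trans (by rw [hn]; exact le_rfl))

end EtaleLifting

/-! ### Adic closure of a subring -/

section AdicClosure

variable {H : Type*} [CommRing H] (ϖ : H) (T : Subring H)

/-- The sums `∑ ϖ ^ n * u n` with all `u n` in `T`, defined coinductively: the largest set `Q` with
`Q ⊆ T + ϖ Q`. -/
def adicClosureSet : Set H :=
  {h | ∃ Q : Set H, h ∈ Q ∧ ∀ q ∈ Q, ∃ u ∈ T, ∃ q' ∈ Q, q = u + ϖ * q'}

variable {ϖ T}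

theorem exists_of_mem_adicClosureSet {h : H} (hh : h ∈ adicClosureSet ϖ T) :
    ∃ u ∈ T, ∃ h' ∈ adicClosureSet ϖ T, h = u + ϖ * h' := by
  obtain ⟨Q, hQ, H⟩ := hh
  obtain ⟨u, hu, q', hq', e⟩ := H h hQ
  exact ⟨u, hu, q', ⟨Q, hq', H⟩, e⟩

theorem mem_adicClosureSet_of_mem {u : H} (hu : u ∈ T) : u ∈ adicClosureSet ϖ T := by
  refine ⟨T, hu, fun q hq => ⟨q, hq, 0, zero_mem _, by ring⟩⟩

theorem add_mem_adicClosureSet {a b : H} (ha : a ∈ adicClosureSet ϖ T)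
    (hb : b ∈ adicClosureSet ϖ T) : a + b ∈ adicClosureSet ϖ T := by
  refine ⟨{x | ∃ a ∈ adicClosureSet ϖ T, ∃ b ∈ adicClosureSet ϖ T, x = a + b},
    ⟨a, ha, b, hb, rfl⟩, ?_⟩
  rintro _ ⟨a, ha, b, hb, rfl⟩
  obtain ⟨u, hu, a', ha', rfl⟩ := exists_of_mem_adicClosureSet ha
  obtain ⟨v, hv, b', hb', rfl⟩ := exists_of_mem_adicClosureSet hb
  exact ⟨u + v, add_mem hu hv, a' + b', ⟨a', ha', b', hb', rfl⟩, by ring⟩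

theorem mul_mem_adicClosureSet_of_mem {h : H} (hh : h ∈ adicClosureSet ϖ T) :
    ϖ * h ∈ adicClosureSet ϖ T := by
  refine ⟨insert (ϖ * h) (adicClosureSet ϖ T), Set.mem_insert _ _, ?_⟩
  rintro q (rfl | hq)
  · exact ⟨0, zero_mem _, h, Set.mem_insert_of_mem _ hh, by ring⟩
  · obtain ⟨u, hu, q', hq', e⟩ := exists_of_mem_adicClosureSet hq
    exact ⟨u, hu, q', Set.mem_insert_of_mem _ hq', e⟩

theorem mul_mem_adicClosureSet {a b : H} (ha : a ∈ adicClosureSet ϖ T)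
    (hb : b ∈ adicClosureSet ϖ T) : a * b ∈ adicClosureSet ϖ T := by
  -- Expanding a product once leaves a sum of three products as remainder, so the coinductive
  -- witness must be closed under addition.
  set Q : AddSubmonoid H := AddSubmonoid.closure
    {x | ∃ a ∈ adicClosureSet ϖ T, ∃ b ∈ adicClosureSet ϖ T, x = a * b} with hQ
  have hprod : ∀ {a b}, a ∈ adicClosureSet ϖ T → b ∈ adicClosureSet ϖ T → a * b ∈ Q :=
    fun {a b} ha hb => AddSubmonoid.subset_closure ⟨a, ha, b, hb, rfl⟩
  refine ⟨Q, hprod ha hb, fun q hq => ?_⟩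
  induction hq using AddSubmonoid.closure_induction with
  | mem x hx =>
    obtain ⟨a, ha, b, hb, rfl⟩ := hx
    obtain ⟨u, hu, a', ha', rfl⟩ := exists_of_mem_adicClosureSet ha
    obtain ⟨v, hv, b', hb', rfl⟩ := exists_of_mem_adicClosureSet hb
    refine ⟨u * v, mul_mem hu hv, u * b' + a' * v + (ϖ * a') * b', ?_, by ring⟩
    exact add_mem (add_mem (hprod (mem_adicClosureSet_of_mem hu) hb')
      (hprod ha' (mem_adicClosureSet_of_mem hv))) (hprod (mul_mem_adicClosureSet_of_mem ha') hb')
  | zero => exact ⟨0, zero_mem _, 0, zero_mem _, by ring⟩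
  | add x y _ _ hx hy =>
    obtain ⟨u, hu, x', hx', rfl⟩ := hx
    obtain ⟨v, hv, y', hy', rfl⟩ := hy
    exact ⟨u + v, add_mem hu hv, x' + y', add_mem hx' hy', by ring⟩

variable (ϖ T) in
/-- The subring of all sums `∑ ϖ ^ n * u n` with all `u n` in `T`. -/
def adicClosure : Subring H where
  carrier := adicClosureSet ϖ T
  mul_mem' := mul_mem_adicClosureSet
  one_mem' := mem_adicClosureSet_of_mem (one_mem _)
  add_mem' := add_mem_adicClosureSet
  zero_mem' := mem_adicClosureSet_of_mem (zero_mem _)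
  neg_mem' := fun {x} hx => by
    have := mul_mem_adicClosureSet (mem_adicClosureSet_of_mem (neg_mem (one_mem T))) hx
    rwa [neg_one_mul] at this

theorem le_adicClosure : T ≤ adicClosure ϖ T := fun _ => mem_adicClosureSet_of_mem

theorem exists_of_mem_adicClosure {h : H} (hh : h ∈ adicClosure ϖ T) :
    ∃ u ∈ T, ∃ h' ∈ adicClosure ϖ T, h = u + ϖ * h' :=
  exists_of_mem_adicClosureSet hh

theorem mul_mem_adicClosure {h : H} (hh : h ∈ adicClosure ϖ T) : ϖ * h ∈ adicClosure ϖ T :=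
  mul_mem_adicClosureSet_of_mem hh

/-- Coinduction up to elements of the closure. -/
theorem mem_adicClosure_of_set {Q : Set H}
    (hQ : ∀ q ∈ Q, ∃ s ∈ adicClosure ϖ T, ∃ q' ∈ Q, q = s + ϖ * q') {q : H} (hq : q ∈ Q) :
    q ∈ adicClosure ϖ T := by
  refine ⟨{x | ∃ s ∈ adicClosure ϖ T, ∃ q ∈ Q, x = s + q}, ⟨0, zero_mem _, q, hq, by ring⟩, ?_⟩
  rintro _ ⟨s, hs, q, hq, rfl⟩
  obtain ⟨s₁, hs₁, q', hq', rfl⟩ := hQ q hq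
  obtain ⟨u, hu, s', hs', e⟩ := exists_of_mem_adicClosure (add_mem hs hs₁)
  exact ⟨u, hu, s' + q', ⟨s', hs', q', hq', rfl⟩, by rw [← add_assoc, e]; ring⟩

/-- The q n play the role of the tails of a series divided by ϖ^n. Membership of a limit is always
checked through this recursion, with no topology on H. -/
theorem mem_adicClosure_of_seq {q s : ℕ → H} (hs : ∀ n, s n ∈ adicClosure ϖ T)
    (hq : ∀ n, q n = s n + ϖ * q (n + 1)) (n : ℕ) : q n ∈ adicClosure ϖ T :=
  mem_adicClosure_of_set (Q := Set.range q)
    (by rintro _ ⟨n, rfl⟩; exact ⟨s n, hs n, q (n + 1), ⟨n + 1, rfl⟩, hq n⟩) ⟨n, rfl⟩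

theorem adicClosure_mono {T' : Subring H} (h : T ≤ T') : adicClosure ϖ T ≤ adicClosure ϖ T' :=
  fun _ hx => mem_adicClosure_of_set (Q := adicClosure ϖ T) (fun q hq => by
    obtain ⟨u, hu, q', hq', e⟩ := exists_of_mem_adicClosure hq
    exact ⟨u, le_adicClosure (h hu), q', hq', e⟩) hx

end AdicClosure

/-! ### Rings with a Frobenius lift modulo a uniformizer -/

/-- A discrete valuation ring `O`, complete for its uniformizer `ϖ`, totally ramified over a
subring `R` with uniformizer `p`, with compatible endomorphisms `φ` of `R` and `O` that lift the
`p`-power Frobenius, and the corresponding Fermat quotient operator `δ`. -/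
structure FrobeniusRing (p : ℕ) (R O : Type*) [CommRing R] [CommRing O] [Algebra R O] where
  ϖ : O
  φR : R →+* R
  φ : O →+* O
  φ_algebraMap : ∀ r, φ (algebraMap R O r) = algebraMap R O (φR r)
  δ : O → O
  mul_δ : ∀ x, ϖ * δ x = φ x - x ^ p
  ne_zero : ϖ ≠ 0
  not_isUnit : ¬ IsUnit ϖ
  dvd_p : ϖ ∣ (p : O)
  p_dvd : ∃ e : ℕ, (p : O) ∣ ϖ ^ e
  dvd_φ : ϖ ∣ φ ϖ
  exists_digit : ∀ x : O, ∃ r : R, ϖ ∣ x - algebraMap R O r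
  p_dvd_of_dvd : ∀ r : R, ϖ ∣ algebraMap R O r → (p : R) ∣ r
  complete : IsAdicComplete (Ideal.span {ϖ}) O

namespace FrobeniusRing

variable {p : ℕ} {R O : Type*} [CommRing R] [CommRing O] [Algebra R O] (D : FrobeniusRing p R O)

theorem φ_eq (x : O) : D.φ x = x ^ p + D.ϖ * D.δ x := by rw [D.mul_δ]; ring

/-- The sum of a series `∑ ϖ ^ l * c l`. -/
theorem exists_series (c : ℕ → O) :
    ∃ s : O, ∀ N, D.ϖ ^ N ∣ s - ∑ l ∈ Finset.range N, D.ϖ ^ l * c l := by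
  have := D.complete
  obtain ⟨L, hL⟩ := IsPrecomplete.prec (I := Ideal.span {D.ϖ}) (M := O) inferInstance
    (f := fun N => ∑ l ∈ Finset.range N, D.ϖ ^ l * c l) (fun {m n} hmn => by
      rw [SModEq.sub_mem, smul_eq_mul, Ideal.mul_top, Ideal.span_singleton_pow,
        Ideal.mem_span_singleton, ← neg_sub, dvd_neg, ← Finset.sum_Ico_eq_sub _ hmn]
      exact Finset.dvd_sum fun i hi =>
        (pow_dvd_pow _ (Finset.mem_Ico.1 hi).1).mul_right _)
  refine ⟨L, fun N => ?_⟩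
  have := hL N
  rwa [SModEq.sub_mem, smul_eq_mul, Ideal.mul_top, Ideal.span_singleton_pow,
    Ideal.mem_span_singleton, ← neg_sub, dvd_neg] at this

theorem eq_zero_of_forall_dvd {x : O} (h : ∀ N, D.ϖ ^ N ∣ x) : x = 0 := by
  have := D.complete
  refine IsHausdorff.haus (I := Ideal.span {D.ϖ}) (M := O) inferInstance x fun n => ?_
  rw [SModEq.sub_mem, smul_eq_mul, Ideal.mul_top, Ideal.span_singleton_pow,
    Ideal.mem_span_singleton, sub_zero]
  exact h n

theorem iInf_span_pow : ⨅ n : ℕ, (Ideal.span {D.ϖ}) ^ n = ⊥ := by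
  rw [eq_bot_iff]
  intro x hx
  refine D.eq_zero_of_forall_dvd fun N => ?_
  rw [← Ideal.mem_span_singleton, ← Ideal.span_singleton_pow]
  exact (Ideal.mem_iInf.1 hx) N

end FrobeniusRing

end ArithDiff

/-! ### Functions of finite order on the O-points, and Frobenius on sections -/

namespace ArithDiff

namespace FrobeniusRing

variable {p : ℕ} {R O A : Type*} [CommRing R] [CommRing O] [Algebra R O]
  (D : FrobeniusRing p R O) [CommRing A] [Algebra R A] {d : ℕ} (t : Fin d → A)

/-- An element of `A` as a function on the `O`-points of `A`. -/
def ev (R O A : Type*) [CommRing R] [CommRing O] [Algebra R O] [CommRing A] [Algebra R A] :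
    A →+* ((A →ₐ[R] O) → O) :=
  RingHom.pi fun a => a.toRingHom

@[simp]
theorem ev_apply (s : A) (a : A →ₐ[R] O) : ev R O A s a = a s := rfl

/-- The uniformizer as a constant function on the points. -/
def cϖ (A : Type*) [CommRing A] [Algebra R A] : (A →ₐ[R] O) → O := fun _ => D.ϖ

/-- The Frobenius lift applied to the values of a function. -/
def φfun (A : Type*) [CommRing A] [Algebra R A] : ((A →ₐ[R] O) → O) →+* ((A →ₐ[R] O) → O) :=
  D.φ.compLeft _

@[simp]
theorem φfun_apply (h : (A →ₐ[R] O) → O) (a : A →ₐ[R] O) : D.φfun A h a = D.φ (h a) := rfl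

/-- Evaluation of polynomials in the derivatives `δ t, …, δ ^ r t` over `A` on the points. -/
noncomputable def jetEval (r : ℕ) : MvPolynomial (Fin d × Fin r) A →+* ((A →ₐ[R] O) → O) :=
  MvPolynomial.eval₂Hom (ev R O A) fun ij a => D.δ^[(ij.2 : ℕ) + 1] (a (t ij.1))

/-- The ring of functions of order at most `r`: the `ϖ`-adic closure of the polynomial functions in
the derivatives of the coordinates `t`. -/
noncomputable def jetRing (r : ℕ) : Subring ((A →ₐ[R] O) → O) := adicClosure (D.cϖ A) (D.jetEval t r).range

theorem jetEval_apply (r : ℕ) (G : MvPolynomial (Fin d × Fin r) A) (a : A →ₐ[R] O) :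
    D.jetEval t r G a =
      MvPolynomial.eval₂ a.toRingHom (fun ij => D.δ^[(ij.2 : ℕ) + 1] (a (t ij.1))) G := by
  have : ((Pi.evalRingHom (fun _ : A →ₐ[R] O => O) a).comp (D.jetEval t r)) =
      MvPolynomial.eval₂Hom a.toRingHom (fun ij => D.δ^[(ij.2 : ℕ) + 1] (a (t ij.1))) := by
    refine MvPolynomial.ringHom_ext ?_ ?_
    · intro s; simp [jetEval]
    · intro ij; simp [jetEval]
  exact RingHom.congr_fun this G

theorem ev_mem (r : ℕ) (s : A) : ev R O A s ∈ D.jetRing t r :=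
  le_adicClosure ⟨MvPolynomial.C s, by simp [jetEval]⟩

/-- Total ramification: a constant of O has a ϖ-adic expansion with digits in R, and these are
values of elements of A. Thus polynomials over A suffice in the definition of `jetRing`. -/
theorem const_mem (r : ℕ) (c : O) : (fun _ => c) ∈ D.jetRing t r := by
  refine mem_adicClosure_of_set (Q := {h | ∃ c, h = fun _ => c}) ?_ ⟨c, rfl⟩
  rintro _ ⟨c, rfl⟩
  obtain ⟨x, y, hy⟩ := D.exists_digit c
  refine ⟨_, D.ev_mem t r (algebraMap R A x), fun _ => y, ⟨y, rfl⟩, funext fun a => ?_⟩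
  simp only [Pi.add_apply, Pi.mul_apply, ev_apply, AlgHom.commutes, cϖ]
  rw [← hy]; ring

theorem δ_coord_mem {r j : ℕ} (h : j ≤ r) (i : Fin d) :
    (fun a : A →ₐ[R] O => D.δ^[j] (a (t i))) ∈ D.jetRing t r := by
  cases j with
  | zero => exact D.ev_mem t r (t i)
  | succ j => exact le_adicClosure ⟨MvPolynomial.X (i, ⟨j, h⟩), by simp [jetEval]⟩

theorem jetRing_mono {r r' : ℕ} (h : r ≤ r') : D.jetRing t r ≤ D.jetRing t r' := by
  refine adicClosure_mono ?_
  rintro _ ⟨G, rfl⟩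
  refine ⟨MvPolynomial.rename (Prod.map id (Fin.castLE h)) G, ?_⟩
  simp only [jetEval, MvPolynomial.coe_eval₂Hom, MvPolynomial.eval₂_rename]
  rfl

theorem mul_mem_jetRing {r : ℕ} {h : (A →ₐ[R] O) → O} (hh : h ∈ D.jetRing t r) :
    D.cϖ A * h ∈ D.jetRing t r := mul_mem_adicClosure hh

/-- The uniformizer in the ring of functions of order at most `r`. -/
noncomputable def jetϖ (r : ℕ) : D.jetRing t r := ⟨D.cϖ A, D.const_mem t r D.ϖ⟩

theorem cancel [IsDomain O] {f g : (A →ₐ[R] O) → O} (h : D.cϖ A * f = D.cϖ A * g) : f = g :=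
  funext fun a => mul_left_cancel₀ D.ne_zero (congrFun h a)

theorem cancel_pow [IsDomain O] {n : ℕ} {f g : (A →ₐ[R] O) → O}
    (h : D.cϖ A ^ n * f = D.cϖ A ^ n * g) : f = g :=
  funext fun a => mul_left_cancel₀ (pow_ne_zero n D.ne_zero) (congrFun h a)

/-- Limits are taken pointwise in the complete ring O; what needs proof is that they have finite
order again. Completeness allows homomorphisms to be lifted into the jet ring along étale
coordinates. -/
theorem isAdicComplete_jetRing [IsDomain O] (r : ℕ) :
    IsAdicComplete (Ideal.span {D.jetϖ t r}) (D.jetRing t r) where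
  haus' x hx := by
    refine Subtype.ext (funext fun a => D.eq_zero_of_forall_dvd fun N => ?_)
    have := hx N
    rw [SModEq.sub_mem, smul_eq_mul, Ideal.mul_top, Ideal.span_singleton_pow,
      Ideal.mem_span_singleton, sub_zero] at this
    obtain ⟨y, rfl⟩ := this
    exact ⟨(y : (A →ₐ[R] O) → O) a, rfl⟩
  prec' f hf := by
    have h1 : ∀ n, ∃ w : D.jetRing t r, f (n + 1) - f n = D.jetϖ t r ^ n * w := fun n => by
      have := (hf (Nat.le_succ n)).symm
      rw [SModEq.sub_mem, smul_eq_mul, Ideal.mul_top, Ideal.span_singleton_pow,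
        Ideal.mem_span_singleton] at this
      exact this
    choose w hw using h1
    have hfw : ∀ n, f n = f 0 + ∑ l ∈ Finset.range n, D.jetϖ t r ^ l * w l := fun n => by
      induction n with
      | zero => simp
      | succ n ih => rw [Finset.sum_range_succ, ← hw, ← add_assoc, ← ih]; ring
    have h2 : ∀ a : A →ₐ[R] O, ∃ s : O, ∀ N, D.ϖ ^ N ∣ s - (f N : (A →ₐ[R] O) → O) a := by
      intro a
      obtain ⟨s, hs⟩ := D.exists_series fun l => (w l : (A →ₐ[R] O) → O) a
      refine ⟨(f 0 : (A →ₐ[R] O) → O) a + s, fun N => ?_⟩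
      have e := congrFun (congrArg Subtype.val (hfw N)) a
      simp only [Subring.coe_add, Subring.coe_mul, Subring.coe_pow, AddSubmonoidClass.coe_finsetSum,
        Pi.add_apply, Finset.sum_apply, Pi.mul_apply, Pi.pow_apply] at e
      rw [e, add_sub_add_left_eq_sub]
      exact hs N
    choose L hL using h2
    choose g hg using hL
    have hLg : ∀ n, L - f n = D.cϖ A ^ n * (fun a => g a n) := fun n =>
      funext fun a => hg a n
    -- The remainders (L - f n)/ϖ^n satisfy the recursion of `mem_adicClosure_of_seq`, so they, and
    -- L with them, lie in the jet ring.
    have hrec : ∀ n, (fun a => g a n) = w n + D.cϖ A * (fun a => g a (n + 1)) := fun n => by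
      refine D.cancel_pow (n := n) ?_
      rw [← hLg, mul_add, ← mul_assoc, ← pow_succ, ← hLg]
      have e : (f (n + 1) : (A →ₐ[R] O) → O) - f n = D.cϖ A ^ n * w n :=
        congrArg Subtype.val (hw n)
      rw [← e]; ring
    have hgm : ∀ n, (fun a => g a n) ∈ D.jetRing t r :=
      mem_adicClosure_of_seq (s := fun n => (w n : (A →ₐ[R] O) → O)) (fun n => (w n).2) hrec
    have hLm : L ∈ D.jetRing t r := by
      have := hLg 0
      rw [pow_zero, one_mul, sub_eq_iff_eq_add] at this
      rw [this]
      exact add_mem (hgm 0) (f 0).2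
    refine ⟨⟨L, hLm⟩, fun n => SModEq.symm ?_⟩
    rw [SModEq.sub_mem, smul_eq_mul, Ideal.mul_top, Ideal.span_singleton_pow,
      Ideal.mem_span_singleton]
    exact ⟨⟨_, hgm n⟩, Subtype.ext (hLg n)⟩

variable {t} {θ : MvPolynomial (Fin d) R →+* A}

/-- `φ ∘ s` is congruent to `s ^ p` modulo `ϖ` in the ring of functions of order at most one. -/
theorem exists_φfun_ev [IsDomain O] [Fact p.Prime] [Nonempty (A →ₐ[R] O)] (hθ : θ.FormallyEtale)
    (hC : θ.comp MvPolynomial.C = algebraMap R A) (ht : ∀ i, θ (MvPolynomial.X i) = t i) (s : A) :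
    ∃ v ∈ D.jetRing t 1, D.φfun A (ev R O A s) = ev R O A s ^ p + D.cϖ A * v := by
  have := D.isAdicComplete_jetRing t 1
  set S := D.jetRing t 1
  set I : Ideal S := Ideal.span {D.jetϖ t 1} with hI
  have hmem : ∀ x : S, x ∈ I ↔ ∃ v ∈ S, (x : (A →ₐ[R] O) → O) = D.cϖ A * v := fun x => by
    rw [hI, Ideal.mem_span_singleton]
    exact ⟨fun ⟨y, hy⟩ => ⟨y, y.2, congrArg Subtype.val hy⟩,
      fun ⟨v, hv, e⟩ => ⟨⟨v, hv⟩, Subtype.ext e⟩⟩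
  obtain ⟨a₀⟩ := ‹Nonempty (A →ₐ[R] O)›
  -- Evaluation at a point shows that ϖ is not a unit among the functions. Together with ϖ ∣ p this
  -- gives characteristic p, so that x ↦ x^p is a homomorphism of S/I.
  have hnt : Nontrivial (S ⧸ I) := by
    refine Ideal.Quotient.nontrivial_iff.2 fun h => D.not_isUnit ?_
    obtain ⟨v, -, hv⟩ := (hmem 1).1 (h ▸ Submodule.mem_top)
    exact IsUnit.of_mul_eq_one (v a₀) (congrFun hv a₀).symm
  obtain ⟨c, hc⟩ := D.dvd_p
  have hchar : CharP (S ⧸ I) p := by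
    refine ringChar.of_eq (((Nat.dvd_prime (Fact.out : p.Prime)).1 (ringChar.dvd ?_)).resolve_left
      (CharP.char_ne_one (S ⧸ I) _))
    rw [← map_natCast (Ideal.Quotient.mk I), Ideal.Quotient.eq_zero_iff_mem, hmem]
    exact ⟨_, D.const_mem t 1 c, by ext a; simp [cϖ, hc]⟩
  let evS : A →+* S := (ev R O A).codRestrict S (D.ev_mem t 1)
  let β : A →+* S ⧸ I := (frobenius (S ⧸ I) p).comp ((Ideal.Quotient.mk I).comp evS)
  -- The only possible values of φ on coordinates: `φR` on coefficients and t ↦ t^p + ϖ δt. Modulo ϖ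
  -- this is the p-th power map β.
  let α : MvPolynomial (Fin d) R →+* S := MvPolynomial.eval₂Hom
    (evS.comp ((algebraMap R A).comp D.φR))
    (fun i => evS (t i) ^ p + D.jetϖ t 1 * ⟨_, D.δ_coord_mem t le_rfl i⟩)
  have hβα : β.comp θ = (Ideal.Quotient.mk I).comp α := by
    refine MvPolynomial.ringHom_ext (fun x => ?_) fun i => ?_
    · have e : θ (MvPolynomial.C x) = algebraMap R A x := RingHom.congr_fun hC x
      simp only [β, α, RingHom.comp_apply, frobenius_def, e, MvPolynomial.coe_eval₂Hom,
        MvPolynomial.eval₂_C, ← map_pow]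
      refine Eq.symm (Ideal.Quotient.eq.2 ((hmem _).2
        ⟨_, D.const_mem t 1 (D.δ (algebraMap R O x)), funext fun a => ?_⟩))
      simp only [cϖ, Pi.mul_apply, D.mul_δ, D.φ_algebraMap]
      simp [evS]
    · simp only [β, α, RingHom.comp_apply, frobenius_def, ht, MvPolynomial.coe_eval₂Hom,
        MvPolynomial.eval₂_X, map_add, map_mul, map_pow]
      rw [Ideal.Quotient.eq_zero_iff_mem.2 (Ideal.mem_span_singleton_self (D.jetϖ t 1))]
      simp
  obtain ⟨γ, hγ, hγβ⟩ := exists_lift_of_isAdicComplete hθ I α β hβα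
  have key : ∀ x, D.φfun A (ev R O A x) = γ x := by
    intro x
    funext a
    -- The abstract lift γ is φ itself: at each point a, both homomorphisms A → O agree on
    -- coordinates and reduce to the p-th power of a modulo ϖ.
    let g₁ : A →+* O := D.φ.comp a.toRingHom
    let g₂ : A →+* O := (Pi.evalRingHom (fun _ : A →ₐ[R] O => O) a).comp (S.subtype.comp γ)
    have hg : g₁ = g₂ := by
      refine eq_of_comp_eq_of_sub_mem hθ (Ideal.span {D.ϖ}) D.iInf_span_pow ?_ fun x => ?_
      · have e2 : g₂.comp θ = (Pi.evalRingHom (fun _ : A →ₐ[R] O => O) a).comp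
            (S.subtype.comp α) := by rw [← hγ]; rfl
        rw [e2]
        refine MvPolynomial.ringHom_ext (fun x => ?_) fun i => ?_
        · have e : θ (MvPolynomial.C x) = algebraMap R A x := RingHom.congr_fun hC x
          simp [g₁, e, α, evS, D.φ_algebraMap]
        · simp [g₁, ht, α, evS, D.φ_eq, jetϖ, cϖ]
      · rw [Ideal.mem_span_singleton]
        have e : Ideal.Quotient.mk I (γ x) = Ideal.Quotient.mk I (evS x ^ p) := by
          have := RingHom.congr_fun hγβ x
          rw [RingHom.comp_apply] at this
          rw [this]; simp [β, frobenius_def]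
        obtain ⟨v, -, hv⟩ := (hmem _).1 (Ideal.Quotient.eq.1 e)
        have hv' : (γ x : (A →ₐ[R] O) → O) a - a x ^ p = D.ϖ * v a := congrFun hv a
        refine ⟨D.δ (a x) - v a, ?_⟩
        rw [mul_sub, ← hv', D.mul_δ]
        simp [g₁, g₂]
    exact RingHom.congr_fun hg x
  have e : Ideal.Quotient.mk I (γ s) = Ideal.Quotient.mk I (evS s ^ p) := by
    have := RingHom.congr_fun hγβ s
    rw [RingHom.comp_apply] at this
    rw [this]; simp [β, frobenius_def]
  obtain ⟨v, hvm, hv⟩ := (hmem _).1 (Ideal.Quotient.eq.1 e)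
  refine ⟨v, hvm, ?_⟩
  rw [key s, ← hv]
  simp [evS]

end FrobeniusRing

end ArithDiff

/-! ### Closure of the functions of finite order under φ, δ and restricted power series -/

namespace ArithDiff

namespace FrobeniusRing

variable {p : ℕ} {R O A : Type*} [CommRing R] [CommRing O] [Algebra R O]
  (D : FrobeniusRing p R O) [CommRing A] [Algebra R A] {d : ℕ} {t : Fin d → A}
  {θ : MvPolynomial (Fin d) R →+* A}

/-- The congruence `φ ∘ u ≡ u ^ p` modulo `ϖ` in the ring of functions of order at most `r` is
stable under addition. -/
theorem frobenius_add [Fact p.Prime] {r : ℕ} {u₁ u₂ v₁ v₂ : (A →ₐ[R] O) → O}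
    (hu₁ : u₁ ∈ D.jetRing t r) (hu₂ : u₂ ∈ D.jetRing t r)
    (hv₁ : v₁ ∈ D.jetRing t r) (hv₂ : v₂ ∈ D.jetRing t r)
    (h₁ : D.φfun A u₁ = u₁ ^ p + D.cϖ A * v₁) (h₂ : D.φfun A u₂ = u₂ ^ p + D.cϖ A * v₂) :
    ∃ v ∈ D.jetRing t r, D.φfun A (u₁ + u₂) = (u₁ + u₂) ^ p + D.cϖ A * v := by
  obtain ⟨w, hw⟩ := exists_add_pow_prime_eq (Fact.out : p.Prime)
    (⟨u₁, hu₁⟩ : D.jetRing t r) ⟨u₂, hu₂⟩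
  obtain ⟨c, hc⟩ := D.dvd_p
  have hw' : (u₁ + u₂) ^ p = u₁ ^ p + u₂ ^ p + (p : (A →ₐ[R] O) → O) * u₁ * u₂ * w :=
    congrArg Subtype.val hw
  have hp : (p : (A →ₐ[R] O) → O) = D.cϖ A * (fun _ => c) := by ext a; simp [cϖ, hc]
  refine ⟨v₁ + v₂ - (fun _ => c) * u₁ * u₂ * (w : (A →ₐ[R] O) → O), sub_mem (add_mem hv₁ hv₂)
    (mul_mem (mul_mem (mul_mem (D.const_mem t r c) hu₁) hu₂) w.2), ?_⟩
  rw [map_add, h₁, h₂, hw', hp]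
  ring

/-- The congruence holds on sections by étaleness and on δ^(j+1) t by the definition of δ, with
remainder δ^(j+2) t. That is why the order rises by one. Sums and products preserve it. -/
theorem exists_φfun_jetEval [IsDomain O] [Fact p.Prime] [Nonempty (A →ₐ[R] O)]
    (hθ : θ.FormallyEtale) (hC : θ.comp MvPolynomial.C = algebraMap R A)
    (ht : ∀ i, θ (MvPolynomial.X i) = t i) (r : ℕ) (G : MvPolynomial (Fin d × Fin r) A) :
    ∃ v ∈ D.jetRing t (r + 1),
      D.φfun A (D.jetEval t r G) = D.jetEval t r G ^ p + D.cϖ A * v := by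
  have hT : ∀ G, D.jetEval t r G ∈ D.jetRing t (r + 1) := fun G =>
    D.jetRing_mono t (Nat.le_succ r) (le_adicClosure ⟨G, rfl⟩)
  induction G using MvPolynomial.induction_on with
  | C s =>
    obtain ⟨v, hv, e⟩ := D.exists_φfun_ev hθ hC ht s
    refine ⟨v, D.jetRing_mono t (by omega) hv, ?_⟩
    rw [show D.jetEval t r (MvPolynomial.C s) = ev R O A s by simp [jetEval], e]
  | add G₁ G₂ h₁ h₂ =>
    obtain ⟨v₁, hv₁, e₁⟩ := h₁
    obtain ⟨v₂, hv₂, e₂⟩ := h₂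
    rw [map_add]
    exact D.frobenius_add (hT G₁) (hT G₂) hv₁ hv₂ e₁ e₂
  | mul_X G ij h =>
    obtain ⟨v, hv, e⟩ := h
    have hx := hT (MvPolynomial.X ij)
    set x := D.jetEval t r (MvPolynomial.X ij) with hxdef
    have hy : (fun a : A →ₐ[R] O => D.δ^[(ij.2 : ℕ) + 2] (a (t ij.1))) ∈ D.jetRing t (r + 1) :=
      D.δ_coord_mem t (by have := ij.2.2; omega) _
    have ex : D.φfun A x = x ^ p + D.cϖ A *
        (fun a : A →ₐ[R] O => D.δ^[(ij.2 : ℕ) + 2] (a (t ij.1))) := by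
      funext a
      simp only [hxdef, jetEval, MvPolynomial.coe_eval₂Hom, MvPolynomial.eval₂_X, φfun_apply,
        D.φ_eq, Pi.add_apply, Pi.mul_apply, Pi.pow_apply, cϖ]
      rw [← Function.iterate_succ_apply' D.δ]
    rw [map_mul, ← hxdef, map_mul, e, ex]
    refine ⟨D.jetEval t r G ^ p * _ + v * (x ^ p + D.cϖ A * _), add_mem
      (mul_mem (pow_mem (hT G) p) hy)
      (mul_mem hv (add_mem (pow_mem hx p) (D.mul_mem_jetRing t hy))), ?_⟩
    ring

theorem φfun_mem [IsDomain O] [Fact p.Prime] [Nonempty (A →ₐ[R] O)]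
    (hθ : θ.FormallyEtale) (hC : θ.comp MvPolynomial.C = algebraMap R A)
    (ht : ∀ i, θ (MvPolynomial.X i) = t i) {r : ℕ} {u : (A →ₐ[R] O) → O}
    (hu : u ∈ D.jetRing t r) : D.φfun A u ∈ D.jetRing t (r + 1) := by
  obtain ⟨ε, hε⟩ := D.dvd_φ
  have hϖ : D.φfun A (D.cϖ A) = D.cϖ A * (fun _ => ε) := by ext a; simp [cϖ, hε]
  -- Since φ(ϖ) = ϖε, each step of the expansion of u contributes a factor ε. The witness therefore
  -- allows an arbitrary multiplier s from the jet ring.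
  refine mem_adicClosure_of_set
    (Q := {q | ∃ s ∈ D.jetRing t (r + 1), ∃ u ∈ D.jetRing t r, q = s * D.φfun A u}) ?_
    ⟨1, one_mem _, u, hu, by rw [one_mul]⟩
  rintro _ ⟨s, hs, u, hu, rfl⟩
  obtain ⟨_, ⟨G, rfl⟩, u', hu', rfl⟩ := exists_of_mem_adicClosure hu
  obtain ⟨v, hv, e⟩ := D.exists_φfun_jetEval hθ hC ht r G
  refine ⟨s * D.φfun A (D.jetEval t r G), mul_mem hs ?_, s * (fun _ => ε) * D.φfun A u',
    ⟨_, mul_mem hs (D.const_mem t _ ε), u', hu', rfl⟩, ?_⟩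
  · rw [e]
    exact add_mem (pow_mem (D.jetRing_mono t (Nat.le_succ r) (le_adicClosure ⟨G, rfl⟩)) p)
      (D.mul_mem_jetRing t hv)
  · rw [map_add, map_mul, hϖ]; ring

/-- Write u = G + ϖu' with G polynomial. Both summands satisfy the Frobenius congruence with
remainder of order r + 1, hence so does u, and that remainder is δ ∘ u. -/
theorem δ_comp_mem [IsDomain O] [Fact p.Prime] [Nonempty (A →ₐ[R] O)]
    (hθ : θ.FormallyEtale) (hC : θ.comp MvPolynomial.C = algebraMap R A)
    (ht : ∀ i, θ (MvPolynomial.X i) = t i) {r : ℕ} {u : (A →ₐ[R] O) → O}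
    (hu : u ∈ D.jetRing t r) : (fun a => D.δ (u a)) ∈ D.jetRing t (r + 1) := by
  obtain ⟨ε, hε⟩ := D.dvd_φ
  have hϖ : D.φfun A (D.cϖ A) = D.cϖ A * (fun _ => ε) := by ext a; simp [cϖ, hε]
  obtain ⟨_, ⟨G, rfl⟩, u', hu', rfl⟩ := exists_of_mem_adicClosure hu
  obtain ⟨v, hv, e⟩ := D.exists_φfun_jetEval hθ hC ht r G
  have hle := D.jetRing_mono t (Nat.le_succ r)
  obtain ⟨m, hm⟩ : ∃ m, p = m + 1 := ⟨p - 1, by have := (Fact.out : p.Prime).pos; omega⟩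
  obtain ⟨w, hw, e'⟩ := D.frobenius_add (hle (le_adicClosure ⟨G, rfl⟩))
    (hle (D.mul_mem_jetRing t hu')) hv
    -- From φ(ϖu') = ϖ ε φ(u') and (ϖu')^p = ϖ · ϖ^(p-1) u'^p, with m = p - 1.
    (v₂ := (fun _ => ε) * D.φfun A u' - D.cϖ A ^ m * u' ^ p)
    (sub_mem (mul_mem (D.const_mem t _ ε) (D.φfun_mem hθ hC ht hu'))
      (mul_mem (pow_mem (D.const_mem t _ D.ϖ) m) (pow_mem (hle hu') p))) e
    (by rw [map_mul, hϖ, mul_pow]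
        have : D.cϖ A ^ p = D.cϖ A * D.cϖ A ^ m := by rw [← pow_succ', ← hm]
        rw [this]
        ring)
  convert hw using 1
  refine D.cancel ?_
  have : D.cϖ A * w = D.φfun A (D.jetEval t r G + D.cϖ A * u') -
      (D.jetEval t r G + D.cϖ A * u') ^ p := by rw [e']; ring
  rw [this]
  funext a
  exact D.mul_δ _

/-- This lets functions defined through arbitrary generators of A be rewritten through the
derivatives of étale coordinates alone. -/
theorem δ_iterate_mem [IsDomain O] [Fact p.Prime] [Nonempty (A →ₐ[R] O)]
    (hθ : θ.FormallyEtale) (hC : θ.comp MvPolynomial.C = algebraMap R A)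
    (ht : ∀ i, θ (MvPolynomial.X i) = t i) (j : ℕ) (s : A) :
    (fun a : A →ₐ[R] O => D.δ^[j] (a s)) ∈ D.jetRing t j := by
  induction j with
  | zero => exact D.ev_mem t 0 s
  | succ j ih =>
    simp only [Function.iterate_succ_apply']
    exact D.δ_comp_mem hθ hC ht ih

/-- A function that is the sum of a series with coefficients tending to zero and terms in the ring
of functions of order at most `r` is in that ring. -/
theorem mem_jetRing_of_series [IsDomain O] {ι : Type*} {r : ℕ} (F : ι → O)
    (M : ι → (A →ₐ[R] O) → O) (hM : ∀ m, M m ∈ D.jetRing t r)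
    (E : ℕ → Finset ι) (hE : ∀ N m, m ∈ E N ↔ ¬ D.ϖ ^ N ∣ F m)
    {h : (A →ₐ[R] O) → O} (hh : ∀ N a, D.ϖ ^ N ∣ h a - ∑ m ∈ E N, F m * M m a) :
    h ∈ D.jetRing t r := by
  classical
  choose g hg using hh
  have hsub : ∀ N, E N ⊆ E (N + 1) := fun N m hm => by
    rw [hE] at hm ⊢
    exact fun h => hm ((pow_dvd_pow _ (Nat.le_succ N)).trans h)
  have hc : ∀ N m, ∃ c, m ∈ E (N + 1) \ E N → F m = D.ϖ ^ N * c := fun N m => by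
    by_cases hm : m ∈ E (N + 1) \ E N
    · rw [Finset.mem_sdiff, hE N, not_not] at hm
      obtain ⟨c, hc⟩ := hm.2
      exact ⟨c, fun _ => hc⟩
    · exact ⟨0, fun h => absurd h hm⟩
  choose c hc using hc
  -- The indices in E (N + 1) but not in E N have coefficients divisible by ϖ^N. Dividing by ϖ^N
  -- gives the recursion for the remainders g N.
  have hmem : ∀ N, g N ∈ D.jetRing t r := by
    refine mem_adicClosure_of_seq (s := fun N => ∑ m ∈ E (N + 1) \ E N, (fun _ => c N m) * M m)
      (fun N => sum_mem fun m _ => mul_mem (D.const_mem t r _) (hM m)) fun N => ?_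
    refine D.cancel_pow (n := N) (funext fun a => ?_)
    simp only [Pi.mul_apply, Pi.pow_apply, Pi.add_apply, Finset.sum_apply, cϖ]
    rw [mul_add, ← mul_assoc, ← pow_succ, ← hg, ← hg, Finset.mul_sum]
    have : ∑ m ∈ E (N + 1) \ E N, D.ϖ ^ N * (c N m * M m a) =
        ∑ m ∈ E (N + 1) \ E N, F m * M m a :=
      Finset.sum_congr rfl fun m hm => by rw [hc N m hm]; ring
    rw [this, ← Finset.sum_sdiff (hsub N)]
    ring
  have h0 : E 0 = ∅ := Finset.eq_empty_of_forall_notMem fun m hm => by simp [hE] at hm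
  convert hmem 0 using 1
  funext a
  have := hg 0 a
  simpa [h0] using this

end FrobeniusRing

end ArithDiff

namespace ArithDiff

/-! ### Taylor expansions along a section -/

section Taylor

open MvPolynomial

theorem aeval_mem_pow_of_mem {R O σ : Type*} [CommRing R] [CommRing O] [Algebra R O] {y : σ → O}
    {J : Ideal O} (hy : ∀ i, y i ∈ J) {n : ℕ} {G : MvPolynomial σ R}
    (hG : G ∈ idealOfVars σ R ^ n) : aeval y G ∈ J ^ n := by
  have h1 : (idealOfVars σ R).map (aeval y : MvPolynomial σ R →ₐ[R] O) ≤ J := by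
    rw [idealOfVars, Ideal.map_span, Ideal.span_le]
    rintro _ ⟨_, ⟨i, rfl⟩, rfl⟩
    simpa using hy i
  have h2 := Ideal.mem_map_of_mem (aeval y : MvPolynomial σ R →ₐ[R] O) hG
  rw [Ideal.map_pow] at h2
  exact Ideal.pow_right_mono h1 n h2

theorem sub_C_constantCoeff_mem {R σ : Type*} [CommRing R] (G : MvPolynomial σ R) :
    G - C (constantCoeff G) ∈ idealOfVars σ R := by
  rw [← pow_one (idealOfVars σ R), mem_pow_idealOfVars_iff']
  intro x hx
  have : x = 0 := by
    rw [← Finsupp.degree_eq_zero_iff]; omega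
  rw [this]
  simp [constantCoeff_eq]

theorem coeff_sumElim {R σ τ : Type*} [CommRing R] (F : MvPolynomial (σ ⊕ τ) R) (β : σ →₀ ℕ)
    (α : τ →₀ ℕ) : coeff (Finsupp.sumElim β α) F = coeff α (coeff β (sumAlgEquiv R σ τ F)) := by
  classical
  induction F using MvPolynomial.induction_on' with
  | monomial γ r =>
    obtain ⟨⟨β', α'⟩, rfl⟩ := (Finsupp.sumFinsuppEquivProdFinsupp).symm.surjective γ
    have e : sumAlgEquiv R σ τ (monomial (Finsupp.sumElim β' α') r) =
        monomial β' (monomial α' r) := by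
      rw [monomial_eq, map_mul, sumAlgEquiv_C_inl, Finsupp.prod, map_prod]
      simp only [map_pow]
      change _ * (Finsupp.sumElim β' α').prod
        (fun i e => sumAlgEquiv R σ τ (X i) ^ e) = _
      rw [Finsupp.prod_sumElim]
      simp only [Function.comp_def, sumAlgEquiv_X_inl, sumAlgEquiv_X_inr, Finsupp.prod]
      rw [monomial_eq (s := β'), monomial_eq (s := α'), map_mul, Finsupp.prod, Finsupp.prod,
        map_prod]
      simp only [map_pow]
      ring
    have e' : (Finsupp.sumFinsuppEquivProdFinsupp.symm (β', α') : σ ⊕ τ →₀ ℕ) =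
      Finsupp.sumElim β' α' := rfl
    rw [e', e, coeff_monomial, coeff_monomial]
    have hinj : Finsupp.sumElim β' α' = Finsupp.sumElim β α ↔ β' = β ∧ α' = α := by
      rw [← e', show Finsupp.sumElim β α =
        Finsupp.sumFinsuppEquivProdFinsupp.symm (β, α) from rfl, Equiv.apply_eq_iff_eq,
        Prod.mk.injEq]
    rw [if_congr hinj rfl rfl]
    by_cases h1 : β' = β <;> by_cases h2 : α' = α <;> simp [h1, h2, coeff_monomial]
  | add F G hF hG => simp [hF, hG]

variable {R A : Type*} [CommRing R] [CommRing A] [Algebra R A] {d : ℕ}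
  {t : Fin d → A} {θ : MvPolynomial (Fin d) R →+* A}

/-- P is a point of A over the constant-term quotient of R[X]/(X)^n, a nilpotent thickening, so it
lifts uniquely with t ↦ X. The lift τ is the Taylor expansion at P to order n. The last clause says
that its constant term is the value at P. -/
theorem exists_taylor (hθ : θ.FormallyEtale) (hC : θ.comp C = algebraMap R A)
    (ht : ∀ i, θ (X i) = t i) (P : A →ₐ[R] R) (hP : ∀ i, P (t i) = 0) {n : ℕ} (hn : n ≠ 0) :
    ∃ τ : A →+* MvPolynomial (Fin d) R ⧸ idealOfVars (Fin d) R ^ n,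
      τ.comp θ = Ideal.Quotient.mk _ ∧
      ∀ s G, Ideal.Quotient.mk _ G = τ s → constantCoeff G = P s := by
  set I := idealOfVars (Fin d) R
  have hI0 : ∀ G ∈ I, constantCoeff G = 0 := fun G hG => by
    rw [← pow_one I, mem_pow_idealOfVars_iff'] at hG
    exact hG 0 (by simp)
  let q : MvPolynomial (Fin d) R ⧸ I ^ n →+* R :=
    Ideal.Quotient.lift (I ^ n) constantCoeff fun G hG => hI0 G (Ideal.pow_le_self hn hG)
  have hq : Function.Surjective q := fun r => ⟨Ideal.Quotient.mk _ (C r), by simp [q]⟩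
  have hker : IsNilpotent (RingHom.ker q) := by
    refine ⟨n, ?_⟩
    have : RingHom.ker q ≤ I.map (Ideal.Quotient.mk (I ^ n)) := by
      intro x hx
      obtain ⟨G, rfl⟩ := Ideal.Quotient.mk_surjective x
      have h0 : constantCoeff G = 0 := hx
      refine Ideal.mem_map_of_mem _ ?_
      have := sub_C_constantCoeff_mem G
      rwa [h0, map_zero, sub_zero] at this
    rw [Submodule.zero_eq_bot, eq_bot_iff]
    refine (Ideal.pow_right_mono this n).trans ?_
    rw [← Ideal.map_pow, Ideal.map_quotient_self]
  obtain ⟨τ, h1, h2⟩ := exists_lift_of_isNilpotent hθ q hq hker (Ideal.Quotient.mk _) P.toRingHom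
    (by
      refine MvPolynomial.ringHom_ext (fun x => ?_) fun i => ?_
      · have e : θ (C x) = algebraMap R A x := RingHom.congr_fun hC x
        simp [e, q]
      · simp [ht, hP, q])
  refine ⟨τ, h1, fun s G hG => ?_⟩
  have := RingHom.congr_fun h2 s
  rw [RingHom.comp_apply, ← hG] at this
  exact this

/-- The ideal of the point `P` modulo `p`. -/
def pointIdeal (p : ℕ) (P : A →ₐ[R] R) : Ideal A := Ideal.comap P (Ideal.span {(p : R)})

theorem comp_eq_constantCoeff (hC : θ.comp C = algebraMap R A)
    (ht : ∀ i, θ (X i) = t i) (P : A →ₐ[R] R) (hP : ∀ i, P (t i) = 0)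
    (G : MvPolynomial (Fin d) R) : P (θ G) = constantCoeff G := by
  have : P.toRingHom.comp θ = constantCoeff := by
    refine MvPolynomial.ringHom_ext (fun x => ?_) fun i => ?_
    · have e : θ (C x) = algebraMap R A x := RingHom.congr_fun hC x
      simp [e]
    · simp [ht, hP]
  exact RingHom.congr_fun this G

theorem eq_aeval (hC : θ.comp C = algebraMap R A) (ht : ∀ i, θ (X i) = t i)
    (G : MvPolynomial (Fin d) R) : θ G = aeval t G := by
  have : θ = (aeval t : MvPolynomial (Fin d) R →ₐ[R] A).toRingHom := by
    refine MvPolynomial.ringHom_ext (fun x => ?_) fun i => ?_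
    · have e : θ (C x) = algebraMap R A x := RingHom.congr_fun hC x
      simp [e]
    · simp [ht]
  exact RingHom.congr_fun this G

theorem coord_mem_pointIdeal (p : ℕ) {P : A →ₐ[R] R} (hP : ∀ i, P (t i) = 0) (i : Fin d) :
    t i ∈ pointIdeal p P := by
  rw [pointIdeal, Ideal.mem_comap, hP]; exact zero_mem _

/-- An element whose Taylor expansion vanishes modulo `p` up to order `n₀` vanishes at the point
modulo `p` to order `n₀`. -/
theorem mem_of_taylor_coeff (p : ℕ) (hθ : θ.FormallyEtale) (hC : θ.comp C = algebraMap R A)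
    (ht : ∀ i, θ (X i) = t i) (P : A →ₐ[R] R) (hP : ∀ i, P (t i) = 0) {n n₀ : ℕ} (hn : n₀ ≤ n)
    {τ : A →+* MvPolynomial (Fin d) R ⧸ idealOfVars (Fin d) R ^ n}
    (hτ : τ.comp θ = Ideal.Quotient.mk _)
    (hτ0 : ∀ s G, Ideal.Quotient.mk _ G = τ s → constantCoeff G = P s)
    {c : A} {G : MvPolynomial (Fin d) R} (hG : Ideal.Quotient.mk _ G = τ c)
    (hcoeff : ∀ α, Finsupp.degree α < n₀ → (p : R) ∣ coeff α G) :
    c ∈ pointIdeal p P ^ n₀ ⊔ Ideal.span {(p : A)} := by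
  set 𝔪 := pointIdeal p P
  set 𝔮 := 𝔪 ^ n₀ ⊔ Ideal.span {(p : A)}
  have hIm : ∀ {m} {G : MvPolynomial (Fin d) R}, G ∈ idealOfVars (Fin d) R ^ m → θ G ∈ 𝔪 ^ m := by
    intro m G hG
    rw [eq_aeval hC ht]
    exact aeval_mem_pow_of_mem (coord_mem_pointIdeal p hP) hG
  let L : MvPolynomial (Fin d) R ⧸ idealOfVars (Fin d) R ^ n →+* A ⧸ 𝔮 :=
    Ideal.Quotient.lift _ ((Ideal.Quotient.mk 𝔮).comp θ) fun G hG =>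
      Ideal.Quotient.eq_zero_iff_mem.2 (le_sup_left (a := 𝔪 ^ n₀) (Ideal.pow_le_pow_right hn (hIm hG)))
  -- Modulo 𝔮 an element equals its Taylor polynomial in t: both maps agree on coordinates and
  -- modulo the nilpotent image of the point ideal.
  have key : Ideal.Quotient.mk 𝔮 = L.comp τ := by
    refine eq_of_comp_eq_of_sub_mem hθ (𝔪.map (Ideal.Quotient.mk 𝔮))
      (iInf_pow_eq_bot_of_isNilpotent ⟨n₀, ?_⟩) ?_ fun s => ?_
    · rw [← Ideal.map_pow, Submodule.zero_eq_bot, eq_bot_iff]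
      refine (Ideal.map_mono (le_sup_left : 𝔪 ^ n₀ ≤ 𝔮)).trans ?_
      rw [Ideal.map_quotient_self]
    · rw [RingHom.comp_assoc, hτ]; rfl
    · obtain ⟨G, hG⟩ := Ideal.Quotient.mk_surjective (τ s)
      rw [RingHom.comp_apply, ← hG]
      change Ideal.Quotient.mk 𝔮 s - Ideal.Quotient.mk 𝔮 (θ G) ∈ _
      rw [← map_sub]
      refine Ideal.mem_map_of_mem _ ?_
      rw [show 𝔪 = pointIdeal p P from rfl, pointIdeal, Ideal.mem_comap, map_sub,
        comp_eq_constantCoeff hC ht P hP, hτ0 s G hG, sub_self]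
      exact zero_mem _
  have h1 : Ideal.Quotient.mk 𝔮 c = Ideal.Quotient.mk 𝔮 (θ G) := by
    rw [key, RingHom.comp_apply, ← hG, ← RingHom.comp_apply, ← key]; rfl
  rw [← Ideal.Quotient.eq_zero_iff_mem, h1, Ideal.Quotient.eq_zero_iff_mem, G.as_sum, map_sum]
  refine sum_mem fun α _ => ?_
  by_cases hα : Finsupp.degree α < n₀
  · obtain ⟨r, hr⟩ := hcoeff α hα
    refine le_sup_right (a := 𝔪 ^ n₀) ?_
    rw [hr, ← C_mul_monomial, map_mul, Ideal.mem_span_singleton]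
    simp
  · refine le_sup_left (a := 𝔪 ^ n₀) (hIm ?_)
    rw [mem_pow_idealOfVars_iff]
    intro x hx
    have := support_monomial_subset hx
    rw [Finset.mem_singleton] at this
    rw [this]; omega

variable {O : Type*} [CommRing O] [Algebra R O] {p : ℕ} (D : FrobeniusRing p R O)

/-- At a point close to `P`, functions are approximated by their Taylor expansions. -/
theorem FrobeniusRing.exists_taylor_eval (hθ : θ.FormallyEtale) (hC : θ.comp C = algebraMap R A)
    (ht : ∀ i, θ (X i) = t i) (P : A →ₐ[R] R) (hP : ∀ i, P (t i) = 0) {n : ℕ}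
    {τ : A →+* MvPolynomial (Fin d) R ⧸ idealOfVars (Fin d) R ^ n}
    (hτ : τ.comp θ = Ideal.Quotient.mk _)
    (hτ0 : ∀ s G, Ideal.Quotient.mk _ G = τ s → constantCoeff G = P s)
    (a : A →ₐ[R] O) (ha : ∀ s, D.ϖ ∣ a s - algebraMap R O (P s)) {m : ℕ}
    (ham : ∀ i, (p : O) ^ m ∣ a (t i)) :
    ∃ L : MvPolynomial (Fin d) R ⧸ idealOfVars (Fin d) R ^ n →+*
        O ⧸ Ideal.span {(p : O) ^ (m * n)},
      (∀ G, L (Ideal.Quotient.mk _ G) = Ideal.Quotient.mk _ (aeval (fun i => a (t i)) G)) ∧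
      ∀ s, L (τ s) = Ideal.Quotient.mk _ (a s) := by
  set J := Ideal.span {(p : O) ^ (m * n)} with hJ
  let L : MvPolynomial (Fin d) R ⧸ idealOfVars (Fin d) R ^ n →+* O ⧸ J :=
    Ideal.Quotient.lift _ ((Ideal.Quotient.mk J).comp
      (aeval (fun i => a (t i)) : MvPolynomial (Fin d) R →ₐ[R] O).toRingHom) fun G hG =>
      Ideal.Quotient.eq_zero_iff_mem.2 (by
        rw [hJ, pow_mul, ← Ideal.span_singleton_pow]
        exact aeval_mem_pow_of_mem (fun i => Ideal.mem_span_singleton.2 (ham i)) hG)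
  refine ⟨L, fun G => rfl, fun s => ?_⟩
  -- Both maps agree on coordinates and modulo ϖ, and ϖ is nilpotent modulo a power of p because p
  -- divides some ϖ^e.
  have key : L.comp τ = (Ideal.Quotient.mk J).comp a.toRingHom := by
    refine eq_of_comp_eq_of_sub_mem hθ ((Ideal.span {D.ϖ}).map (Ideal.Quotient.mk J))
      (iInf_pow_eq_bot_of_isNilpotent ?_) ?_ fun s => ?_
    · obtain ⟨e, he⟩ := D.p_dvd
      refine ⟨e * (m * n), ?_⟩
      rw [← Ideal.map_pow, Submodule.zero_eq_bot, eq_bot_iff]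
      have : Ideal.span {D.ϖ} ^ (e * (m * n)) ≤ J := by
        rw [Ideal.span_singleton_pow, hJ, Ideal.span_singleton_le_span_singleton, pow_mul D.ϖ]
        exact pow_dvd_pow_of_dvd he _
      refine (Ideal.map_mono this).trans ?_
      rw [Ideal.map_quotient_self]
    · rw [RingHom.comp_assoc, hτ]
      refine MvPolynomial.ringHom_ext (fun x => ?_) fun i => ?_
      · have e : θ (C x) = algebraMap R A x := RingHom.congr_fun hC x
        simp [L, e]
      · simp [L, ht]
    · obtain ⟨G, hG⟩ := Ideal.Quotient.mk_surjective (τ s)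
      rw [RingHom.comp_apply, ← hG]
      change Ideal.Quotient.mk J (aeval (fun i => a (t i)) G) - Ideal.Quotient.mk J (a s) ∈ _
      rw [← map_sub]
      refine Ideal.mem_map_of_mem _ ?_
      have h1 : aeval (fun i => a (t i)) (G - C (constantCoeff G)) ∈ Ideal.span {D.ϖ} ^ 1 := by
        refine aeval_mem_pow_of_mem (fun i => ?_) (by simpa using sub_C_constantCoeff_mem G)
        have := ha (t i)
        rw [hP, map_zero, sub_zero] at this
        exact Ideal.mem_span_singleton.2 this
      rw [pow_one, map_sub, aeval_C, hτ0 s G hG] at h1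
      have h2 := sub_mem h1 (Ideal.mem_span_singleton.2 (ha s))
      convert h2 using 1
      ring
  exact RingHom.congr_fun key s

/-- Hensel's lemma: the residue disk of P contains points with any prescribed coordinates in ϖO.
These are the test points at which vanishing functions are evaluated. -/
theorem FrobeniusRing.exists_point (hθ : θ.FormallyEtale) (hC : θ.comp C = algebraMap R A)
    (ht : ∀ i, θ (X i) = t i) (P : A →ₐ[R] R) (hP : ∀ i, P (t i) = 0) (b : Fin d → O)
    (hb : ∀ i, D.ϖ ∣ b i) :
    ∃ a : A →ₐ[R] O, (∀ s, D.ϖ ∣ a s - algebraMap R O (P s)) ∧ ∀ i, a (t i) = b i := by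
  have := D.complete
  let α : MvPolynomial (Fin d) R →+* O := (aeval b : MvPolynomial (Fin d) R →ₐ[R] O).toRingHom
  let β : A →+* O ⧸ Ideal.span {D.ϖ} :=
    (Ideal.Quotient.mk _).comp ((algebraMap R O).comp P.toRingHom)
  have hx : ∀ x, θ (C x) = algebraMap R A x := fun x => RingHom.congr_fun hC x
  obtain ⟨γ, h1, h2⟩ := exists_lift_of_isAdicComplete hθ (Ideal.span {D.ϖ}) α β (by
    refine MvPolynomial.ringHom_ext (fun x => ?_) fun i => ?_
    · simp [β, α, hx]
    · simp only [β, α, ht, RingHom.comp_apply, AlgHom.toRingHom_eq_coe, RingHom.coe_coe, hP,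
        map_zero, aeval_X]
      exact (Ideal.Quotient.eq_zero_iff_mem.2 (Ideal.mem_span_singleton.2 (hb i))).symm)
  refine ⟨{ γ with commutes' := fun x => ?_ }, fun s => ?_, fun i => ?_⟩
  · have := RingHom.congr_fun h1 (C x)
    simpa [α, hx] using this
  · rw [← Ideal.mem_span_singleton, ← Ideal.Quotient.eq]
    exact RingHom.congr_fun h2 s
  · have := RingHom.congr_fun h1 (X i)
    simpa [α, ht] using this

end Taylor

end ArithDiff

/-! ### A function of finite order that vanishes on a residue disk is divisible by ϖ -/

namespace ArithDiff

namespace FrobeniusRing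

open MvPolynomial

variable {p : ℕ} {R O A : Type*} [CommRing R] [CommRing O] [Algebra R O]
  (D : FrobeniusRing p R O) [CommRing A] [Algebra R A] {d : ℕ} {t : Fin d → A}
  {θ : MvPolynomial (Fin d) R →+* A}

/-- The coordinates `(δ b, …, δ ^ r b, b)` of a tuple `b`. -/
def jetCoord (r : ℕ) (b : Fin d → O) : (Fin d × Fin r) ⊕ Fin d → O :=
  Sum.elim (fun ij => D.δ^[(ij.2 : ℕ) + 1] (b ij.1)) b

/-- A polynomial in `b, δ b, …, δ ^ r b` of degree less than `n` is zero if it vanishes to order `n`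
at the origin. -/
def JetIndependent : Prop :=
  ∀ (d r n : ℕ) (F : MvPolynomial ((Fin d × Fin r) ⊕ Fin d) O),
    (∀ γ ∈ F.support, Finsupp.degree γ < n) →
    (∀ m, r < m → ∀ b : Fin d → O,
      (p : O) ^ ((m - r) * n) ∣ eval (D.jetCoord r fun i => (p : O) ^ m * b i) F) → F = 0

/-- φ fixes p, so the numerator of δ keeps the factor p^(m+1), and dividing by ϖ costs at most one
factor p because ϖ ∣ p. -/
theorem pow_dvd_δ [IsDomain O] [Fact p.Prime] {m : ℕ} {x : O} (h : (p : O) ^ (m + 1) ∣ x) :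
    (p : O) ^ m ∣ D.δ x := by
  obtain ⟨y, rfl⟩ := h
  obtain ⟨c, hc⟩ := D.dvd_p
  obtain ⟨q, hq⟩ : ∃ q, p = q + 1 := ⟨p - 1, by have := (Fact.out : p.Prime).pos; omega⟩
  have e2 : ((p : O) ^ (m + 1) * y) ^ p =
      (p : O) ^ (m + 1) * y * ((p : O) ^ (m + 1) * y) ^ q := by
    rw [← pow_succ', ← hq]
  refine ⟨c * (D.φ y - y * ((p : O) ^ (m + 1) * y) ^ q), mul_left_cancel₀ D.ne_zero ?_⟩
  rw [D.mul_δ, e2, map_mul, map_pow, map_natCast]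
  have e1 : (p : O) ^ (m + 1) = D.ϖ * c * (p : O) ^ m := by rw [← hc, pow_succ']
  generalize ((p : O) ^ (m + 1) * y) ^ q = z
  rw [e1]; ring

theorem pow_dvd_δ_iterate [IsDomain O] [Fact p.Prime] (j : ℕ) {m : ℕ} {x : O}
    (h : (p : O) ^ (m + j) ∣ x) : (p : O) ^ m ∣ D.δ^[j] x := by
  induction j generalizing x with
  | zero => exact h
  | succ j ih => rw [Function.iterate_succ_apply]; exact ih (D.pow_dvd_δ h)

/-- At most r applications of δ occur, each losing at most one power of p. Hence the exponent (m -
r) * n in `JetIndependent`, which is the size of a monomial of degree n. -/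
theorem pow_dvd_jetCoord [IsDomain O] [Fact p.Prime] {r m : ℕ} (hm : r < m) {b : Fin d → O}
    (hb : ∀ i, (p : O) ^ m ∣ b i) (x : (Fin d × Fin r) ⊕ Fin d) :
    (p : O) ^ (m - r) ∣ D.jetCoord r b x := by
  rcases x with ⟨i, j⟩ | i
  · have hj := j.2
    refine (pow_dvd_pow _ (show m - r ≤ m - (j + 1) by omega)).trans
      (D.pow_dvd_δ_iterate _ ((pow_dvd_pow _ ?_).trans (hb i)))
    simp only; omega
  · exact (pow_dvd_pow _ (Nat.sub_le _ _)).trans (hb i)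

theorem exists_expansion {r : ℕ} {h : (A →ₐ[R] O) → O} (hh : h ∈ D.jetRing t r) :
    ∃ (H : ℕ → MvPolynomial (Fin d × Fin r) A) (g : ℕ → (A →ₐ[R] O) → O),
      (∀ l, g l ∈ D.jetRing t r) ∧ g 0 = h ∧
      ∀ l, g l = D.jetEval t r (H l) + D.cϖ A * g (l + 1) := by
  have h1 : ∀ u : D.jetRing t r, ∃ (G : MvPolynomial (Fin d × Fin r) A) (v : D.jetRing t r),
      (u : (A →ₐ[R] O) → O) = D.jetEval t r G + D.cϖ A * v := fun u => by
    obtain ⟨_, ⟨G, rfl⟩, v, hv, e⟩ := exists_of_mem_adicClosure u.2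
    exact ⟨G, ⟨v, hv⟩, e⟩
  choose G v hGv using h1
  refine ⟨fun l => G (v^[l] ⟨h, hh⟩), fun l => v^[l] ⟨h, hh⟩, fun l => (v^[l] ⟨h, hh⟩).2, rfl,
    fun l => ?_⟩
  simp only [Function.iterate_succ_apply']
  exact hGv _

theorem expansion_partial_sum {r : ℕ} {H : ℕ → MvPolynomial (Fin d × Fin r) A}
    {g : ℕ → (A →ₐ[R] O) → O}
    (hg : ∀ l, g l = D.jetEval t r (H l) + D.cϖ A * g (l + 1)) (N : ℕ) (a : A →ₐ[R] O) :
    g 0 a = ∑ l ∈ Finset.range N, D.ϖ ^ l * D.jetEval t r (H l) a + D.ϖ ^ N * g N a := by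
  induction N with
  | zero => simp
  | succ N ih =>
    rw [ih, Finset.sum_range_succ, hg N]
    simp only [Pi.add_apply, Pi.mul_apply, cϖ]
    ring

/-- The low order Taylor coefficients of the leading term of a function that vanishes close to `P`
are divisible by `p`. -/
theorem dvd_coeff_of_vanish [IsDomain O] [Fact p.Prime] (hU : D.JetIndependent)
    (hθ : θ.FormallyEtale) (hC : θ.comp C = algebraMap R A) (ht : ∀ i, θ (X i) = t i)
    (P : A →ₐ[R] R) (hP : ∀ i, P (t i) = 0) {r : ℕ} {H : ℕ → MvPolynomial (Fin d × Fin r) A}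
    {g : ℕ → (A →ₐ[R] O) → O}
    (hg : ∀ l, g l = D.jetEval t r (H l) + D.cϖ A * g (l + 1))
    (hvan : ∀ a : A →ₐ[R] O, (∀ s, D.ϖ ∣ a s - algebraMap R O (P s)) → g 0 a = 0)
    {n : ℕ} {τ : A →+* MvPolynomial (Fin d) R ⧸ idealOfVars (Fin d) R ^ n}
    (hτ : τ.comp θ = Ideal.Quotient.mk _)
    (hτ0 : ∀ s G, Ideal.Quotient.mk _ G = τ s → constantCoeff G = P s)
    {G : ℕ → MvPolynomial (Fin d × Fin r) (MvPolynomial (Fin d) R)}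
    (hG : ∀ l, map (Ideal.Quotient.mk _) (G l) = map τ (H l))
    (β : Fin d × Fin r →₀ ℕ) (α : Fin d →₀ ℕ)
    (hβα : Finsupp.degree (Finsupp.sumElim β α) < n) : (p : R) ∣ coeff α (coeff β (G 0)) := by
  set F : ℕ → MvPolynomial ((Fin d × Fin r) ⊕ Fin d) R :=
    fun l => (sumAlgEquiv R (Fin d × Fin r) (Fin d)).symm (G l) with hF
  have hΓ : {γ : (Fin d × Fin r) ⊕ Fin d →₀ ℕ | Finsupp.degree γ < n}.Finite :=
    (Finsupp.finite_of_degree_le n).subset fun γ (hγ : _ < n) => hγ.le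
  set Γ := hΓ.toFinset with hΓdef
  have hmemΓ : ∀ γ, γ ∈ Γ ↔ Finsupp.degree γ < n := fun γ => by simp [hΓdef]
  -- ρ γ is the Taylor coefficient at γ of the whole series ∑ ϖ^l H_l. W keeps these coefficients in
  -- degree less than n, and T l is the contribution of H_l before weighting by ϖ^l.
  choose ρ hρ using fun γ => D.exists_series fun l => algebraMap R O (coeff γ (F l))
  let T : ℕ → MvPolynomial ((Fin d × Fin r) ⊕ Fin d) R := fun l =>
    ∑ γ ∈ Γ, monomial γ (coeff γ (F l))
  let W : MvPolynomial ((Fin d × Fin r) ⊕ Fin d) O := ∑ γ ∈ Γ, monomial γ (ρ γ)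
  have hcoeffW : ∀ γ ∈ Γ, coeff γ W = ρ γ := fun γ hγ => by
    classical
    simp only [W, coeff_sum, coeff_monomial, Finset.sum_ite_eq', hγ, if_true]
  have hcoeffT : ∀ l, ∀ γ ∈ Γ, coeff γ (T l) = coeff γ (F l) := fun l γ hγ => by
    classical
    simp only [T, coeff_sum, coeff_monomial, Finset.sum_ite_eq', hγ, if_true]
  -- At a point with coordinates p^m b, the value of W agrees with that of the function, which is 0,
  -- modulo p^((m-r)n). `JetIndependent` then applies.
  have hW : W = 0 := by
    refine hU d r n W (fun γ hγ => ?_) fun m hm b => ?_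
    · classical
      by_contra hcon
      refine (mem_support_iff.1 hγ) ?_
      simp only [W, coeff_sum, coeff_monomial, Finset.sum_ite_eq', hmemΓ, hcon, if_false]
    obtain ⟨c, hc⟩ := D.dvd_p
    obtain ⟨a, ha, hat⟩ := D.exists_point hθ hC ht P hP (fun i => (p : O) ^ m * b i) fun i =>
      ((Dvd.intro c hc.symm).trans (dvd_pow_self _ (by omega))).mul_right _
    set y := D.jetCoord r fun i => (p : O) ^ m * b i with hy
    have ham : ∀ i, (p : O) ^ m ∣ a (t i) := fun i => by rw [hat]; exact Dvd.intro _ rfl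
    obtain ⟨L, hL, hLτ⟩ := D.exists_taylor_eval hθ hC ht P hP hτ hτ0 a ha ham
    set 𝔞 := Ideal.span {(p : O) ^ ((m - r) * n)} with h𝔞
    -- the Taylor approximation of the coefficients
    have hA : ∀ l, D.jetEval t r (H l) a - aeval y (F l) ∈ 𝔞 := fun l => by
      have hle : Ideal.span {(p : O) ^ (m * n)} ≤ 𝔞 := by
        rw [h𝔞, Ideal.span_singleton_le_span_singleton]
        exact pow_dvd_pow _ (Nat.mul_le_mul_right _ (Nat.sub_le _ _))
      refine hle (Ideal.Quotient.eq.1 ?_)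
      have e1 : Ideal.Quotient.mk (Ideal.span {(p : O) ^ (m * n)}) (D.jetEval t r (H l) a) =
          eval₂ L (fun ij => Ideal.Quotient.mk _ (y (Sum.inl ij))) (map τ (H l)) := by
        rw [D.jetEval_apply, eval₂_map, hom_eval₂]
        have e3 : (Ideal.Quotient.mk (Ideal.span {(p : O) ^ (m * n)})).comp a.toRingHom =
            L.comp τ := RingHom.ext fun s => (hLτ s).symm
        rw [e3]
        simp only [y, jetCoord, Sum.elim_inl, hat]
      have e2 : aeval y (F l) =
          eval₂ (aeval fun i => a (t i) : MvPolynomial (Fin d) R →ₐ[R] O).toRingHom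
            (fun ij => y (Sum.inl ij)) (G l) := by
        have : (aeval y : MvPolynomial ((Fin d × Fin r) ⊕ Fin d) R →ₐ[R] O).toRingHom.comp
            (sumAlgEquiv R (Fin d × Fin r) (Fin d)).symm.toRingEquiv.toRingHom =
            eval₂Hom (aeval fun i => a (t i) : MvPolynomial (Fin d) R →ₐ[R] O).toRingHom
            (fun ij => y (Sum.inl ij)) := by
          refine MvPolynomial.ringHom_ext (fun q => ?_) fun i => ?_
          · induction q using MvPolynomial.induction_on with
            | C x => simp
            | add q q' hq hq' => simp only [map_add, hq, hq']
            | mul_X q i hq =>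
              rw [map_mul, map_mul, map_mul, hq]
              congr 1
              simp [y, jetCoord, hat]
          · simp
        exact RingHom.congr_fun this (G l)
      rw [e1, e2, ← hG, eval₂_map, hom_eval₂]
      refine congrArg (fun f => eval₂ f _ (G l)) (RingHom.ext fun q => ?_)
      exact hL q
    -- The truncation only drops monomials of degree at least n, in variables whose values are
    -- divisible by p^(m-r).
    have hB : ∀ l, aeval y (F l) - aeval y (T l) ∈ 𝔞 := fun l => by
      rw [← map_sub, h𝔞, pow_mul, ← Ideal.span_singleton_pow]
      refine aeval_mem_pow_of_mem (fun x => Ideal.mem_span_singleton.2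
        (D.pow_dvd_jetCoord hm (fun i => Dvd.intro _ rfl) x)) ?_
      rw [mem_pow_idealOfVars_iff']
      intro γ hγ
      rw [coeff_sub, hcoeffT l γ ((hmemΓ γ).2 hγ), sub_self]
    obtain ⟨e, he⟩ := D.p_dvd
    -- As p ∣ ϖ^e, the power ϖ^N is divisible by p^((m-r)n), so the terms from index N on are
    -- negligible.
    set N := e * ((m - r) * n)
    have hN : D.ϖ ^ N ∈ 𝔞 := by
      rw [h𝔞, Ideal.mem_span_singleton, pow_mul D.ϖ]
      exact pow_dvd_pow_of_dvd he _
    have h0 := D.expansion_partial_sum hg N a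
    rw [hvan a ha] at h0
    have hS : ∑ l ∈ Finset.range N, D.ϖ ^ l * aeval y (T l) ∈ 𝔞 := by
      have h1 : ∑ l ∈ Finset.range N, D.ϖ ^ l * D.jetEval t r (H l) a ∈ 𝔞 := by
        rw [← neg_mem_iff, ← zero_sub, sub_eq_of_eq_add' h0]
        exact Ideal.mul_mem_right _ _ hN
      have h2 : ∑ l ∈ Finset.range N, D.ϖ ^ l * (D.jetEval t r (H l) a - aeval y (T l)) ∈ 𝔞 :=
        sum_mem fun l _ => Ideal.mul_mem_left _ _ (by
          rw [← sub_add_sub_cancel _ (aeval y (F l))]; exact add_mem (hA l) (hB l))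
      have h3 := sub_mem h1 h2
      rw [← Finset.sum_sub_distrib] at h3
      convert h3 using 2
      ring
    rw [← Ideal.mem_span_singleton, ← h𝔞]
    have hdiff : eval y W - ∑ l ∈ Finset.range N, D.ϖ ^ l * aeval y (T l) ∈ 𝔞 := by
      have : eval y W - ∑ l ∈ Finset.range N, D.ϖ ^ l * aeval y (T l) =
          ∑ γ ∈ Γ, (ρ γ - ∑ l ∈ Finset.range N, D.ϖ ^ l * algebraMap R O (coeff γ (F l))) *
            γ.prod fun i k => y i ^ k := by
        simp only [W, T, map_sum, eval_monomial, aeval_monomial, sub_mul, Finset.sum_sub_distrib,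
          Finset.mul_sum, Finset.sum_mul]
        rw [Finset.sum_comm]
        simp only [mul_assoc]
      rw [this]
      refine sum_mem fun γ _ => Ideal.mul_mem_right _ _ ?_
      exact Ideal.mem_of_dvd _ (hρ γ N) hN
    simpa using add_mem hdiff hS
  -- Now ρ γ = 0. Reducing its series modulo ϖ leaves only the coefficient coming from H 0; it lies
  -- in R, so divisibility by ϖ becomes divisibility by p.
  have hγ := (hmemΓ _).2 hβα
  have h0 := hcoeffW _ hγ
  rw [hW, coeff_zero] at h0
  have h1 := hρ (Finsupp.sumElim β α) 1
  rw [← h0, pow_one, Finset.sum_range_one, pow_zero, one_mul, zero_sub, dvd_neg] at h1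
  have h2 := D.p_dvd_of_dvd _ h1
  rwa [coeff_sumElim, hF, AlgEquiv.apply_symm_apply] at h2

/-- All Taylor coefficients of the leading term H 0 are divisible by p, so its coefficients vanish
mod p to infinite order at P. The hypothesis `hA`, supplied by Krull's intersection theorem on an
integral reduction, turns this into p ∣ H 0, and ϖ ∣ p. -/
theorem exists_div_of_vanish [IsDomain O] [Fact p.Prime] (hU : D.JetIndependent)
    (hθ : θ.FormallyEtale) (hC : θ.comp C = algebraMap R A) (ht : ∀ i, θ (X i) = t i)
    (P : A →ₐ[R] R) (hP : ∀ i, P (t i) = 0)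
    (hA : ∀ c : A, (∀ n, c ∈ pointIdeal p P ^ n ⊔ Ideal.span {(p : A)}) → (p : A) ∣ c)
    {r : ℕ} {h : (A →ₐ[R] O) → O} (hh : h ∈ D.jetRing t r)
    (hvan : ∀ a : A →ₐ[R] O, (∀ s, D.ϖ ∣ a s - algebraMap R O (P s)) → h a = 0) :
    ∃ h' ∈ D.jetRing t r, h = D.cϖ A * h' := by
  obtain ⟨H, g, hgm, rfl, hg⟩ := D.exists_expansion hh
  have hdvd : C (p : A) ∣ H 0 := by
    rw [C_dvd_iff_dvd_coeff]
    refine fun β => hA _ fun n₀ => ?_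
    -- A Taylor term of order below n₀ in the coefficient at β has total degree below n₀ + deg β.
    -- The extra 1 only keeps the order nonzero.
    obtain ⟨τ, hτ, hτ0⟩ := exists_taylor hθ hC ht P hP (n := n₀ + Finsupp.degree β + 1) (by omega)
    have hsurj : ∀ l, ∃ G : MvPolynomial (Fin d × Fin r) (MvPolynomial (Fin d) R),
        map (Ideal.Quotient.mk (idealOfVars (Fin d) R ^ (n₀ + Finsupp.degree β + 1))) G =
          map τ (H l) :=
      fun l => map_surjective _ Ideal.Quotient.mk_surjective _
    choose G hG using hsurj
    refine mem_of_taylor_coeff p hθ hC ht P hP (by omega) hτ hτ0 (G := coeff β (G 0)) ?_ ?_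
    · rw [← coeff_map, hG, coeff_map]
    · intro α hα
      refine D.dvd_coeff_of_vanish hU hθ hC ht P hP hg hvan hτ hτ0 hG β α ?_
      rw [Finsupp.sumElim_eq_add, map_add, Finsupp.degree_mapDomain, Finsupp.degree_mapDomain]
      omega
  obtain ⟨H', hH'⟩ := hdvd
  obtain ⟨c, hc⟩ := D.dvd_p
  refine ⟨(fun _ => c) * D.jetEval t r H' + g 1,
    add_mem (mul_mem (D.const_mem t r c) (le_adicClosure ⟨H', rfl⟩)) (hgm 1), ?_⟩
  rw [hg 0, hH', map_mul]
  funext a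
  have : D.jetEval t r (C (p : A)) a = (p : O) := by simp [jetEval]
  simp only [Pi.add_apply, Pi.mul_apply, this, cϖ]
  rw [hc]; ring

/-- A function of finite order that vanishes close to a point is zero. -/
theorem eq_zero_of_vanish [IsDomain O] [Fact p.Prime] (hU : D.JetIndependent)
    (hθ : θ.FormallyEtale) (hC : θ.comp C = algebraMap R A) (ht : ∀ i, θ (X i) = t i)
    (P : A →ₐ[R] R) (hP : ∀ i, P (t i) = 0)
    (hA : ∀ c : A, (∀ n, c ∈ pointIdeal p P ^ n ⊔ Ideal.span {(p : A)}) → (p : A) ∣ c)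
    {r : ℕ} {h : (A →ₐ[R] O) → O} (hh : h ∈ D.jetRing t r)
    (hvan : ∀ a : A →ₐ[R] O, (∀ s, D.ϖ ∣ a s - algebraMap R O (P s)) → h a = 0) : h = 0 := by
  have key : ∀ N, ∀ h ∈ D.jetRing t r,
      (∀ a : A →ₐ[R] O, (∀ s, D.ϖ ∣ a s - algebraMap R O (P s)) → h a = 0) →
      ∀ a, D.ϖ ^ N ∣ h a := by
    intro N
    induction N with
    | zero => intro h _ _ a; simp
    | succ N ih =>
      intro h hh hvan a
      obtain ⟨h', hh', rfl⟩ := D.exists_div_of_vanish hU hθ hC ht P hP hA hh hvan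
      rw [pow_succ']
      refine mul_dvd_mul_left _ (ih h' hh' (fun a ha => ?_) a)
      exact (mul_eq_zero.1 (hvan a ha)).resolve_left D.ne_zero
  exact funext fun a => D.eq_zero_of_forall_dvd fun N => key N h hh hvan a

end FrobeniusRing

end ArithDiff

namespace ArithDiff

/-! ### Local integrality of the reduction modulo `p` -/

section LocalDomain

open MvPolynomial

variable {R A : Type*} [CommRing R] [CommRing A] [Algebra R A] {d : ℕ}
  {t : Fin d → A} {θ : MvPolynomial (Fin d) R →+* A} {p : ℕ}

theorem span_le_pointIdeal (P : A →ₐ[R] R) : Ideal.span {(p : A)} ≤ pointIdeal p P := by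
  rw [Ideal.span_singleton_le_iff_mem, pointIdeal, Ideal.mem_comap, map_natCast]
  exact Ideal.mem_span_singleton_self _

theorem pointIdeal_ne_top (P : A →ₐ[R] R) (hp : ¬ IsUnit (p : R)) : pointIdeal p P ≠ ⊤ := by
  rw [pointIdeal, Ne, Ideal.comap_eq_top_iff, Ideal.span_singleton_eq_top]
  exact hp

theorem mk_mem_map_pow_iff (P : A →ₐ[R] R) (n : ℕ) (c : A) :
    Ideal.Quotient.mk (Ideal.span {(p : A)}) c ∈
        (pointIdeal p P).map (Ideal.Quotient.mk (Ideal.span {(p : A)})) ^ n ↔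
      c ∈ pointIdeal p P ^ n ⊔ Ideal.span {(p : A)} := by
  rw [← Ideal.map_pow, ← Ideal.mem_comap,
    Ideal.comap_map_of_surjective' _ Ideal.Quotient.mk_surjective, Ideal.mk_ker]

/-- Krull's intersection theorem in the Noetherian domain A/p, for the proper ideal of the reduction
of P. -/
theorem dvd_of_forall_mem_pow (P : A →ₐ[R] R) (hp : ¬ IsUnit (p : R))
    [hprime : (Ideal.span {(p : A)}).IsPrime] [IsNoetherianRing (A ⧸ Ideal.span {(p : A)})] (c : A)
    (hc : ∀ n, c ∈ pointIdeal p P ^ n ⊔ Ideal.span {(p : A)}) : (p : A) ∣ c := by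
  rw [← Ideal.mem_span_singleton, ← Ideal.Quotient.eq_zero_iff_mem, ← Ideal.mem_bot,
    ← Ideal.iInf_pow_eq_bot_of_isDomain
      ((pointIdeal p P).map (Ideal.Quotient.mk (Ideal.span {(p : A)}))), Ideal.mem_iInf]
  · exact fun n => (mk_mem_map_pow_iff P n c).2 (hc n)
  · intro h
    refine pointIdeal_ne_top P hp ?_
    have := congrArg (Ideal.comap (Ideal.Quotient.mk (Ideal.span {(p : A)}))) h
    rwa [Ideal.comap_map_of_surjective' _ Ideal.Quotient.mk_surjective, Ideal.mk_ker,
      Ideal.comap_top, sup_eq_left.2 (span_le_pointIdeal P)] at this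

theorem sup_pow_le_sup (I J : Ideal A) (n : ℕ) : (I ⊔ J) ^ n ≤ I ^ n ⊔ J := by
  induction n with
  | zero => simp
  | succ n ih =>
    rw [pow_succ, pow_succ]
    refine (Ideal.mul_mono_left ih).trans ?_
    rw [Ideal.sup_mul, Ideal.mul_sup]
    have h1 : I ^ n * J ≤ J := Ideal.mul_le_right
    have h2 : J * (I ⊔ J) ≤ J := Ideal.mul_le_left
    exact sup_le (sup_le le_sup_left (h1.trans le_sup_right)) (h2.trans le_sup_right)

/-- Converse of `mem_of_taylor_coeff`. Together they read off the order of vanishing at P modulo p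
from the Taylor expansion. -/
theorem dvd_taylor_coeff_of_mem (P : A →ₐ[R] R) {n : ℕ}
    {τ : A →+* MvPolynomial (Fin d) R ⧸ idealOfVars (Fin d) R ^ n}
    (hτ0 : ∀ s G, Ideal.Quotient.mk _ G = τ s → constantCoeff G = P s)
    {c : A} {G : MvPolynomial (Fin d) R} (hG : Ideal.Quotient.mk _ G = τ c)
    (hc : c ∈ pointIdeal p P ^ n ⊔ Ideal.span {(p : A)}) (α : Fin d →₀ ℕ)
    (hα : Finsupp.degree α < n) : (p : R) ∣ coeff α G := by
  set J : Ideal (MvPolynomial (Fin d) R) := Ideal.span {C (p : R)} with hJ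
  have h1 : (pointIdeal p P).map τ ≤ (idealOfVars (Fin d) R ⊔ J).map (Ideal.Quotient.mk (idealOfVars (Fin d) R ^ n)) := by
    rw [Ideal.map_le_iff_le_comap]
    intro s hs
    obtain ⟨G, hG⟩ := Ideal.Quotient.mk_surjective (τ s)
    rw [Ideal.mem_comap, ← hG]
    refine Ideal.mem_map_of_mem _ ?_
    have h2 : C (constantCoeff G) ∈ J := by
      rw [hJ, hτ0 s G hG, Ideal.mem_span_singleton]
      exact map_dvd C (Ideal.mem_span_singleton.1 hs)
    have := Submodule.add_mem_sup (sub_C_constantCoeff_mem G) h2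
    rwa [sub_add_cancel] at this
  have h2 : (pointIdeal p P ^ n ⊔ Ideal.span {(p : A)}).map τ ≤ (idealOfVars (Fin d) R ^ n ⊔ J).map (Ideal.Quotient.mk (idealOfVars (Fin d) R ^ n)) := by
    rw [Ideal.map_sup, Ideal.map_pow]
    refine sup_le ((Ideal.pow_right_mono h1 n).trans ?_) ?_
    · rw [← Ideal.map_pow]; exact Ideal.map_mono (sup_pow_le_sup _ J n)
    · rw [Ideal.map_span, Set.image_singleton, map_natCast, Ideal.span_singleton_le_iff_mem]
      have : ((p : MvPolynomial (Fin d) R ⧸ idealOfVars (Fin d) R ^ n)) = (Ideal.Quotient.mk (idealOfVars (Fin d) R ^ n)) (C (p : R)) := by simp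
      rw [this]
      exact Ideal.mem_map_of_mem _ (le_sup_right (a := idealOfVars (Fin d) R ^ n) (Ideal.mem_span_singleton_self _))
  have h3 : Ideal.Quotient.mk (idealOfVars (Fin d) R ^ n) G ∈ (idealOfVars (Fin d) R ^ n ⊔ J).map (Ideal.Quotient.mk (idealOfVars (Fin d) R ^ n)) := by rw [hG]; exact h2 (Ideal.mem_map_of_mem _ hc)
  rw [← Ideal.mem_comap, Ideal.comap_map_of_surjective' _ Ideal.Quotient.mk_surjective,
    Ideal.mk_ker, sup_right_comm, sup_idem] at h3
  obtain ⟨u, hu, v, hv, rfl⟩ := Submodule.mem_sup.1 h3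
  rw [coeff_add, (mem_pow_idealOfVars_iff' n u).1 hu α hα, zero_add]
  obtain ⟨w, rfl⟩ := Ideal.mem_span_singleton.1 hv
  rw [coeff_C_mul]
  exact Dvd.intro _ rfl

theorem order_lt_of_not_dvd {G : MvPolynomial (Fin d) R} {n : ℕ} {α : Fin d →₀ ℕ}
    (hα : Finsupp.degree α < n) (h : ¬ (p : R) ∣ coeff α G) :
    (map (Ideal.Quotient.mk (Ideal.span {(p : R)})) G :
      MvPowerSeries (Fin d) (R ⧸ Ideal.span {(p : R)})).order < n := by
  by_contra hcon
  push Not at hcon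
  refine h ?_
  have := MvPowerSeries.coeff_of_lt_order (f := (map (Ideal.Quotient.mk (Ideal.span {(p : R)})) G :
      MvPowerSeries (Fin d) (R ⧸ Ideal.span {(p : R)})))
    (d := α) (lt_of_lt_of_le (by exact_mod_cast hα) hcon)
  rw [MvPolynomial.coeff_coe, coeff_map, Ideal.Quotient.eq_zero_iff_mem,
    Ideal.mem_span_singleton] at this
  exact this

/-- Orders of vanishing at P modulo p add up, because orders of power series over the domain R/p do.
-/
theorem mul_notMem (hθ : θ.FormallyEtale) (hC : θ.comp C = algebraMap R A)
    (ht : ∀ i, θ (X i) = t i) (P : A →ₐ[R] R) (hP : ∀ i, P (t i) = 0)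
    [hprime : (Ideal.span {(p : R)}).IsPrime] {x y : A} {a b : ℕ}
    (hx : x ∉ pointIdeal p P ^ a ⊔ Ideal.span {(p : A)})
    (hy : y ∉ pointIdeal p P ^ b ⊔ Ideal.span {(p : A)}) :
    x * y ∉ pointIdeal p P ^ (a + b) ⊔ Ideal.span {(p : A)} := by
  intro hxy
  have ha : a + b ≠ 0 := by
    intro h
    have : a = 0 := by omega
    rw [this, pow_zero, Ideal.one_eq_top, top_sup_eq] at hx
    exact hx trivial
  obtain ⟨τ, hτ, hτ0⟩ := exists_taylor hθ hC ht P hP ha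
  obtain ⟨G, hG⟩ := Ideal.Quotient.mk_surjective (τ x)
  obtain ⟨G', hG'⟩ := Ideal.Quotient.mk_surjective (τ y)
  have h1 : ∃ α, Finsupp.degree α < a ∧ ¬ (p : R) ∣ coeff α G := by
    by_contra hcon
    push Not at hcon
    exact hx (mem_of_taylor_coeff p hθ hC ht P hP (Nat.le_add_right a b) hτ hτ0 hG hcon)
  have h2 : ∃ α, Finsupp.degree α < b ∧ ¬ (p : R) ∣ coeff α G' := by
    by_contra hcon
    push Not at hcon
    exact hy (mem_of_taylor_coeff p hθ hC ht P hP (Nat.le_add_left b a) hτ hτ0 hG' hcon)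
  obtain ⟨α, hα, hα'⟩ := h1
  obtain ⟨β, hβ, hβ'⟩ := h2
  have h3 : ∀ γ, Finsupp.degree γ < a + b → (p : R) ∣ coeff γ (G * G') :=
    dvd_taylor_coeff_of_mem P hτ0 (by rw [map_mul, map_mul, hG, hG']) hxy
  have ho1 := order_lt_of_not_dvd hα hα'
  have ho2 := order_lt_of_not_dvd hβ hβ'
  have ho3 : ((a + b : ℕ) : ℕ∞) ≤ (map (Ideal.Quotient.mk (Ideal.span {(p : R)})) (G * G') :
      MvPowerSeries (Fin d) (R ⧸ Ideal.span {(p : R)})).order := by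
    refine MvPowerSeries.nat_le_order fun γ hγ => ?_
    rw [MvPolynomial.coeff_coe, coeff_map, Ideal.Quotient.eq_zero_iff_mem,
      Ideal.mem_span_singleton]
    exact h3 γ hγ
  rw [map_mul, MvPolynomial.coe_mul, MvPowerSeries.order_mul] at ho3
  refine absurd ho3 (not_le.2 ?_)
  push_cast
  exact ENat.add_lt_add ho1 ho2

/-- Krull and Nakayama without integrality: the intersection N of the powers of 𝔪 in A/p satisfies N
= 𝔪N, so some e congruent to 1 modulo 𝔪 kills it. Inverting e removes the components of the
reduction away from P. -/
theorem exists_forall_mem_pow_dvd (P : A →ₐ[R] R)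
    [IsNoetherianRing (A ⧸ Ideal.span {(p : A)})] :
    ∃ e : A, e - 1 ∈ pointIdeal p P ∧
      ∀ z, (∀ n, z ∈ pointIdeal p P ^ n ⊔ Ideal.span {(p : A)}) → (p : A) ∣ e * z := by
  set q := Ideal.Quotient.mk (Ideal.span {(p : A)})
  set 𝔪 := (pointIdeal p P).map q with h𝔪
  set N : Ideal (A ⧸ Ideal.span {(p : A)}) := ⨅ n : ℕ, 𝔪 ^ n
  have hN : N ≤ 𝔪 • N := by
    intro x hx
    have h1 : x ∈ (⨅ i : ℕ, 𝔪 ^ i • ⊤ : Submodule (A ⧸ Ideal.span {(p : A)}) _) := by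
      simpa only [smul_eq_mul, Ideal.mul_top] using hx
    obtain ⟨r, hr⟩ := (Ideal.mem_iInf_smul_pow_eq_bot_iff 𝔪 x).1 h1
    rw [← hr]
    exact Submodule.smul_mem_smul r.2 hx
  obtain ⟨r, hr, hr'⟩ := Submodule.exists_sub_one_mem_and_smul_eq_zero_of_fg_of_le_smul 𝔪 N
    (IsNoetherian.noetherian N) hN
  obtain ⟨e, rfl⟩ := Ideal.Quotient.mk_surjective r
  refine ⟨e, ?_, fun z hz => ?_⟩
  · have h1 : q (e - 1) ∈ 𝔪 ^ 1 := by simpa [q] using hr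
    rw [mk_mem_map_pow_iff, pow_one, sup_eq_left.2 (span_le_pointIdeal P)] at h1
    exact h1
  · have := hr' (q z) (Ideal.mem_iInf.2 fun n => (mk_mem_map_pow_iff P n z).2 (hz n))
    rwa [smul_eq_mul, ← map_mul, Ideal.Quotient.eq_zero_iff_mem, Ideal.mem_span_singleton] at this

/-- Every section of an étale algebra over affine space has a principal neighbourhood whose
reduction modulo `p` is integral. -/
theorem exists_isPrime_localization (hθ : θ.FormallyEtale) (hC : θ.comp C = algebraMap R A)
    (ht : ∀ i, θ (X i) = t i) (P : A →ₐ[R] R) (hP : ∀ i, P (t i) = 0)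
    [hprime : (Ideal.span {(p : R)}).IsPrime] [IsNoetherianRing (A ⧸ Ideal.span {(p : A)})] :
    ∃ e : A, e ∉ pointIdeal p P ∧ ∀ (B : Type*) [CommRing B] [Algebra A B]
      [IsLocalization.Away e B], (Ideal.span {(p : B)}).IsPrime := by
  obtain ⟨e, he, hez⟩ := exists_forall_mem_pow_dvd (p := p) P
  have hmprime : (pointIdeal p P).IsPrime := Ideal.IsPrime.comap P.toRingHom
  have he' : e ∉ pointIdeal p P := fun h => hmprime.ne_top
    ((Ideal.eq_top_iff_one _).2 (by simpa using sub_mem h he))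
  have hdvd : ∀ {z : A}, (p : A) ∣ z → ∀ n, z ∈ pointIdeal p P ^ n ⊔ Ideal.span {(p : A)} :=
    fun hz n => le_sup_right (a := pointIdeal p P ^ n) (Ideal.mem_span_singleton.2 hz)
  -- The elements of infinite order at P form a prime ideal, by additivity of orders. After
  -- inverting e it becomes the ideal generated by p.
  have hpr : ∀ {x y : A}, (∀ n, x * y ∈ pointIdeal p P ^ n ⊔ Ideal.span {(p : A)}) →
      (∀ n, x ∈ pointIdeal p P ^ n ⊔ Ideal.span {(p : A)}) ∨
      ∀ n, y ∈ pointIdeal p P ^ n ⊔ Ideal.span {(p : A)} := by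
    intro x y hxy
    by_contra! hcon
    obtain ⟨⟨a, ha⟩, b, hb⟩ := hcon
    exact mul_notMem hθ hC ht P hP ha hb (hxy _)
  have hepow : ∀ N : ℕ, ∃ n, e ^ N ∉ pointIdeal p P ^ n ⊔ Ideal.span {(p : A)} := fun N => by
    refine ⟨1, fun h => he' (hmprime.mem_of_pow_mem N ?_)⟩
    rwa [pow_one, sup_eq_left.2 (span_le_pointIdeal P)] at h
  refine ⟨e, he', fun B _ _ _ => ?_⟩
  have hB : ∀ x : A, (p : B) ∣ algebraMap A B x → ∃ N, (p : A) ∣ e ^ N * x := by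
    rintro x ⟨z, hz⟩
    obtain ⟨N, w, hw⟩ := IsLocalization.Away.surj e z
    rw [← map_pow] at hw
    have h1 : algebraMap A B (e ^ N * x) = algebraMap A B (p * w) := by
      rw [map_mul, hz, map_mul, map_natCast, ← hw]; ring
    obtain ⟨⟨_, M, rfl⟩, hM⟩ := (IsLocalization.eq_iff_exists (Submonoid.powers e) B).1 h1
    refine ⟨M + N, w * e ^ M, ?_⟩
    simp only at hM
    rw [pow_add, mul_assoc, hM]; ring
  have hunit : IsUnit (algebraMap A B e) := IsLocalization.Away.algebraMap_isUnit e
  refine ⟨fun h => ?_, fun {x y} hxy => ?_⟩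
  · rw [Ideal.span_singleton_eq_top] at h
    obtain ⟨N, hN⟩ := hB 1 h.dvd
    rw [mul_one] at hN
    obtain ⟨n, hn⟩ := hepow N
    exact hn (hdvd hN n)
  · rw [Ideal.mem_span_singleton] at hxy
    obtain ⟨i, x', hx'⟩ := IsLocalization.Away.surj e x
    obtain ⟨j, y', hy'⟩ := IsLocalization.Away.surj e y
    obtain ⟨N, hN⟩ := hB (x' * y') (by
      rw [map_mul, ← hx', ← hy']
      exact hxy.trans (Dvd.intro (algebraMap A B e ^ i * algebraMap A B e ^ j) (by ring)))
    -- An element of infinite order is divisible by p after multiplication by e, and e is a unit in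
    -- B.
    have hfin : ∀ {x : B} {x' : A} {i : ℕ}, x * algebraMap A B e ^ i = algebraMap A B x' →
        (∀ n, x' ∈ pointIdeal p P ^ n ⊔ Ideal.span {(p : A)}) → x ∈ Ideal.span {(p : B)} := by
      intro x x' i hx hx'
      rw [Ideal.mem_span_singleton]
      have h1 := map_dvd (algebraMap A B) (hez x' hx')
      rw [map_natCast, map_mul, ← hx] at h1
      rw [hunit.dvd_mul_left] at h1
      exact (hunit.pow i).dvd_mul_right.1 h1
    rcases hpr (hdvd hN) with h | h
    · obtain ⟨n, hn⟩ := hepow N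
      exact absurd (h n) hn
    · rcases hpr h with h | h
      · exact Or.inl (hfin hx' h)
      · exact Or.inr (hfin hy' h)

end LocalDomain

end ArithDiff

namespace ArithDiff

/-! ### Teichmüller elements -/

section Ultrametric

variable {F : Type*} [NormedField F] [IsUltrametricDist F]

/-- The closed unit ball of an ultrametric field. -/
def unitRing (F : Type*) [NormedField F] [IsUltrametricDist F] : Subring F where
  carrier := {x | ‖x‖ ≤ 1}
  mul_mem' := fun {a b} (ha : ‖a‖ ≤ 1) (hb : ‖b‖ ≤ 1) => by
    change ‖a * b‖ ≤ 1
    rw [norm_mul]; exact mul_le_one₀ ha (norm_nonneg _) hb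
  one_mem' := by simp
  add_mem' := fun {a b} (ha : ‖a‖ ≤ 1) (hb : ‖b‖ ≤ 1) =>
    (IsUltrametricDist.norm_add_le_max a b).trans (max_le ha hb)
  zero_mem' := by simp
  neg_mem' := fun {a} (ha : ‖a‖ ≤ 1) => by
    change ‖-a‖ ≤ 1
    rwa [norm_neg]

theorem norm_sub_le_max (a b : F) : ‖a - b‖ ≤ max ‖a‖ ‖b‖ := by
  rw [sub_eq_add_neg, ← norm_neg b]
  exact IsUltrametricDist.norm_add_le_max a (-b)

theorem norm_sub_le_of_le (a b c : F) {r : ℝ} (h₁ : ‖a - b‖ ≤ r) (h₂ : ‖b - c‖ ≤ r) :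
    ‖a - c‖ ≤ r := by
  rw [← sub_add_sub_cancel a b c]
  exact (IsUltrametricDist.norm_add_le_max _ _).trans (max_le h₁ h₂)

theorem norm_sub_lt_of_lt (a b c : F) {r : ℝ} (h₁ : ‖a - b‖ < r) (h₂ : ‖b - c‖ < r) :
    ‖a - c‖ < r := by
  rw [← sub_add_sub_cancel a b c]
  exact (IsUltrametricDist.norm_add_le_max _ _).trans_lt (max_lt h₁ h₂)

theorem norm_eq_of_norm_sub_lt {a b : F} (h : ‖a - b‖ < ‖a‖) : ‖b‖ = ‖a‖ := by
  have h1 : ‖b‖ ≤ ‖a‖ := by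
    have := norm_sub_le_max a (a - b)
    rwa [sub_sub_cancel, max_eq_left h.le] at this
  refine le_antisymm h1 ?_
  by_contra! hcon
  have := IsUltrametricDist.norm_add_le_max (a - b) b
  rw [sub_add_cancel] at this
  exact absurd this (not_le.2 (max_lt h hcon))

variable {p : ℕ} [Fact p.Prime]

theorem exists_pow_sub_pow_eq {a b : F} (ha : ‖a‖ ≤ 1) (hb : ‖b‖ ≤ 1) :
    ∃ r : F, ‖r‖ ≤ 1 ∧ a ^ p - b ^ p = (a - b) ^ p + p * ((a - b) * r) := by
  obtain ⟨r, hr⟩ := exists_add_pow_prime_eq (Fact.out : p.Prime)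
    (⟨b, hb⟩ : unitRing F) (⟨a, ha⟩ - ⟨b, hb⟩)
  have h1 : (b + (a - b)) ^ p = b ^ p + (a - b) ^ p + p * b * (a - b) * r :=
    congrArg Subtype.val hr
  refine ⟨b * r, ?_, ?_⟩
  · exact (unitRing F).mul_mem hb r.2
  · rw [add_sub_cancel] at h1
    rw [h1]; ring

theorem norm_pow_sub_pow_le {a b : F} (ha : ‖a‖ ≤ 1) (hb : ‖b‖ ≤ 1) {κ : ℝ}
    (hκ : κ < 1) (hp : ‖(p : F)‖ ≤ κ) (hab : ‖a - b‖ ≤ κ) : ‖a ^ p - b ^ p‖ ≤ κ * ‖a - b‖ := by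
  obtain ⟨r, hr, e⟩ := exists_pow_sub_pow_eq (p := p) ha hb
  rw [e]
  have hκ0 : 0 ≤ κ := (norm_nonneg _).trans hp
  refine (IsUltrametricDist.norm_add_le_max _ _).trans (max_le ?_ ?_)
  · rw [norm_pow, ← Nat.succ_pred_eq_of_pos (Fact.out : p.Prime).pos, pow_succ]
    refine mul_le_mul_of_nonneg_right ?_ (norm_nonneg _)
    have hpred : p.pred ≠ 0 := by
      have := (Fact.out : p.Prime).two_le
      rw [Nat.pred_eq_sub_one]; omega
    exact (pow_le_of_le_one (norm_nonneg _) (hab.trans hκ.le) hpred).trans hab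
  · rw [norm_mul, norm_mul]
    exact mul_le_mul hp (mul_le_of_le_one_right (norm_nonneg _) hr) (by positivity) hκ0

theorem norm_pow_pow_sub_le {a b : F} (ha : ‖a‖ ≤ 1) (hb : ‖b‖ ≤ 1) {κ : ℝ}
    (hκ : κ < 1) (hp : ‖(p : F)‖ ≤ κ) (hab : ‖a - b‖ ≤ κ) {s : ℕ} (hs : s ≠ 0) :
    ‖a ^ p ^ s - b ^ p ^ s‖ ≤ κ * ‖a - b‖ := by
  have hκ0 : 0 ≤ κ := (norm_nonneg _).trans hp
  induction s with
  | zero => exact absurd rfl hs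
  | succ s ih =>
    rcases Nat.eq_zero_or_pos s with rfl | hs'
    · simpa using norm_pow_sub_pow_le ha hb hκ hp hab
    · have h1 := ih hs'.ne'
      have h2 : κ * ‖a - b‖ ≤ κ := mul_le_of_le_one_right hκ0 (hab.trans hκ.le)
      rw [pow_succ, pow_mul, pow_mul]
      have h3 := norm_pow_sub_pow_le (p := p) (a := a ^ p ^ s) (b := b ^ p ^ s)
        (by rw [norm_pow]; exact pow_le_one₀ (norm_nonneg _) ha)
        (by rw [norm_pow]; exact pow_le_one₀ (norm_nonneg _) hb) hκ hp (h1.trans h2)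
      exact h3.trans ((mul_le_of_le_one_left (norm_nonneg _) hκ.le).trans h1)

/-- Injectivity of Frobenius on the reduced residue ring, applied s times through a^p - b^p ≡ (a -
b)^p mod p. -/
theorem norm_sub_lt_one_of_pow {a b : F} (ha : ‖a‖ ≤ 1) (hb : ‖b‖ ≤ 1) (hp : ‖(p : F)‖ < 1)
    (s : ℕ) (h : ‖a ^ p ^ s - b ^ p ^ s‖ < 1) : ‖a - b‖ < 1 := by
  induction s with
  | zero => simpa using h
  | succ s ih =>
    refine ih ?_
    rw [pow_succ, pow_mul, pow_mul] at h
    have ha' : ‖a ^ p ^ s‖ ≤ 1 := by rw [norm_pow]; exact pow_le_one₀ (norm_nonneg _) ha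
    have hb' : ‖b ^ p ^ s‖ ≤ 1 := by rw [norm_pow]; exact pow_le_one₀ (norm_nonneg _) hb
    obtain ⟨r, hr, e⟩ := exists_pow_sub_pow_eq (p := p) ha' hb'
    have hd : ‖a ^ p ^ s - b ^ p ^ s‖ ≤ 1 := (norm_sub_le_max _ _).trans (max_le ha' hb')
    have h1 : ‖(p : F) * ((a ^ p ^ s - b ^ p ^ s) * r)‖ < 1 := by
      rw [norm_mul, norm_mul]
      exact (mul_le_of_le_one_right (norm_nonneg _) (mul_le_one₀ hd (norm_nonneg _) hr)).trans_lt hp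
    have h2 : ‖(a ^ p ^ s - b ^ p ^ s) ^ p‖ < 1 := by
      rw [eq_sub_of_add_eq e.symm]
      exact (norm_sub_le_max _ _).trans_lt (max_lt h h1)
    rw [norm_pow] at h2
    by_contra! hcon
    exact absurd h2 (not_lt.2 (one_le_pow₀ hcon))

end Ultrametric

/-! ### The maximal unramified extension and its Teichmüller elements -/

section Unramified

variable {p : ℕ} [Fact p.Prime]

theorem norm_p_algCl : ‖(p : PadicAlgCl p)‖ = (p : ℝ)⁻¹ := by
  rw [← map_natCast (algebraMap ℚ_[p] (PadicAlgCl p)), norm_algebraMap', Padic.norm_p]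

theorem one_lt_p : (1 : ℝ) < p := by exact_mod_cast (Fact.out : p.Prime).one_lt

theorem p_pos : (0 : ℝ) < p := zero_lt_one.trans one_lt_p

theorem inv_p_lt_one : (p : ℝ)⁻¹ < 1 := inv_lt_one_of_one_lt₀ one_lt_p

/-- The Teichmüller elements: the roots of unity of order prime to `p`, and zero. -/
def teichSet (p : ℕ) [Fact p.Prime] : Set (PadicAlgCl p) := {ζ | ∃ s, s ≠ 0 ∧ ζ ^ p ^ s = ζ}

/-- A finite extension of `ℚ_p` contains a Teichmüller representative of each of its integral
elements. -/
theorem exists_teich (L : IntermediateField ℚ_[p] (PadicAlgCl p)) [FiniteDimensional ℚ_[p] L]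
    {y : PadicAlgCl p} (hy : y ∈ L) (hy1 : ‖y‖ ≤ 1) :
    ∃ ζ ∈ L, ζ ∈ teichSet p ∧ ‖y - ζ‖ < 1 := by
  set M : Submodule ℚ_[p] (PadicAlgCl p) := Subalgebra.toSubmodule L.toSubalgebra with hM
  have hfd : FiniteDimensional ℚ_[p] M := inferInstanceAs (FiniteDimensional ℚ_[p] L)
  have hprop : ProperSpace M := FiniteDimensional.proper ℚ_[p] M
  have hp1 : ‖(p : PadicAlgCl p)‖ < 1 := by rw [norm_p_algCl]; exact inv_p_lt_one
  have hpow1 : ∀ n : ℕ, ‖y ^ n‖ ≤ 1 := fun n => by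
    rw [norm_pow]; exact pow_le_one₀ (norm_nonneg _) hy1
  -- In place of finiteness of the residue field: by compactness of the unit ball two of the powers
  -- y^(p^i) are at distance below 1, and Frobenius is injective on residues.
  obtain ⟨s, hs, hys⟩ : ∃ s, s ≠ 0 ∧ ‖y - y ^ p ^ s‖ < 1 := by
    let u : ℕ → M := fun i => ⟨y ^ p ^ i, (pow_mem hy _ : y ^ p ^ i ∈ L)⟩
    have hu : ∀ i, u i ∈ Metric.closedBall (0 : M) 1 := fun i => by
      rw [mem_closedBall_zero_iff]; exact hpow1 _
    obtain ⟨x, -, ψ, hψ, hlim⟩ := (isCompact_closedBall (0 : M) 1).tendsto_subseq hu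
    have hc := hlim.cauchySeq
    rw [Metric.cauchySeq_iff] at hc
    obtain ⟨N, hN⟩ := hc 1 one_pos
    have h1 := hN N le_rfl (N + 1) (Nat.le_succ N)
    have hlt : ψ N < ψ (N + 1) := hψ (Nat.lt_succ_self N)
    refine ⟨ψ (N + 1) - ψ N, by omega, ?_⟩
    refine norm_sub_lt_one_of_pow (p := p) hy1 (hpow1 _) hp1 (ψ N) ?_
    rw [← pow_mul, ← pow_add, Nat.sub_add_cancel hlt.le]
    rw [dist_eq_norm] at h1
    exact h1
  set κ : ℝ := max ‖(p : PadicAlgCl p)‖ ‖y - y ^ p ^ s‖ with hκ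
  have hκ1 : κ < 1 := max_lt hp1 hys
  have hκ0 : 0 ≤ κ := (norm_nonneg _).trans (le_max_left _ _)
  -- The map x ↦ x^(p^s) contracts differences by κ, so its iterates at y converge to a fixed point
  -- ζ in the residue class of y.
  let v : ℕ → PadicAlgCl p := fun n => y ^ (p ^ s) ^ n
  have hv1 : ∀ n, v (n + 1) = v n ^ p ^ s := fun n => by
    simp only [v]; rw [pow_succ, pow_mul]
  have hstep : ∀ n, ‖v n - v (n + 1)‖ ≤ κ * κ ^ n := fun n => by
    induction n with
    | zero =>
      have : ‖y - y ^ p ^ s‖ ≤ κ := le_max_right _ _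
      simpa [v] using this
    | succ n ih =>
      rw [hv1 n, hv1 (n + 1)]
      have h1 : ‖v n - v (n + 1)‖ ≤ κ := ih.trans
        (mul_le_of_le_one_right hκ0 (pow_le_one₀ hκ0 hκ1.le))
      refine (norm_pow_pow_sub_le (hpow1 _) (hpow1 _) hκ1 (le_max_left _ _) h1 hs).trans ?_
      rw [show κ * κ ^ (n + 1) = κ * (κ * κ ^ n) by ring]
      exact mul_le_mul_of_nonneg_left ih hκ0
  have hcauchy : CauchySeq v := cauchySeq_of_le_geometric κ κ hκ1 fun n => by
    rw [dist_eq_norm]; exact hstep n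
  obtain ⟨ζ, hζL, hζ⟩ := cauchySeq_tendsto_of_isComplete
    (Submodule.complete_of_finiteDimensional M)
    (fun n => (pow_mem hy _ : v n ∈ L)) hcauchy
  refine ⟨ζ, hζL, ⟨s, hs, ?_⟩, ?_⟩
  · have h1 : Tendsto (fun n => v (n + 1)) atTop (𝓝 ζ) := hζ.comp (tendsto_add_atTop_nat 1)
    have h2 : Tendsto (fun n => v (n + 1)) atTop (𝓝 (ζ ^ p ^ s)) := by
      simp only [hv1]; exact hζ.pow _
    exact tendsto_nhds_unique h2 h1
  · have h1 : ∀ n, ‖y - v n‖ ≤ κ := fun n => by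
      induction n with
      | zero => simpa [v] using hκ0
      | succ n ih =>
        exact norm_sub_le_of_le _ (v n) _ ih ((hstep n).trans
          (mul_le_of_le_one_right hκ0 (pow_le_one₀ hκ0 hκ1.le)))
    exact (le_of_tendsto (hζ.const_sub y).norm (Eventually.of_forall h1)).trans_lt hκ1

/-- In a ring of characteristic `p`, the elements fixed by some power of Frobenius form a subring. -/
def frobFixed (Q : Type*) [CommRing Q] (p : ℕ) [ExpChar Q p] : Subring Q where
  carrier := {x | ∃ s, s ≠ 0 ∧ x ^ p ^ s = x}
  one_mem' := ⟨1, one_ne_zero, one_pow _⟩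
  zero_mem' := ⟨1, one_ne_zero, zero_pow (pow_ne_zero _ (expChar_pos Q p).ne')⟩
  mul_mem' := by
    rintro a b ⟨s, hs, ha⟩ ⟨s', hs', hb⟩
    have h : ∀ {x : Q} {s : ℕ}, x ^ p ^ s = x → ∀ k, x ^ p ^ (s * k) = x := fun {x s} hx k => by
      induction k with
      | zero => simp
      | succ k ih => rw [mul_add, pow_add, pow_mul, ih, mul_one, hx]
    refine ⟨s * s', mul_ne_zero hs hs', ?_⟩
    rw [mul_pow, h ha, mul_comm s, h hb]
  add_mem' := by
    rintro a b ⟨s, hs, ha⟩ ⟨s', hs', hb⟩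
    have h : ∀ {x : Q} {s : ℕ}, x ^ p ^ s = x → ∀ k, x ^ p ^ (s * k) = x := fun {x s} hx k => by
      induction k with
      | zero => simp
      | succ k ih => rw [mul_add, pow_add, pow_mul, ih, mul_one, hx]
    refine ⟨s * s', mul_ne_zero hs hs', ?_⟩
    rw [add_pow_expChar_pow, h ha, mul_comm s, h hb]
  neg_mem' := by
    rintro a ⟨s, hs, ha⟩
    refine ⟨s, hs, ?_⟩
    have := map_neg (iterateFrobenius Q p s) a
    rwa [iterateFrobenius_def, iterateFrobenius_def, ha] at this

/-- The ring generated by `ℤ_p` and the Teichmüller elements. -/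
noncomputable def teichRing (p : ℕ) [Fact p.Prime] : Subring (PadicAlgCl p) :=
  Subring.closure (teichSet p ∪ (fun x : ℤ_[p] => algebraMap ℚ_[p] (PadicAlgCl p) x) '' Set.univ)

theorem teichSet_norm_le {ζ : PadicAlgCl p} (h : ζ ∈ teichSet p) : ‖ζ‖ ≤ 1 := by
  obtain ⟨s, hs, e⟩ := h
  by_contra! hcon
  have h1 := congrArg norm e
  rw [norm_pow] at h1
  have h2 : 1 < p ^ s := Nat.one_lt_pow hs (Fact.out : p.Prime).one_lt
  exact absurd h1 (ne_of_gt (lt_self_pow₀ hcon h2))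

theorem teichRing_norm_le {x : PadicAlgCl p} (h : x ∈ teichRing p) : ‖x‖ ≤ 1 := by
  have : teichRing p ≤ unitRing (PadicAlgCl p) := by
    refine Subring.closure_le.2 (Set.union_subset (fun ζ hζ => teichSet_norm_le hζ) ?_)
    rintro _ ⟨x, -, rfl⟩
    change ‖algebraMap ℚ_[p] (PadicAlgCl p) x‖ ≤ 1
    rw [norm_algebraMap']
    exact x.2
  exact this h

/-- Modulo p every generator is fixed by a power of Frobenius (for ℤ_p by Fermat's little theorem),
and elements with this property form a subring. -/
theorem exists_pow_sub_eq_of_mem_teichRing {x : PadicAlgCl p} (h : x ∈ teichRing p) :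
    ∃ s, s ≠ 0 ∧ ∃ y ∈ teichRing p, x ^ p ^ s - x = p * y := by
  set W := teichRing p
  set I : Ideal W := Ideal.span {(p : W)} with hI
  have hmem : ∀ z : W, z ∈ I ↔ ∃ y ∈ W, (z : PadicAlgCl p) = p * y := fun z => by
    rw [hI, Ideal.mem_span_singleton]
    exact ⟨fun ⟨y, hy⟩ => ⟨y, y.2, congrArg Subtype.val hy⟩,
      fun ⟨y, hy, e⟩ => ⟨⟨y, hy⟩, Subtype.ext e⟩⟩
  have hnt : Nontrivial (W ⧸ I) := by
    refine Ideal.Quotient.nontrivial_iff.2 fun h => ?_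
    obtain ⟨y, hy, e⟩ := (hmem 1).1 (h ▸ Submodule.mem_top)
    have h1 := congrArg norm e
    rw [norm_mul, norm_p_algCl] at h1
    have h2 : (p : ℝ)⁻¹ * ‖y‖ < 1 :=
      (mul_le_of_le_one_right (by positivity) (teichRing_norm_le hy)).trans_lt inv_p_lt_one
    rw [← h1] at h2
    simp at h2
  have hchar : CharP (W ⧸ I) p := by
    refine ringChar.of_eq (((Nat.dvd_prime (Fact.out : p.Prime)).1 (ringChar.dvd ?_)).resolve_left
      (CharP.char_ne_one (W ⧸ I) _))
    rw [← map_natCast (Ideal.Quotient.mk I), Ideal.Quotient.eq_zero_iff_mem]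
    exact Ideal.mem_span_singleton_self _
  have key : ∀ x (hx : x ∈ W), Ideal.Quotient.mk I ⟨x, hx⟩ ∈ frobFixed (W ⧸ I) p := by
    intro x hx
    induction hx using Subring.closure_induction with
    | mem x hx =>
      rcases hx with hx | ⟨z, -, rfl⟩
      · obtain ⟨s, hs, e⟩ := hx
        refine ⟨s, hs, ?_⟩
        rw [← map_pow]
        congr 1
        exact Subtype.ext e
      · refine ⟨1, one_ne_zero, ?_⟩
        rw [pow_one, ← map_pow, Ideal.Quotient.eq, hmem]
        have h1 : z ^ p - z ∈ RingHom.ker (PadicInt.toZMod (p := p)) := by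
          rw [RingHom.mem_ker, map_sub, map_pow, ZMod.pow_card, sub_self]
        rw [PadicInt.ker_toZMod, PadicInt.maximalIdeal_eq_span_p, Ideal.mem_span_singleton] at h1
        obtain ⟨w, hw⟩ := h1
        refine ⟨algebraMap ℚ_[p] (PadicAlgCl p) w,
          Subring.subset_closure (Or.inr ⟨w, trivial, rfl⟩), ?_⟩
        have h2 := congrArg (fun v : ℤ_[p] => algebraMap ℚ_[p] (PadicAlgCl p) (v : ℚ_[p])) hw
        simp only [PadicInt.coe_sub, PadicInt.coe_pow, PadicInt.coe_mul, map_sub, map_pow, map_mul,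
          PadicInt.coe_natCast, map_natCast] at h2
        exact h2
    | zero => exact zero_mem (frobFixed (W ⧸ I) p)
    | one => exact one_mem (frobFixed (W ⧸ I) p)
    | add x y hx hy h1 h2 => exact add_mem (S := Subring (W ⧸ I)) h1 h2
    | neg x hx h1 => exact neg_mem (S := Subring (W ⧸ I)) h1
    | mul x y hx hy h1 h2 => exact mul_mem (S := Subring (W ⧸ I)) h1 h2
  obtain ⟨s, hs, e⟩ := key x h
  rw [← map_pow, Ideal.Quotient.eq, hmem] at e
  obtain ⟨y, hy, e⟩ := e
  exact ⟨s, hs, y, hy, e⟩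

/-- If ‖x‖ < 1, then x^(p^s) is smaller than x, so x has the norm of p y with y in the same ring.
Descent on a lower bound p^(-N) for the norm terminates. -/
theorem norm_of_mem_teichRing {x : PadicAlgCl p} (h : x ∈ teichRing p) (hx : x ≠ 0) :
    ∃ n : ℤ, ‖x‖ = (p : ℝ) ^ n := by
  have key : ∀ (N : ℕ) (x : PadicAlgCl p), x ∈ teichRing p → ((p : ℝ)⁻¹) ^ N < ‖x‖ →
      ∃ n : ℤ, ‖x‖ = (p : ℝ) ^ n := by
    intro N
    induction N with
    | zero =>
      intro x hx h
      exact absurd h (not_lt.2 (by simpa using teichRing_norm_le hx))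
    | succ N ih =>
      intro x hx h
      rcases (teichRing_norm_le hx).eq_or_lt with h1 | h1
      · exact ⟨0, by simpa using h1⟩
      obtain ⟨s, hs, y, hy, e⟩ := exists_pow_sub_eq_of_mem_teichRing hx
      have hpos : 0 < ‖x‖ := lt_of_le_of_lt (by positivity) h
      have h2 : 1 < p ^ s := Nat.one_lt_pow hs (Fact.out : p.Prime).one_lt
      have h3 : ‖x ^ p ^ s‖ < ‖x‖ := by
        rw [norm_pow]
        exact pow_lt_self_of_lt_one₀ hpos h1 h2
      have h4 : ‖x‖ = (p : ℝ)⁻¹ * ‖y‖ := by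
        rw [← norm_p_algCl (p := p), ← norm_mul, ← e]
        have : ‖x - (x - x ^ p ^ s)‖ < ‖x‖ := by rwa [sub_sub_cancel]
        rw [← norm_neg (x ^ p ^ s - x), neg_sub, norm_eq_of_norm_sub_lt this]
      have hp0 : (0 : ℝ) < (p : ℝ)⁻¹ := inv_pos.2 p_pos
      obtain ⟨n, hn⟩ := ih y hy (by
        rw [h4, pow_succ'] at h
        exact lt_of_mul_lt_mul_left h hp0.le)
      refine ⟨n - 1, ?_⟩
      rw [h4, hn, zpow_sub₀ p_pos.ne', zpow_one]
      field_simp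
  obtain ⟨N, hN⟩ := exists_pow_lt_of_lt_one (norm_pos_iff.2 hx) (inv_p_lt_one (p := p))
  exact key N x h hN

/-- The extension of `ℚ_p` generated by the Teichmüller elements. -/
noncomputable def teichField (p : ℕ) [Fact p.Prime] : IntermediateField ℚ_[p] (PadicAlgCl p) :=
  IntermediateField.adjoin ℚ_[p] (teichSet p)

theorem exists_pow_mul_mem_teichRing {x : PadicAlgCl p} (h : x ∈ teichField p) :
    ∃ n : ℕ, (p : PadicAlgCl p) ^ n * x ∈ teichRing p := by
  have h1 : x ∈ Algebra.adjoin ℚ_[p] (teichSet p) := by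
    rw [← IntermediateField.adjoin_toSubalgebra]
    exact h
  have hp : ∀ n : ℕ, (p : PadicAlgCl p) ^ n ∈ teichRing p := fun n =>
    pow_mem (natCast_mem (teichRing p) p) n
  induction h1 using Algebra.adjoin_induction with
  | mem x hx =>
    refine ⟨0, ?_⟩
    rw [pow_zero, one_mul]
    exact Subring.subset_closure (Or.inl hx)
  | algebraMap r =>
    obtain ⟨n, hn⟩ := exists_pow_lt_of_lt_one
      (show 0 < (‖r‖ + 1)⁻¹ by positivity) (inv_p_lt_one (p := p))
    refine ⟨n, ?_⟩
    have h2 : ‖(p : ℚ_[p]) ^ n * r‖ ≤ 1 := by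
      rw [norm_mul, norm_pow, Padic.norm_p]
      have : ((p : ℝ)⁻¹) ^ n * ‖r‖ ≤ (‖r‖ + 1)⁻¹ * (‖r‖ + 1) :=
        mul_le_mul hn.le (by linarith) (norm_nonneg _) (by positivity)
      rwa [inv_mul_cancel₀ (by positivity)] at this
    refine Subring.subset_closure (Or.inr ⟨⟨_, h2⟩, trivial, ?_⟩)
    simp
  | add x y hx hy h1 h2 =>
    obtain ⟨n, hn⟩ := h1 ((IntermediateField.algebra_adjoin_le_adjoin _ _) hx)
    obtain ⟨m, hm⟩ := h2 ((IntermediateField.algebra_adjoin_le_adjoin _ _) hy)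
    refine ⟨n + m, ?_⟩
    have := add_mem (mul_mem (hp m) hn) (mul_mem (hp n) hm)
    convert this using 1
    ring
  | mul x y hx hy h1 h2 =>
    obtain ⟨n, hn⟩ := h1 ((IntermediateField.algebra_adjoin_le_adjoin _ _) hx)
    obtain ⟨m, hm⟩ := h2 ((IntermediateField.algebra_adjoin_le_adjoin _ _) hy)
    refine ⟨n + m, ?_⟩
    have := mul_mem hn hm
    convert this using 1
    ring

theorem isUnramifiedExt_teichField : IsUnramifiedExt p (teichField p) := by
  intro x hx hx0
  obtain ⟨n, hn⟩ := exists_pow_mul_mem_teichRing hx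
  have hp0 : (p : PadicAlgCl p) ≠ 0 := by exact_mod_cast (Fact.out : p.Prime).ne_zero
  obtain ⟨k, hk⟩ := norm_of_mem_teichRing hn (mul_ne_zero (pow_ne_zero _ hp0) hx0)
  rw [norm_mul, norm_pow, norm_p_algCl] at hk
  refine ⟨k + n, ?_⟩
  rw [zpow_add₀ p_pos.ne', ← hk, zpow_natCast]
  rw [mul_right_comm, inv_pow, inv_mul_cancel₀ (pow_ne_zero n p_pos.ne'), one_mul]

theorem teich_mem_Qur {ζ : PadicAlgCl p} (h : ζ ∈ teichSet p) : ζ ∈ Qur p := by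
  have hle : IntermediateField.adjoin ℚ_[p] {ζ} ≤ Qur p := by
    refine le_sSup ⟨?_, fun x hx => isUnramifiedExt_teichField x ?_⟩
    · exact IntermediateField.adjoin.finiteDimensional (Algebra.IsIntegral.isIntegral ζ)
    · exact IntermediateField.adjoin.mono _ _ _ (Set.singleton_subset_iff.2 h) hx
  exact hle (IntermediateField.mem_adjoin_simple_self _ _)

theorem norm_le_inv_of_lt_one {x : ℝ} {n : ℤ} (h : x = (p : ℝ) ^ n) (hx : x < 1) :
    x ≤ (p : ℝ)⁻¹ := by
  rw [h, ← zpow_zero (p : ℝ), zpow_lt_zpow_iff_right₀ one_lt_p] at hx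
  rw [h, ← zpow_neg_one]
  exact zpow_le_zpow_right₀ one_lt_p.le (by omega)

/-- In an unramified L, p is a uniformizer, so integral elements have p-adic expansions with
Teichmüller digits in L. The partial sums lie in the finite-dimensional, hence closed, space
`teichField p ⊓ L`. It follows that the compositum `Qur p` is still unramified. -/
theorem Qur_le_teichField : Qur p ≤ teichField p := by
  refine sSup_le ?_
  rintro L ⟨hfd, hL⟩
  have hp0 : (p : PadicAlgCl p) ≠ 0 := by exact_mod_cast (Fact.out : p.Prime).ne_zero
  have happrox : ∀ (n : ℕ), ∀ x ∈ L, ‖x‖ ≤ 1 →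
      ∃ w ∈ teichField p ⊓ L, ‖w - x‖ ≤ ((p : ℝ)⁻¹) ^ n := by
    intro n
    induction n with
    | zero => intro x _ h; exact ⟨0, zero_mem _, by simpa using h⟩
    | succ n ih =>
      intro x hx h
      obtain ⟨ζ, hζL, hζ, hlt⟩ := exists_teich L hx h
      have hd : x - ζ ∈ L := sub_mem hx hζL
      have hle : ‖x - ζ‖ ≤ (p : ℝ)⁻¹ := by
        by_cases h0 : x - ζ = 0
        · rw [h0, norm_zero]; exact (inv_pos.2 p_pos).le
        · obtain ⟨k, hk⟩ := hL _ hd h0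
          exact norm_le_inv_of_lt_one hk hlt
      obtain ⟨w, hw, hwx⟩ := ih ((x - ζ) / p) (div_mem hd (natCast_mem _ _)) (by
        rw [norm_div, norm_p_algCl, div_inv_eq_mul]
        calc ‖x - ζ‖ * p ≤ (p : ℝ)⁻¹ * p := mul_le_mul_of_nonneg_right hle p_pos.le
          _ = 1 := inv_mul_cancel₀ p_pos.ne')
      refine ⟨ζ + p * w, add_mem ⟨IntermediateField.subset_adjoin _ _ hζ, hζL⟩
        (mul_mem (natCast_mem _ _) hw), ?_⟩
      have : ζ + p * w - x = p * (w - (x - ζ) / p) := by field_simp; ring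
      rw [this, norm_mul, norm_p_algCl, pow_succ']
      exact mul_le_mul_of_nonneg_left hwx (inv_pos.2 p_pos).le
  have hfd' : FiniteDimensional ℚ_[p] (Subalgebra.toSubmodule (teichField p ⊓ L).toSubalgebra) :=
    FiniteDimensional.of_injective (Submodule.inclusion
      (p := Subalgebra.toSubmodule (teichField p ⊓ L).toSubalgebra)
      (p' := Subalgebra.toSubmodule L.toSubalgebra) (fun x hx => hx.2))
      (Submodule.inclusion_injective _)
  have hclosed := Submodule.closed_of_finiteDimensional
    (Subalgebra.toSubmodule (teichField p ⊓ L).toSubalgebra)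
  have hball : ∀ x ∈ L, ‖x‖ ≤ 1 → x ∈ teichField p := by
    intro x hx h
    choose w hw hwx using fun n => happrox n x hx h
    have hlim : Tendsto w atTop (𝓝 x) := by
      rw [tendsto_iff_norm_sub_tendsto_zero]
      exact squeeze_zero (fun _ => norm_nonneg _) hwx
        (tendsto_pow_atTop_nhds_zero_of_lt_one (inv_pos.2 p_pos).le inv_p_lt_one)
    exact (hclosed.mem_of_tendsto hlim (Eventually.of_forall hw)).1
  intro x hx
  obtain ⟨n, hn⟩ := exists_pow_lt_of_lt_one
    (show 0 < (‖x‖ + 1)⁻¹ by positivity) (inv_p_lt_one (p := p))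
  have h2 : ‖(p : PadicAlgCl p) ^ n * x‖ ≤ 1 := by
    rw [norm_mul, norm_pow, norm_p_algCl]
    have : ((p : ℝ)⁻¹) ^ n * ‖x‖ ≤ (‖x‖ + 1)⁻¹ * (‖x‖ + 1) :=
      mul_le_mul hn.le (by linarith) (norm_nonneg _) (by positivity)
    rwa [inv_mul_cancel₀ (by positivity)] at this
  have h3 := hball _ (mul_mem (pow_mem (natCast_mem _ _) n) hx) h2
  have h4 := div_mem h3 (pow_mem (natCast_mem (teichField p) p) n)
  rwa [mul_div_cancel_left₀ _ (pow_ne_zero n hp0)] at h4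

theorem norm_of_mem_Qur {x : PadicAlgCl p} (h : x ∈ Qur p) (hx : x ≠ 0) :
    ∃ n : ℤ, ‖x‖ = (p : ℝ) ^ n :=
  isUnramifiedExt_teichField x (Qur_le_teichField h) hx

end Unramified

end ArithDiff

namespace ArithDiff

/-! ### The fields `K` and `K_π` -/

variable {p : ℕ} [Fact p.Prime]

/-- A root of a monic polynomial with integral coefficients is integral. -/
theorem norm_le_one_of_pow_eq {F : Type*} [NormedField F] [IsUltrametricDist F] {x : F} {e : ℕ}
    {a : ℕ → F} (ha : ∀ i < e, ‖a i‖ ≤ 1) (h : x ^ e = ∑ i ∈ Finset.range e, a i * x ^ i) :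
    ‖x‖ ≤ 1 := by
  by_contra! hcon
  cases e with
  | zero => simp at h
  | succ n =>
    have h1 : ‖x ^ (n + 1)‖ ≤ ‖x‖ ^ n := by
      rw [h]
      refine IsUltrametricDist.norm_sum_le_of_forall_le_of_nonneg (by positivity) fun i hi => ?_
      rw [Finset.mem_range] at hi
      rw [norm_mul, norm_pow]
      exact (mul_le_of_le_one_left (by positivity) (ha i hi)).trans
        (pow_le_pow_right₀ hcon.le (by omega))
    rw [norm_pow] at h1
    exact absurd h1 (not_le.2 (pow_lt_pow_right₀ hcon (Nat.lt_succ_self n)))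

theorem norm_p : ‖(p : ℂ_[p])‖ = (p : ℝ)⁻¹ := by
  rw [← PadicComplex.coe_natCast, PadicComplex.norm_extends, norm_p_algCl]

theorem p_ne_zero : (p : ℂ_[p]) ≠ 0 := by
  exact_mod_cast (Fact.out : p.Prime).ne_zero

theorem mem_K_iff {x : ℂ_[p]} :
    x ∈ K p ↔ x ∈ closure ((fun y : PadicAlgCl p => (y : ℂ_[p])) '' (Qur p : Set (PadicAlgCl p))) :=
  Iff.rfl

theorem coe_mem_K {y : PadicAlgCl p} (h : y ∈ Qur p) : (y : ℂ_[p]) ∈ K p :=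
  mem_K_iff.2 (subset_closure ⟨y, h, rfl⟩)

theorem isClosed_K : IsClosed (K p : Set ℂ_[p]) := isClosed_closure

theorem norm_of_mem_K {x : ℂ_[p]} (h : x ∈ K p) (hx : x ≠ 0) : ∃ n : ℤ, ‖x‖ = (p : ℝ) ^ n := by
  obtain ⟨_, ⟨y, hy, rfl⟩, hxy⟩ := Metric.mem_closure_iff.1 (mem_K_iff.1 h) ‖x‖ (norm_pos_iff.2 hx)
  rw [dist_eq_norm] at hxy
  have h1 := norm_eq_of_norm_sub_lt hxy
  rw [PadicComplex.norm_extends] at h1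
  have hy0 : y ≠ 0 := by
    rintro rfl
    rw [norm_zero] at h1
    exact hx (norm_eq_zero.1 h1.symm)
  rw [← h1]
  exact norm_of_mem_Qur hy hy0

instance : CompleteSpace (K p) := isClosed_K.completeSpace_coe

noncomputable instance : NontriviallyNormedField (K p) where
  non_trivial := by
    refine ⟨⟨(p : ℂ_[p])⁻¹, inv_mem (natCast_mem _ _)⟩, ?_⟩
    change 1 < ‖(p : ℂ_[p])⁻¹‖
    rw [norm_inv, norm_p, inv_inv]
    exact one_lt_p

noncomputable instance : NormedAlgebra (K p) (Kalg p) where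
  norm_smul_le r x := by
    rw [Algebra.smul_def, norm_mul]
    rfl

instance : Algebra.IsAlgebraic (K p) (Kalg p) := by unfold Kalg; infer_instance

instance : IsAlgClosed (Kalg p) :=
  (algebraicClosure.isAlgClosure (F := K p) (E := ℂ_[p])).isAlgClosed

/-- Approximate by an element algebraic over ℚ_p, then by its Teichmüller representative, which is
unramified. Hence R already has the residue field of ℂ_p. -/
theorem exists_mem_R_norm_sub_lt {x : ℂ_[p]} (h : ‖x‖ ≤ 1) : ∃ c ∈ R p, ‖x - c‖ < 1 := by
  obtain ⟨y, hy⟩ := UniformSpace.Completion.denseRange_coe.exists_dist_lt x one_pos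
  rw [dist_eq_norm] at hy
  have hy1 : ‖y‖ ≤ 1 := by
    rw [← PadicComplex.norm_extends]
    have := norm_sub_le_max x (x - y)
    rw [sub_sub_cancel] at this
    exact this.trans (max_le h hy.le)
  have : FiniteDimensional ℚ_[p] (IntermediateField.adjoin ℚ_[p] {y}) :=
    IntermediateField.adjoin.finiteDimensional (Algebra.IsIntegral.isIntegral y)
  obtain ⟨ζ, -, hζ, hlt⟩ := exists_teich (IntermediateField.adjoin ℚ_[p] {y})
    (IntermediateField.mem_adjoin_simple_self _ _) hy1
  refine ⟨ζ, ⟨coe_mem_K (teich_mem_Qur hζ), ?_⟩, norm_sub_lt_of_lt _ _ _ hy ?_⟩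
  · rw [PadicComplex.norm_extends]; exact teichSet_norm_le hζ
  · rw [← UniformSpace.Completion.coe_sub, PadicComplex.norm_extends]; exact hlt

section ValRing

variable {F : Subfield ℂ_[p]}

theorem valRing_dvd_iff {a x : valRing F} (ha : a ≠ 0) :
    a ∣ x ↔ ‖(x : ℂ_[p])‖ ≤ ‖(a : ℂ_[p])‖ := by
  have ha' : (a : ℂ_[p]) ≠ 0 := fun h => ha (Subtype.ext h)
  constructor
  · rintro ⟨y, rfl⟩
    rw [Subring.coe_mul, norm_mul]
    exact mul_le_of_le_one_right (norm_nonneg _) y.2.2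
  · intro h
    refine ⟨⟨x / a, div_mem x.2.1 a.2.1, ?_⟩, Subtype.ext ?_⟩
    · rw [norm_div]; exact div_le_one_of_le₀ h (norm_nonneg _)
    · exact (mul_div_cancel₀ _ ha').symm

theorem isAdicComplete_valRing (hF : IsClosed (F : Set ℂ_[p])) {a : valRing F} (ha : a ≠ 0)
    (ha1 : ‖(a : ℂ_[p])‖ < 1) : IsAdicComplete (Ideal.span {a}) (valRing F) := by
  have hmem : ∀ (n : ℕ) (x y : valRing F), (x ≡ y [SMOD (Ideal.span {a} ^ n • ⊤ : Ideal (valRing F))]) ↔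
      ‖(x : ℂ_[p]) - y‖ ≤ ‖(a : ℂ_[p])‖ ^ n := fun n x y => by
    rw [SModEq.sub_mem, smul_eq_mul, Ideal.mul_top, Ideal.span_singleton_pow,
      Ideal.mem_span_singleton, valRing_dvd_iff (pow_ne_zero n ha), Subring.coe_pow, norm_pow]
    rfl
  have hlim : Tendsto (fun n : ℕ => ‖(a : ℂ_[p])‖ ^ n) atTop (𝓝 0) :=
    tendsto_pow_atTop_nhds_zero_of_lt_one (norm_nonneg _) ha1
  refine { haus' := fun x hx => ?_, prec' := fun f hf => ?_ }
  · have h1 : ∀ n, ‖(x : ℂ_[p])‖ ≤ ‖(a : ℂ_[p])‖ ^ n := fun n => by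
      have := (hmem n x 0).1 (hx n)
      rwa [Subring.coe_zero, sub_zero] at this
    exact Subtype.ext (norm_le_zero_iff.1 (ge_of_tendsto' hlim h1))
  · have hf' : ∀ m n, m ≤ n → ‖(f m : ℂ_[p]) - f n‖ ≤ ‖(a : ℂ_[p])‖ ^ m := fun m n h =>
      (hmem m _ _).1 (hf h)
    have hc : CauchySeq fun n => (f n : ℂ_[p]) :=
      cauchySeq_of_le_geometric _ 1 ha1 fun n => by
        rw [dist_eq_norm, one_mul]; exact hf' n (n + 1) (Nat.le_succ n)
    obtain ⟨L, hL⟩ := cauchySeq_tendsto_of_complete hc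
    have hLm : L ∈ valRing F := ⟨hF.mem_of_tendsto hL (Eventually.of_forall fun n => (f n).2.1),
      le_of_tendsto hL.norm (Eventually.of_forall fun n => (f n).2.2)⟩
    refine ⟨⟨L, hLm⟩, fun n => (hmem n _ _).2 ?_⟩
    exact le_of_tendsto (hL.const_sub _).norm ((eventually_ge_atTop n).mono fun m hm => hf' n m hm)

theorem coe_valRing_natCast (n : ℕ) : ((n : valRing F) : ℂ_[p]) = n := by simp

theorem valRing_p_ne_zero : (p : valRing F) ≠ 0 := fun h =>
  p_ne_zero (p := p) (by simpa using congrArg Subtype.val h)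

end ValRing

theorem isAdicComplete_R : IsAdicComplete (Ideal.span {(p : R p)}) (R p) := by
  refine isAdicComplete_valRing isClosed_K valRing_p_ne_zero ?_
  rw [coe_valRing_natCast, norm_p]
  exact inv_p_lt_one

theorem R_p_dvd_of_norm_lt_one {r : R p} (h : ‖(r : ℂ_[p])‖ < 1) : (p : R p) ∣ r := by
  rw [valRing_dvd_iff valRing_p_ne_zero, coe_valRing_natCast, norm_p]
  by_cases h0 : (r : ℂ_[p]) = 0
  · rw [h0, norm_zero]; exact (inv_pos.2 p_pos).le
  · obtain ⟨n, hn⟩ := norm_of_mem_K r.2.1 h0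
    exact norm_le_inv_of_lt_one hn h

theorem norm_lt_one_of_p_dvd {F : Subfield ℂ_[p]} {r : valRing F} (h : (p : valRing F) ∣ r) :
    ‖(r : ℂ_[p])‖ < 1 := by
  rw [valRing_dvd_iff valRing_p_ne_zero, coe_valRing_natCast, norm_p] at h
  exact h.trans_lt inv_p_lt_one

/-! ### The residue field -/

theorem valRing_mem_maximalIdeal {F : Subfield ℂ_[p]} (x : valRing F) :
    x ∈ IsLocalRing.maximalIdeal (valRing F) ↔ ‖(x : ℂ_[p])‖ < 1 := by
  rw [IsLocalRing.mem_maximalIdeal, mem_nonunits_iff, valRing_isUnit_iff, lt_iff_le_and_ne]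
  exact ⟨fun h => ⟨x.2.2, h⟩, fun h => h.2⟩

theorem RtoResidue_eq_zero_iff (r : R p) : RtoResidue p r = 0 ↔ (p : R p) ∣ r := by
  change IsLocalRing.residue (Ralg p) (RtoRalg p r) = 0 ↔ _
  rw [IsLocalRing.residue_eq_zero_iff, valRing_mem_maximalIdeal]
  exact ⟨fun h => R_p_dvd_of_norm_lt_one h, fun h => norm_lt_one_of_p_dvd (r := r) h⟩

theorem ker_RtoResidue : RingHom.ker (RtoResidue p) = Ideal.span {(p : R p)} := by
  ext r
  rw [RingHom.mem_ker, RtoResidue_eq_zero_iff, Ideal.mem_span_singleton]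

theorem RtoResidue_surjective : Function.Surjective (RtoResidue p) := by
  intro y
  obtain ⟨x, rfl⟩ := IsLocalRing.residue_surjective y
  obtain ⟨c, hc, hlt⟩ := exists_mem_R_norm_sub_lt x.2.2
  refine ⟨⟨c, hc⟩, ?_⟩
  change IsLocalRing.residue (Ralg p) (RtoRalg p ⟨c, hc⟩) = _
  rw [← sub_eq_zero, ← map_sub, IsLocalRing.residue_eq_zero_iff, valRing_mem_maximalIdeal]
  change ‖c - x‖ < 1
  rwa [norm_sub_rev]

instance isMaximal_span_p : (Ideal.span {(p : R p)}).IsMaximal := by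
  rw [← ker_RtoResidue]
  exact RingHom.ker_isMaximal_of_surjective _ RtoResidue_surjective

/-- A monic lift of the polynomial has a root in the algebraically closed field K^alg; the root is
integral, and it reduces to the root wanted. -/
instance isAlgClosed_k : IsAlgClosed (k p) := by
  refine IsAlgClosed.of_exists_root _ fun f hf hirr => ?_
  obtain ⟨g, hg, hdeg, hmonic⟩ := Polynomial.lifts_and_degree_eq_and_monic
    ((Polynomial.mem_lifts f).2 (Polynomial.map_surjective _ IsLocalRing.residue_surjective f)) hf
  have hinj : Function.Injective (fun x : Ralg p => (⟨x, x.2.1⟩ : Kalg p)) := fun a b h =>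
    Subtype.ext (congrArg (fun z : Kalg p => (z : ℂ_[p])) h)
  let j : Ralg p →+* Kalg p :=
    { toFun := fun x => ⟨x, x.2.1⟩, map_one' := rfl, map_mul' := fun _ _ => rfl, map_zero' := rfl,
      map_add' := fun _ _ => rfl }
  have hd : (g.map j).degree ≠ 0 := by
    rw [hmonic.degree_map, hdeg]
    exact (Polynomial.degree_pos_of_irreducible hirr).ne'
  obtain ⟨x, hx⟩ := IsAlgClosed.exists_root (g.map j) hd
  have hx' : Polynomial.eval₂ j x g = 0 := by rwa [Polynomial.IsRoot, Polynomial.eval_map] at hx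
  have hx1 : ‖x‖ ≤ 1 := by
    rw [Polynomial.eval₂_eq_sum_range, Finset.sum_range_succ, hmonic.coeff_natDegree, map_one,
      one_mul, add_comm] at hx'
    refine norm_le_one_of_pow_eq (e := g.natDegree) (a := fun i => -j (g.coeff i)) (fun i _ => ?_) ?_
    · rw [norm_neg]; exact (g.coeff i).2.2
    · simp only [neg_mul, Finset.sum_neg_distrib]
      exact eq_neg_of_add_eq_zero_left hx'
  refine ⟨IsLocalRing.residue (Ralg p) ⟨x, x.2, hx1⟩, ?_⟩
  have h0 : g.eval (⟨x, x.2, hx1⟩ : Ralg p) = 0 := by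
    apply hinj
    change j (g.eval _) = j 0
    rw [map_zero, ← Polynomial.eval₂_at_apply]
    exact hx'
  rw [← hg, Polynomial.eval_map_apply, h0, map_zero]

end ArithDiff

namespace ArithDiff

/-! ### The ring `R_π` -/

variable {p : ℕ} [Fact p.Prime] {π : PadicAlgCl p}

/-- The defining data of an element of `Π`: it is a root of an Eisenstein equation of degree `e`,
which determines its absolute value. -/
theorem exists_eisenstein (hπ : π ∈ PiSet p) :
    ∃ (e : ℕ) (a : ℕ → PadicAlgCl p), e ≠ 0 ∧ ‖π‖ ^ e = (p : ℝ)⁻¹ ∧ (∀ i, a i ∈ Qur p) ∧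
      π ^ e = ∑ i ∈ Finset.range e, a i * π ^ i := by
  obtain ⟨⟨P, hmonic, heis, hroot⟩, -⟩ := hπ
  set e := P.natDegree with he
  have hexp : π ^ e = ∑ i ∈ Finset.range e, -(P.coeff i : PadicAlgCl p) * π ^ i := by
    rw [Polynomial.aeval_eq_sum_range, Finset.sum_range_succ, hmonic.coeff_natDegree, one_smul,
      add_comm] at hroot
    simp only [neg_mul, Finset.sum_neg_distrib]
    exact eq_neg_of_add_eq_zero_left hroot
  have he0 : e ≠ 0 := by
    intro h0
    rw [h0] at hexp
    simp at hexp
  have hcoeff : ∀ i < e, ‖(P.coeff i : PadicAlgCl p)‖ ≤ (p : ℝ)⁻¹ := fun i hi => by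
    obtain ⟨y, hy⟩ := Ideal.mem_span_singleton.1 (heis.mem hi)
    have : (P.coeff i : PadicAlgCl p) = p * y := by rw [hy]; simp
    rw [this, norm_mul, norm_p_algCl]
    exact mul_le_of_le_one_right (inv_pos.2 p_pos).le y.2.2
  -- Norms of nonzero elements of `Qur p` are powers of p, so if the cofactor y were not a unit it
  -- would be divisible by p, placing the constant coefficient in (p^2).
  have hcoeff0 : ‖(P.coeff 0 : PadicAlgCl p)‖ = (p : ℝ)⁻¹ := by
    obtain ⟨y, hy⟩ := Ideal.mem_span_singleton.1 (heis.mem (Nat.pos_of_ne_zero he0))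
    have h1 : (P.coeff 0 : PadicAlgCl p) = p * y := by rw [hy]; simp
    have h2 : ‖(y : PadicAlgCl p)‖ = 1 := by
      by_contra hne
      have hlt := lt_of_le_of_ne y.2.2 hne
      have hp0 : (p : PadicAlgCl p) ≠ 0 := by exact_mod_cast (Fact.out : p.Prime).ne_zero
      have hle : ‖(y : PadicAlgCl p)‖ ≤ (p : ℝ)⁻¹ := by
        by_cases h0 : (y : PadicAlgCl p) = 0
        · rw [h0, norm_zero]; exact (inv_pos.2 p_pos).le
        · obtain ⟨n, hn⟩ := norm_of_mem_Qur y.2.1 h0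
          exact norm_le_inv_of_lt_one hn hlt
      refine heis.notMem ?_
      rw [pow_two, Ideal.span_singleton_mul_span_singleton, Ideal.mem_span_singleton, hy]
      refine mul_dvd_mul_left _ ⟨⟨y / p, div_mem y.2.1 (natCast_mem _ _), ?_⟩, Subtype.ext ?_⟩
      · rw [norm_div, norm_p_algCl]
        exact div_le_one_of_le₀ hle (inv_pos.2 p_pos).le
      · simp only [Subring.coe_mul, SubringClass.coe_natCast]
        exact (mul_div_cancel₀ _ hp0).symm
    rw [h1, norm_mul, h2, norm_p_algCl, mul_one]
  have hle1 : ‖π‖ ≤ 1 := norm_le_one_of_pow_eq (a := fun i => -(P.coeff i : PadicAlgCl p))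
    (fun i hi => by rw [norm_neg]; exact (hcoeff i hi).trans inv_p_lt_one.le) hexp
  have hlt1 : ‖π‖ < 1 := by
    refine lt_of_le_of_ne hle1 fun h1 => ?_
    have h2 : ‖π ^ e‖ ≤ (p : ℝ)⁻¹ := by
      rw [hexp]
      refine IsUltrametricDist.norm_sum_le_of_forall_le_of_nonneg (inv_pos.2 p_pos).le fun i hi => ?_
      rw [norm_mul, norm_neg, norm_pow, h1, one_pow, mul_one]
      exact hcoeff i (Finset.mem_range.1 hi)
    rw [norm_pow, h1, one_pow] at h2
    exact absurd h2 (not_le.2 inv_p_lt_one)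
  refine ⟨e, fun i => -(P.coeff i : PadicAlgCl p), he0, ?_, fun i => neg_mem (P.coeff i).2.1, hexp⟩
  rw [← norm_pow, ← hcoeff0]
  refine norm_eq_of_norm_sub_lt ?_ |>.trans (norm_neg _)
  obtain ⟨n, hn⟩ := Nat.exists_eq_succ_of_ne_zero he0
  rw [hexp, hn, Finset.sum_range_succ', pow_zero, mul_one, norm_neg, ← norm_neg, neg_sub,
    add_sub_cancel_right, hcoeff0]
  refine lt_of_le_of_lt (IsUltrametricDist.norm_sum_le_of_forall_le_of_nonneg
    (C := (p : ℝ)⁻¹ * ‖π‖) (by positivity) fun i hi => ?_)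
    (mul_lt_of_lt_one_right (inv_pos.2 p_pos) hlt1)
  rw [norm_mul, norm_neg, norm_pow]
  refine mul_le_mul (hcoeff _ ?_) (pow_le_of_le_one (norm_nonneg _) hlt1.le (Nat.succ_ne_zero i))
    (by positivity) (inv_pos.2 p_pos).le
  rw [Finset.mem_range] at hi; omega

theorem norm_pi_pos (hπ : π ∈ PiSet p) : 0 < ‖π‖ := by
  obtain ⟨e, -, he, h, -⟩ := exists_eisenstein hπ
  refine (norm_nonneg π).lt_of_ne' fun h0 => ?_
  rw [h0, zero_pow he] at h
  exact (inv_pos.2 (p_pos (p := p))).ne h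

theorem norm_pi_lt_one (hπ : π ∈ PiSet p) : ‖π‖ < 1 := by
  obtain ⟨e, -, he, h, -⟩ := exists_eisenstein hπ
  by_contra! hcon
  have := one_le_pow₀ hcon (n := e)
  rw [h] at this
  exact absurd this (not_le.2 inv_p_lt_one)

/-- Elements of `K(π)` are polynomials in `π` of degree less than the degree of a monic equation of
`π` over `K`. -/
theorem exists_sum_of_mem_adjoin {K L : Type*} [Field K] [Field L] [Algebra K L] {π : L} {e : ℕ}
    {a : ℕ → K} (h : π ^ e = ∑ i ∈ Finset.range e, algebraMap K L (a i) * π ^ i) {x : L}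
    (hx : x ∈ IntermediateField.adjoin K {π}) :
    ∃ c : ℕ → K, x = ∑ i ∈ Finset.range e, algebraMap K L (c i) * π ^ i := by
  set Q : Polynomial K := Polynomial.X ^ e - ∑ i ∈ Finset.range e, Polynomial.C (a i) * Polynomial.X ^ i
    with hQ
  have hlt : (∑ i ∈ Finset.range e, Polynomial.C (a i) * Polynomial.X ^ i).degree < (e : WithBot ℕ) := by
    refine (Polynomial.degree_sum_le _ _).trans_lt ((Finset.sup_lt_iff (WithBot.bot_lt_coe e)).2
      fun i hi => (Polynomial.degree_C_mul_X_pow_le i (a i)).trans_lt ?_)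
    exact WithBot.coe_lt_coe.2 (Finset.mem_range.1 hi)
  have hmonic : Q.Monic := Polynomial.monic_X_pow_sub hlt
  have hdeg : Q.degree = e := by
    rw [hQ, Polynomial.degree_sub_eq_left_of_degree_lt]
    · exact Polynomial.degree_X_pow e
    · rwa [Polynomial.degree_X_pow]
  have hroot : Polynomial.aeval π Q = 0 := by
    rw [hQ, map_sub, map_pow, Polynomial.aeval_X, h, sub_eq_zero, map_sum]
    simp
  have hx' : x ∈ Algebra.adjoin K {π} := by
    rw [← IntermediateField.adjoin_simple_toSubalgebra_of_isAlgebraic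
      (IsIntegral.isAlgebraic ⟨Q, hmonic, hroot⟩)]
    exact hx
  rw [Algebra.adjoin_singleton_eq_range_aeval] at hx'
  obtain ⟨f, rfl⟩ := hx'
  refine ⟨(f %ₘ Q).coeff, ?_⟩
  change Polynomial.aeval π f = _
  rw [← Polynomial.modByMonic_add_div f Q, map_add, map_mul, hroot, zero_mul, add_zero]
  have hlt' : (f %ₘ Q).degree < e := by
    rw [← hdeg]; exact Polynomial.degree_modByMonic_lt f hmonic
  rw [Polynomial.modByMonic_add_div]
  by_cases h0 : f %ₘ Q = 0
  · simp [h0]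
  · rw [Polynomial.aeval_eq_sum_range' ((Polynomial.natDegree_lt_iff_degree_lt h0).2 hlt')]
    simp only [Algebra.smul_def]

/-- The terms of a polynomial in a uniformizer `π` of degree less than the ramification index, with
unramified coefficients, have distinct absolute values. -/
theorem norm_sum_mul_pow {F : Type*} [NormedField F] [IsUltrametricDist F] {π : F} {e : ℕ}
    (he : e ≠ 0) (hnorm : ‖π‖ ^ e = (p : ℝ)⁻¹) {c : ℕ → F}
    (hc : ∀ i < e, c i ≠ 0 → ∃ n : ℤ, ‖c i‖ = (p : ℝ) ^ n)
    (h0 : ∑ i ∈ Finset.range e, c i * π ^ i ≠ 0) :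
    ∃ i < e, (∃ n : ℤ, ‖∑ i ∈ Finset.range e, c i * π ^ i‖ = ‖π‖ ^ (i + e * n : ℤ)) ∧
      ‖∑ i ∈ Finset.range e, c i * π ^ i‖ = ‖c i * π ^ i‖ ∧
      ∀ j < e, ‖c j * π ^ j‖ ≤ ‖∑ i ∈ Finset.range e, c i * π ^ i‖ := by
  have hpos : 0 < ‖π‖ := (norm_nonneg π).lt_of_ne' fun h0 => by
    rw [h0, zero_pow he] at hnorm
    exact (inv_pos.2 (p_pos (p := p))).ne hnorm
  have hlt : ‖π‖ < 1 := by
    by_contra! hcon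
    have := one_le_pow₀ hcon (n := e)
    rw [hnorm] at this
    exact absurd this (not_le.2 inv_p_lt_one)
  have hterm : ∀ i < e, c i ≠ 0 → ∃ n : ℤ, ‖c i * π ^ i‖ = ‖π‖ ^ (i + e * n : ℤ) := fun i hie hi => by
    obtain ⟨n, hn⟩ := hc i hie hi
    refine ⟨-n, ?_⟩
    rw [norm_mul, norm_pow, hn, zpow_add₀ hpos.ne', zpow_natCast,
      zpow_mul, zpow_natCast, hnorm, inv_zpow', neg_neg, mul_comm]
  classical
  set s := (Finset.range e).filter fun i => c i ≠ 0 with hs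
  have hsum : ∑ i ∈ Finset.range e, c i * π ^ i = ∑ i ∈ s, c i * π ^ i := by
    rw [hs, Finset.sum_filter_of_ne]
    intro i _ h h0
    rw [h0, zero_mul] at h
    exact h rfl
  have hne : s.Nonempty := by
    rw [Finset.nonempty_iff_ne_empty]
    rintro h
    rw [h, Finset.sum_empty] at hsum
    exact h0 hsum
  -- The valuation of the i-th term is congruent to i modulo e, so no two nonzero terms have the
  -- same norm.
  have hpair : Set.Pairwise (s : Set ℕ) fun i j => ‖c i * π ^ i‖ ≠ ‖c j * π ^ j‖ := by
    intro i hi j hj hij h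
    obtain ⟨hi1, hi2⟩ := Finset.mem_filter.1 hi
    obtain ⟨hj1, hj2⟩ := Finset.mem_filter.1 hj
    rw [Finset.mem_range] at hi1 hj1
    obtain ⟨n, hn⟩ := hterm i hi1 hi2
    obtain ⟨m, hm⟩ := hterm j hj1 hj2
    rw [hn, hm] at h
    have h' := zpow_right_injective₀ hpos hlt.ne h
    refine hij ?_
    have h3 : ((i : ℤ) + e * n) % e = ((j : ℤ) + e * m) % e := by rw [h']
    rw [Int.add_mul_emod_self_left, Int.add_mul_emod_self_left,
      Int.emod_eq_of_lt (by positivity) (by exact_mod_cast hi1),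
      Int.emod_eq_of_lt (by positivity) (by exact_mod_cast hj1)] at h3
    exact_mod_cast h3
  have hsup := IsUltrametricDist.norm_sum_eq_sup'_of_pairwise_ne hne hpair
  obtain ⟨i, hi, hmax⟩ := s.exists_mem_eq_sup' hne fun i => ‖c i * π ^ i‖
  have hie := Finset.mem_range.1 (Finset.mem_filter.1 hi).1
  obtain ⟨n, hn⟩ := hterm i hie (Finset.mem_filter.1 hi).2
  rw [hsum]
  refine ⟨i, hie, ⟨n, ?_⟩, ?_, fun j hj => ?_⟩
  · rw [← hn, ← hmax, hsup]
  · rw [← hmax, hsup]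
  · by_cases hcj : c j = 0
    · rw [hcj, zero_mul, norm_zero]; exact norm_nonneg _
    · rw [hsup]
      exact Finset.le_sup' (fun i => ‖c i * π ^ i‖)
        (Finset.mem_filter.2 ⟨Finset.mem_range.2 hj, hcj⟩)

theorem norm_of_mem_Kpi (hπ : π ∈ PiSet p) {x : ℂ_[p]} (hx : x ∈ Kpi p π) (hx0 : x ≠ 0) :
    ∃ n : ℤ, ‖x‖ = ‖π‖ ^ n := by
  obtain ⟨e, a, he, hnorm, ha, hexp⟩ := exists_eisenstein hπ
  obtain ⟨c, rfl⟩ := exists_sum_of_mem_adjoin (K := K p) (L := ℂ_[p]) (π := (π : ℂ_[p])) (e := e)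
    (a := fun i => ⟨a i, coe_mem_K (ha i)⟩) (by
      have := congrArg (algebraMap (PadicAlgCl p) ℂ_[p]) hexp
      simp only [map_pow, map_sum, map_mul] at this
      exact this) hx
  obtain ⟨i, -, ⟨n, hn⟩, -⟩ := norm_sum_mul_pow he
    (by rw [PadicComplex.norm_extends]; exact hnorm)
    (fun i _ h => ArithDiff.norm_of_mem_K (c i).2 h) hx0
  rw [PadicComplex.norm_extends] at hn
  exact ⟨_, hn⟩

theorem norm_le_norm_pi (hπ : π ∈ PiSet p) {x : ℂ_[p]} (hx : x ∈ Kpi p π) (hx1 : ‖x‖ < 1) :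
    ‖x‖ ≤ ‖π‖ := by
  by_cases hx0 : x = 0
  · rw [hx0, norm_zero]; exact norm_nonneg _
  obtain ⟨n, hn⟩ := norm_of_mem_Kpi hπ hx hx0
  have hpos := norm_pi_pos hπ
  have hlt := norm_pi_lt_one hπ
  rw [hn, ← zpow_zero ‖π‖, zpow_lt_zpow_iff_right_of_lt_one₀ hpos hlt] at hx1
  rw [hn]
  conv_rhs => rw [← zpow_one ‖π‖]
  exact (zpow_le_zpow_iff_right_of_lt_one₀ hpos hlt).2 (by omega)

theorem isClosed_Kpi : IsClosed (Kpi p π : Set ℂ_[p]) := by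
  have h1 : IsIntegral (K p) (π : ℂ_[p]) :=
    ((Algebra.IsIntegral.isIntegral (R := ℚ_[p]) π).algebraMap (B := ℂ_[p])).tower_top
  have : FiniteDimensional (K p) (Subalgebra.toSubmodule (Kpi p π).toSubalgebra) :=
    IntermediateField.adjoin.finiteDimensional h1
  exact Submodule.closed_of_finiteDimensional (Subalgebra.toSubmodule (Kpi p π).toSubalgebra)

/-! ### The action of Frobenius -/

variable {φ : Kalg p ≃+* Kalg p}

theorem IsFrobenius.mem_R (hφ : IsFrobenius φ) {x : Kalg p} (hx : (x : ℂ_[p]) ∈ R p) :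
    (φ x : ℂ_[p]) ∈ R p := by
  have : φ x ∈ φ '' {x : Kalg p | (x : ℂ_[p]) ∈ R p} := ⟨x, hx, rfl⟩
  rwa [hφ.image_R] at this

/-- A power of p, which φ fixes, scales x to a unit of R. As φ maps R into itself, it maps units of
R to units. -/
theorem IsFrobenius.norm_of_mem_K (hφ : IsFrobenius φ) {x : Kalg p} (hx : (x : ℂ_[p]) ∈ K p) :
    (φ x : ℂ_[p]) ∈ K p ∧ ‖φ x‖ = ‖x‖ := by
  by_cases hx0 : x = 0
  · rw [hx0, map_zero]; exact ⟨zero_mem _, rfl⟩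
  have hx0' : (x : ℂ_[p]) ≠ 0 := fun h => hx0 (Subtype.ext h)
  obtain ⟨n, hn⟩ := ArithDiff.norm_of_mem_K hx hx0'
  have hpn : ‖(p : Kalg p) ^ n‖ = (p : ℝ) ^ (-n) := by
    rw [norm_zpow]
    change ‖((p : Kalg p) : ℂ_[p])‖ ^ n = _
    rw [zpow_neg, ← inv_zpow, ← norm_p]
    simp
  have hp0 : (p : Kalg p) ^ n ≠ 0 := by
    rw [← norm_pos_iff, hpn]; exact zpow_pos p_pos _
  have hpK : (((p : Kalg p) ^ n : Kalg p) : ℂ_[p]) ∈ K p := by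
    have : (((p : Kalg p) ^ n : Kalg p) : ℂ_[p]) = (p : ℂ_[p]) ^ n :=
      (map_zpow₀ (Kalg p).val (p : Kalg p) n).trans (by rw [map_natCast])
    rw [this]; exact zpow_mem (natCast_mem _ _) _
  have hy1 : ‖x * (p : Kalg p) ^ n‖ = 1 := by
    rw [norm_mul, hpn]
    have : ‖x‖ = (p : ℝ) ^ n := hn
    rw [this, ← zpow_add₀ p_pos.ne', add_neg_cancel, zpow_zero]
  have hyK : ((x * (p : Kalg p) ^ n : Kalg p) : ℂ_[p]) ∈ K p := mul_mem hx hpK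
  have hφy := hφ.mem_R (x := x * (p : Kalg p) ^ n) ⟨hyK, hy1.le⟩
  have hφy' := hφ.mem_R (x := (x * (p : Kalg p) ^ n)⁻¹) ⟨inv_mem hyK, by
    change ‖(x * (p : Kalg p) ^ n)⁻¹‖ ≤ 1
    rw [norm_inv, hy1, inv_one]⟩
  have hφn : φ (x * (p : Kalg p) ^ n) = φ x * (p : Kalg p) ^ n := by
    rw [map_mul, map_zpow₀, map_natCast]
  have h1 : ‖φ (x * (p : Kalg p) ^ n)‖ = 1 := by
    refine le_antisymm hφy.2 ?_
    have := hφy'.2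
    change ‖φ (x * (p : Kalg p) ^ n)⁻¹‖ ≤ 1 at this
    rw [map_inv₀, norm_inv] at this
    have hpos : 0 < ‖φ (x * (p : Kalg p) ^ n)‖ := by
      rw [norm_pos_iff, map_ne_zero_iff _ φ.injective]; exact mul_ne_zero hx0 hp0
    exact (inv_le_one₀ hpos).1 this
  rw [hφn] at h1 hφy
  refine ⟨?_, ?_⟩
  · have := div_mem hφy.1 hpK
    change ((φ x * (p : Kalg p) ^ n / (p : Kalg p) ^ n : Kalg p) : ℂ_[p]) ∈ K p at this
    rwa [mul_div_cancel_right₀ _ hp0] at this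
  · rw [norm_mul, ← hy1, norm_mul] at h1
    exact mul_right_cancel₀ (norm_ne_zero_iff.2 hp0) h1

/-- No continuity of φ is assumed: x ↦ ‖φ x‖ is an absolute value extending that of the complete
field K, and such an extension to an algebraic extension is unique. -/
theorem IsFrobenius.norm_map (hφ : IsFrobenius φ) (x : Kalg p) : ‖φ x‖ = ‖x‖ := by
  let f : AbsoluteValue (Kalg p) ℝ :=
    { toFun := fun x => ‖φ x‖
      map_mul' := fun x y => by rw [map_mul, norm_mul]
      nonneg' := fun x => norm_nonneg _
      eq_zero' := fun x => by rw [norm_eq_zero, map_eq_zero_iff _ φ.injective]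
      add_le' := fun x y => by rw [map_add]; exact norm_add_le _ _ }
  have h1 : f x = spectralNorm (K p) (Kalg p) x :=
    spectralNorm_unique_field_norm_ext (fun c => (hφ.norm_of_mem_K c.2).2) x
  rw [NormedAlgebra.norm_eq_spectralNorm (K p) x, ← h1]
  rfl

theorem IsFrobenius.map_padic (hφ : IsFrobenius φ) (x : ℚ_[p]) :
    φ (algebraMap (K p) (Kalg p) (algebraMap ℚ_[p] (K p) x)) =
      algebraMap (K p) (Kalg p) (algebraMap ℚ_[p] (K p) x) := by
  let j : ℚ_[p] →+* Kalg p := (algebraMap (K p) (Kalg p)).comp (algebraMap ℚ_[p] (K p))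
  have hj : ∀ x, ‖j x‖ = ‖x‖ := fun x => by
    change ‖algebraMap ℚ_[p] ℂ_[p] x‖ = _
    rw [norm_algebraMap']
  have hjc : Continuous j := AddMonoidHomClass.continuous_of_bound j 1 fun x => by
    rw [hj, one_mul]
  have hφc : Continuous φ := AddMonoidHomClass.continuous_of_bound φ 1 fun x => by
    rw [hφ.norm_map, one_mul]
  have h : (fun x => φ (j x)) = j := by
    refine Padic.denseRange_ratCast p |>.equalizer (hφc.comp hjc) hjc ?_
    funext q
    simp
  exact congrFun h x

theorem coe_mem_Kpi {β : PadicAlgCl p} (h : β ∈ IntermediateField.adjoin ℚ_[p] {π}) :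
    (β : ℂ_[p]) ∈ Kpi p π := by
  induction h using IntermediateField.adjoin_induction with
  | mem x hx =>
    rw [Set.mem_singleton_iff] at hx
    rw [hx]
    exact IntermediateField.mem_adjoin_simple_self _ _
  | algebraMap x => exact (Kpi p π).algebraMap_mem (algebraMap ℚ_[p] (K p) x)
  | add x y _ _ hx hy => rw [UniformSpace.Completion.coe_add]; exact add_mem hx hy
  | inv x _ hx =>
    have : ((x⁻¹ : PadicAlgCl p) : ℂ_[p]) = (x : ℂ_[p])⁻¹ := map_inv₀ (algebraMap _ ℂ_[p]) x
    rw [this]; exact inv_mem hx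
  | mul x y _ _ hx hy => rw [UniformSpace.Completion.coe_mul]; exact mul_mem hx hy

/-- `π` as an element of `K^alg`. -/
noncomputable def piKalg (π : PadicAlgCl p) : Kalg p :=
  ⟨(π : ℂ_[p]), Kpi_le p π (IntermediateField.mem_adjoin_simple_self _ _)⟩

/-- φ fixes ℚ_p, so φ(π) is a conjugate of π over ℚ_p. Here the Galois condition in the definition
of Π enters. -/
theorem IsFrobenius.map_pi_mem (hφ : IsFrobenius φ) (hπ : π ∈ PiSet p) :
    (φ (piKalg π) : ℂ_[p]) ∈ Kpi p π := by
  have hgal := hπ.2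
  set E := IntermediateField.adjoin ℚ_[p] {π} with hE
  let j : ℚ_[p] →+* Kalg p := (algebraMap (K p) (Kalg p)).comp (algebraMap ℚ_[p] (K p))
  let g : E := IntermediateField.AdjoinSimple.gen ℚ_[p] π
  let ι : E →+* ℂ_[p] := (algebraMap (PadicAlgCl p) ℂ_[p]).comp E.val.toRingHom
  have hintegral : IsIntegral ℚ_[p] g := Algebra.IsIntegral.isIntegral g
  set m := minpoly ℚ_[p] g with hm
  have h1 : m.eval₂ (j : ℚ_[p] →+* Kalg p) (piKalg π) = 0 := by
    have h2 : m.eval₂ (algebraMap ℚ_[p] E) g = 0 := minpoly.aeval ℚ_[p] g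
    have h3 := congrArg ι h2
    rw [map_zero, Polynomial.hom_eval₂] at h3
    apply Subtype.ext
    change (Kalg p).val.toRingHom (m.eval₂ j (piKalg π)) = 0
    rw [Polynomial.hom_eval₂]
    exact h3
  have h2 : m.eval₂ j (φ (piKalg π)) = 0 := by
    have h3 := congrArg φ.toRingHom h1
    rw [map_zero, Polynomial.hom_eval₂] at h3
    have h4 : φ.toRingHom.comp j = j := RingHom.ext fun x => hφ.map_padic x
    rwa [h4] at h3
  have h3 : ((m.map (algebraMap ℚ_[p] E)).map ι).eval ((φ (piKalg π) : Kalg p) : ℂ_[p]) = 0 := by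
    rw [Polynomial.map_map, Polynomial.eval_map]
    have h4 := congrArg (Kalg p).val.toRingHom h2
    rw [map_zero, Polynomial.hom_eval₂] at h4
    exact h4
  have hs : (m.map (algebraMap ℚ_[p] E)).Splits := Normal.splits inferInstance g
  have hne : (m.map (algebraMap ℚ_[p] E)).map ι ≠ 0 :=
    Polynomial.map_ne_zero (Polynomial.map_ne_zero (minpoly.ne_zero hintegral))
  have hroot := (Polynomial.mem_roots hne).2 h3
  rw [Polynomial.Splits.roots_map hs, Multiset.mem_map] at hroot
  obtain ⟨β, -, hβ⟩ := hroot
  rw [← hβ]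
  exact coe_mem_Kpi β.2

theorem IsFrobenius.mem_Kpi (hφ : IsFrobenius φ) (hπ : π ∈ PiSet p) {x : ℂ_[p]}
    (hx : x ∈ Kpi p π) : (φ ⟨x, Kpi_le p π hx⟩ : ℂ_[p]) ∈ Kpi p π := by
  induction hx using IntermediateField.adjoin_induction with
  | mem x hx =>
    rw [Set.mem_singleton_iff] at hx
    subst hx
    exact hφ.map_pi_mem hπ
  | algebraMap x => exact (Kpi p π).algebraMap_mem ⟨_, (hφ.norm_of_mem_K x.2).1⟩
  | add x y h1 h2 hx hy =>
    have := add_mem hx hy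
    have e : φ ⟨x + y, Kpi_le p π (add_mem h1 h2)⟩ =
      φ ⟨x, Kpi_le p π h1⟩ + φ ⟨y, Kpi_le p π h2⟩ := (map_add φ _ _).symm ▸ rfl
    rw [e]; exact this
  | inv x h1 hx =>
    have := inv_mem hx
    have e : φ ⟨x⁻¹, Kpi_le p π (inv_mem h1)⟩ = (φ ⟨x, Kpi_le p π h1⟩)⁻¹ :=
      (map_inv₀ φ _).symm ▸ rfl
    rw [e]; exact this
  | mul x y h1 h2 hx hy =>
    have := mul_mem hx hy
    have e : φ ⟨x * y, Kpi_le p π (mul_mem h1 h2)⟩ =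
      φ ⟨x, Kpi_le p π h1⟩ * φ ⟨y, Kpi_le p π h2⟩ := (map_mul φ _ _).symm ▸ rfl
    rw [e]; exact this

noncomputable instance : Algebra (R p) (Rpi p π) := (RtoRpi p π).toAlgebra

/-- The automorphism `φ` on `R`. -/
noncomputable def frobR (hφ : IsFrobenius φ) : R p →+* R p where
  toFun r := ⟨φ (algebraMap (K p) (Kalg p) ⟨r, r.2.1⟩), hφ.mem_R r.2⟩
  map_one' := Subtype.ext (congrArg (Kalg p).val (map_one φ))
  map_zero' := Subtype.ext (congrArg (Kalg p).val (map_zero φ))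
  map_mul' x y := Subtype.ext (congrArg (Kalg p).val (map_mul φ
    (algebraMap (K p) (Kalg p) ⟨x, x.2.1⟩) (algebraMap (K p) (Kalg p) ⟨y, y.2.1⟩)))
  map_add' x y := Subtype.ext (congrArg (Kalg p).val (map_add φ
    (algebraMap (K p) (Kalg p) ⟨x, x.2.1⟩) (algebraMap (K p) (Kalg p) ⟨y, y.2.1⟩)))

/-- The automorphism `φ` on `R_π`. -/
noncomputable def frobRpi (hφ : IsFrobenius φ) (hπ : π ∈ PiSet p) : Rpi p π →+* Rpi p π where
  toFun x := ⟨φ (RpiToKalg p π x), hφ.mem_Kpi hπ x.2.1, (hφ.norm_map _).trans_le x.2.2⟩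
  map_one' := Subtype.ext (congrArg (Kalg p).val (map_one φ))
  map_zero' := Subtype.ext (congrArg (Kalg p).val (map_zero φ))
  map_mul' x y := Subtype.ext (congrArg (Kalg p).val (map_mul φ
    (RpiToKalg p π x) (RpiToKalg p π y)))
  map_add' x y := Subtype.ext (congrArg (Kalg p).val (map_add φ
    (RpiToKalg p π x) (RpiToKalg p π y)))

/-- `π` as an element of `R_π`. -/
noncomputable def piRpi (hπ : π ∈ PiSet p) : Rpi p π :=
  ⟨(π : ℂ_[p]), IntermediateField.mem_adjoin_simple_self _ _, by
    rw [PadicComplex.norm_extends]; exact (norm_pi_lt_one hπ).le⟩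

theorem norm_piRpi (hπ : π ∈ PiSet p) : ‖(piRpi hπ : ℂ_[p])‖ = ‖π‖ := PadicComplex.norm_extends p π

theorem piRpi_ne_zero (hπ : π ∈ PiSet p) : piRpi hπ ≠ 0 := fun h => by
  have := norm_piRpi hπ
  rw [h, Subring.coe_zero, norm_zero] at this
  exact (norm_pi_pos hπ).ne this

theorem piRpi_dvd_iff (hπ : π ∈ PiSet p) {x : Rpi p π} : piRpi hπ ∣ x ↔ ‖(x : ℂ_[p])‖ < 1 := by
  rw [valRing_dvd_iff (piRpi_ne_zero hπ), norm_piRpi]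
  exact ⟨fun h => h.trans_lt (norm_pi_lt_one hπ), fun h => norm_le_norm_pi hπ x.2.1 h⟩

theorem exists_R_dvd_sub (hπ : π ∈ PiSet p) (x : Rpi p π) :
    ∃ r : R p, piRpi hπ ∣ x - algebraMap (R p) (Rpi p π) r := by
  obtain ⟨c, hc, hlt⟩ := exists_mem_R_norm_sub_lt x.2.2
  exact ⟨⟨c, hc⟩, (piRpi_dvd_iff hπ).2 hlt⟩

theorem frobRpi_algebraMap (hφ : IsFrobenius φ) (hπ : π ∈ PiSet p) (r : R p) :
    frobRpi hφ hπ (algebraMap (R p) (Rpi p π) r) = algebraMap (R p) (Rpi p π) (frobR hφ r) := rfl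

theorem norm_frobRpi (hφ : IsFrobenius φ) (hπ : π ∈ PiSet p) (x : Rpi p π) :
    ‖(frobRpi hφ hπ x : ℂ_[p])‖ = ‖(x : ℂ_[p])‖ := hφ.norm_map (RpiToKalg p π x)

theorem p_dvd_frobR_sub (hφ : IsFrobenius φ) (r : R p) : (p : R p) ∣ frobR hφ r - r ^ p := by
  obtain ⟨y, hy, e⟩ := hφ.frob (algebraMap (K p) (Kalg p) ⟨r, r.2.1⟩) r.2
  refine ⟨⟨y, hy⟩, Subtype.ext ?_⟩
  have := congrArg (Kalg p).val e
  rw [map_mul, map_natCast] at this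
  rw [Subring.coe_mul, coe_valRing_natCast]
  exact this

theorem piRpi_dvd_p (hπ : π ∈ PiSet p) : piRpi hπ ∣ (p : Rpi p π) := by
  rw [piRpi_dvd_iff, coe_valRing_natCast, norm_p]; exact inv_p_lt_one

/-- Modulo π every x is congruent to an element of R, where φ lifts Frobenius by hypothesis, and φ
preserves divisibility by π since it is isometric. So δ_π maps R_π to itself. -/
theorem piRpi_dvd_frob_sub (hφ : IsFrobenius φ) (hπ : π ∈ PiSet p) (x : Rpi p π) :
    piRpi hπ ∣ frobRpi hφ hπ x - x ^ p := by
  obtain ⟨r, hr⟩ := exists_R_dvd_sub hπ x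
  set c := algebraMap (R p) (Rpi p π) r
  have h1 : piRpi hπ ∣ frobRpi hφ hπ (x - c) := by
    rw [piRpi_dvd_iff, norm_frobRpi]; exact (piRpi_dvd_iff hπ).1 hr
  have h2 : piRpi hπ ∣ frobRpi hφ hπ c - c ^ p := by
    refine (piRpi_dvd_p hπ).trans ?_
    have := map_dvd (algebraMap (R p) (Rpi p π)) (p_dvd_frobR_sub hφ r)
    rwa [map_natCast, map_sub, map_pow] at this
  have h3 : piRpi hπ ∣ x ^ p - c ^ p := hr.trans (sub_dvd_pow_sub_pow x c p)
  have : frobRpi hφ hπ x - x ^ p = frobRpi hφ hπ (x - c) + (frobRpi hφ hπ c - c ^ p)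
      - (x ^ p - c ^ p) := by rw [map_sub]; ring
  rw [this]
  exact dvd_sub (dvd_add h1 h2) h3

/-- `δ_π` as a map from `R_π` to itself. -/
noncomputable def deltaPi (hφ : IsFrobenius φ) (hπ : π ∈ PiSet p) (x : Rpi p π) : Rpi p π :=
  (piRpi_dvd_frob_sub hφ hπ x).choose

theorem mul_deltaPi (hφ : IsFrobenius φ) (hπ : π ∈ PiSet p) (x : Rpi p π) :
    piRpi hπ * deltaPi hφ hπ x = frobRpi hφ hπ x - x ^ p :=
  (piRpi_dvd_frob_sub hφ hπ x).choose_spec.symm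

theorem piKalg_ne_zero (hπ : π ∈ PiSet p) : piKalg π ≠ 0 := fun h =>
  piRpi_ne_zero hπ (Subtype.ext (congrArg (Kalg p).val h))

theorem RpiToKalg_deltaPi (hφ : IsFrobenius φ) (hπ : π ∈ PiSet p) (x : Rpi p π) :
    RpiToKalg p π (deltaPi hφ hπ x) = fermatQuotient φ π (RpiToKalg p π x) := by
  have h := congrArg (RpiToKalg p π) (mul_deltaPi hφ hπ x)
  change _ = _ / piKalg π
  rw [eq_div_iff (piKalg_ne_zero hπ), mul_comm]
  exact h

theorem RpiToKalg_deltaPi_iterate (hφ : IsFrobenius φ) (hπ : π ∈ PiSet p) (j : ℕ) (x : Rpi p π) :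
    RpiToKalg p π ((deltaPi hφ hπ)^[j] x) = (fermatQuotient φ π)^[j] (RpiToKalg p π x) :=
  (Function.Semiconj.iterate_right (RpiToKalg_deltaPi hφ hπ) j) x

/-- `R_π` with its Frobenius structure. -/
noncomputable def frobeniusRing (hφ : IsFrobenius φ) (hπ : π ∈ PiSet p) :
    FrobeniusRing p (R p) (Rpi p π) where
  ϖ := piRpi hπ
  φR := frobR hφ
  φ := frobRpi hφ hπ
  φ_algebraMap r := frobRpi_algebraMap hφ hπ r
  δ := deltaPi hφ hπ
  mul_δ := mul_deltaPi hφ hπ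
  ne_zero := piRpi_ne_zero hπ
  not_isUnit h := by
    rw [valRing_isUnit_iff, norm_piRpi] at h
    exact (norm_pi_lt_one hπ).ne h
  dvd_p := piRpi_dvd_p hπ
  p_dvd := by
    obtain ⟨e, -, -, h, -⟩ := exists_eisenstein hπ
    refine ⟨e, ?_⟩
    rw [valRing_dvd_iff valRing_p_ne_zero, coe_valRing_natCast, norm_p, Subring.coe_pow, norm_pow,
      norm_piRpi, h]
  dvd_φ := by
    rw [piRpi_dvd_iff, norm_frobRpi, norm_piRpi]; exact norm_pi_lt_one hπ
  exists_digit := exists_R_dvd_sub hπ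
  p_dvd_of_dvd r h := R_p_dvd_of_norm_lt_one ((piRpi_dvd_iff hπ).1 h)
  complete := isAdicComplete_valRing isClosed_Kpi (piRpi_ne_zero hπ) (by
    rw [norm_piRpi]; exact norm_pi_lt_one hπ)

end ArithDiff

namespace ArithDiff

/-! ### Independence of the iterates of `δ_π` -/

variable {p : ℕ} [Fact p.Prime] {π : PadicAlgCl p} {φ : Kalg p ≃+* Kalg p}

/-- The leading coefficients of the iterates of `δ_π`. -/
noncomputable def leadCoeff (φ : Kalg p ≃+* Kalg p) (π : PadicAlgCl p) : ℕ → Kalg p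
  | 0 => 1
  | j + 1 => φ (leadCoeff φ π j) / piKalg π

theorem leadCoeff_ne_zero (hπ : π ∈ PiSet p) (j : ℕ) : leadCoeff φ π j ≠ 0 := by
  induction j with
  | zero => exact one_ne_zero
  | succ j ih => exact div_ne_zero ((map_ne_zero_iff _ φ.injective).2 ih) (piKalg_ne_zero hπ)

theorem IsFrobenius.continuous (hφ : IsFrobenius φ) : Continuous φ :=
  AddMonoidHomClass.continuous_of_bound φ 1 fun x => by rw [hφ.norm_map, one_mul]

theorem norm_p_Kalg : ‖(p : Kalg p)‖ = (p : ℝ)⁻¹ := by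
  rw [← norm_p (p := p)]
  exact congrArg norm (map_natCast (Kalg p).val p)

theorem p_Kalg_ne_zero : (p : Kalg p) ≠ 0 := by
  rw [← norm_pos_iff, norm_p_Kalg]; exact inv_pos.2 p_pos

theorem tendsto_p_pow_Kalg {c : ℕ} (hc : c ≠ 0) :
    Tendsto (fun m : ℕ => (p : Kalg p) ^ (m * c)) atTop (𝓝 0) := by
  simp_rw [mul_comm _ c, pow_mul]
  refine tendsto_pow_atTop_nhds_zero_of_norm_lt_one ?_
  rw [norm_pow, norm_p_Kalg]
  exact pow_lt_one₀ (inv_pos.2 p_pos).le inv_p_lt_one hc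

/-- Near zero the `j`-th iterate of `δ_π` is approximately a multiple of `φ ^ j`. -/
theorem IsFrobenius.tendsto_fermatQuotient (hφ : IsFrobenius φ) (b : Kalg p)
    (j : ℕ) :
    Tendsto (fun m : ℕ => ((p : Kalg p) ^ m)⁻¹ * (fermatQuotient φ π)^[j] ((p : Kalg p) ^ m * b))
      atTop (𝓝 (leadCoeff φ π j * φ^[j] b)) := by
  have hp0 := p_Kalg_ne_zero (p := p)
  induction j with
  | zero =>
    refine tendsto_const_nhds.congr fun m => ?_
    simp only [Function.iterate_zero, id_eq, leadCoeff, one_mul]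
    rw [inv_mul_cancel_left₀ (pow_ne_zero m hp0)]
  | succ j ih =>
    set y : ℕ → Kalg p := fun m =>
      ((p : Kalg p) ^ m)⁻¹ * (fermatQuotient φ π)^[j] ((p : Kalg p) ^ m * b) with hy
    have hpp : p - 1 ≠ 0 := by have := (Fact.out : p.Prime).two_le; omega
    -- With x = p^m y, δ(x)/p^m = (φ(y) - p^(m(p-1)) y^p)/π. The nonlinear term dies in the limit,
    -- which leaves the recursion for `leadCoeff`.
    have h1 : Tendsto (fun m => (φ (y m) - (p : Kalg p) ^ (m * (p - 1)) * y m ^ p) / piKalg π) atTop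
        (𝓝 ((φ (leadCoeff φ π j * φ^[j] b) - 0 * (leadCoeff φ π j * φ^[j] b) ^ p) / piKalg π)) :=
      (((hφ.continuous.tendsto _).comp ih).sub
        ((tendsto_p_pow_Kalg hpp).mul (ih.pow p))).div_const _
    have h2 : (φ (leadCoeff φ π j * φ^[j] b) - 0 * (leadCoeff φ π j * φ^[j] b) ^ p) / piKalg π =
        leadCoeff φ π (j + 1) * φ^[j + 1] b := by
      rw [zero_mul, sub_zero, map_mul, leadCoeff, Function.iterate_succ_apply']
      ring
    rw [h2] at h1
    refine h1.congr fun m => ?_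
    rw [Function.iterate_succ_apply']
    set x := (fermatQuotient φ π)^[j] ((p : Kalg p) ^ m * b) with hx
    have hyx : x = (p : Kalg p) ^ m * y m := by
      rw [hy]; exact (mul_inv_cancel_left₀ (pow_ne_zero m hp0) _).symm
    have h3 : fermatQuotient φ π x = (φ x - x ^ p) / piKalg π := rfl
    have hpow : ((p : Kalg p) ^ m) ^ p = (p : Kalg p) ^ m * (p : Kalg p) ^ (m * (p - 1)) := by
      rw [← pow_mul, ← pow_add]
      congr 1
      have := (Fact.out : p.Prime).pos
      nth_rewrite 1 [← Nat.sub_add_cancel this]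
      ring
    have h4 : φ ((p : Kalg p) ^ m * y m) = (p : Kalg p) ^ m * φ (y m) := by
      rw [map_mul, map_pow, map_natCast]
    have h5 : ∀ {F : Type} [Field F] {P : F} (Q u v w : F), P ≠ 0 →
        (u - Q * v) / w = P⁻¹ * ((P * u - P * Q * v) / w) := fun Q u v w hP => by
      rw [mul_assoc, ← mul_sub, ← mul_div_assoc, inv_mul_cancel_left₀ hP]
    have h6 : ((p : Kalg p) ^ m * y m) ^ p =
        (p : Kalg p) ^ m * (p : Kalg p) ^ (m * (p - 1)) * y m ^ p :=
      (mul_pow _ _ _).trans (congrArg (· * y m ^ p) hpow)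
    rw [h3, hyx, h4, h6]
    exact h5 _ _ _ _ (pow_ne_zero m hp0)

/-- The inclusion of `R_π` in `K^alg` as a ring homomorphism. -/
noncomputable def RpiToKalgHom (p : ℕ) [Fact p.Prime] (π : PadicAlgCl p) : Rpi p π →+* Kalg p where
  toFun := RpiToKalg p π
  map_one' := rfl
  map_zero' := rfl
  map_mul' _ _ := rfl
  map_add' _ _ := rfl

theorem RpiToKalgHom_injective : Function.Injective (RpiToKalgHom p π) := fun _ _ h =>
  Subtype.ext (congrArg (Kalg p).val h)

/-- The restriction of `φ ^ j` to `R_π`. -/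
noncomputable def frobPow (φ : Kalg p ≃+* Kalg p) (π : PadicAlgCl p) (j : ℕ) : Rpi p π →+* Kalg p :=
  ((φ : Kalg p →+* Kalg p) ^ j).comp (RpiToKalgHom p π)

theorem frobPow_apply (j : ℕ) (x : Rpi p π) : frobPow φ π j x = φ^[j] (RpiToKalg p π x) := by
  change ((φ : Kalg p →+* Kalg p) ^ j) (RpiToKalg p π x) = _
  rw [RingHom.coe_pow]
  rfl

theorem p_dvd_frobR_iterate_sub (hφ : IsFrobenius φ) (s : ℕ) (r : R p) :
    (p : R p) ∣ (frobR hφ)^[s] r - r ^ p ^ s := by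
  induction s with
  | zero => simp
  | succ s ih =>
    rw [Function.iterate_succ_apply', pow_succ, pow_mul]
    have h1 := p_dvd_frobR_sub hφ ((frobR hφ)^[s] r)
    have h2 := ih.trans (sub_dvd_pow_sub_pow ((frobR hφ)^[s] r) (r ^ p ^ s) p)
    simpa using dvd_add h1 h2

theorem frobPow_algebraMap (hφ : IsFrobenius φ) (s : ℕ) (r : R p) :
    frobPow φ π s (algebraMap (R p) (Rpi p π) r) =
      RpiToKalg p π (algebraMap (R p) (Rpi p π) ((frobR hφ)^[s] r)) := by
  rw [frobPow_apply]
  induction s with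
  | zero => rfl
  | succ s ih => rw [Function.iterate_succ_apply', ih, Function.iterate_succ_apply']; rfl

/-- If two powers agreed, some φ^s with s > 0 would be the identity on R, and y^(p^s) = y for all y
in k. But X^(p^s) - X - 1 has a root in the algebraically closed field k. -/
theorem frobPow_injective (hφ : IsFrobenius φ) : Function.Injective (frobPow φ π) := by
  have key : ∀ i s, frobPow φ π i = frobPow φ π (i + s) → s = 0 := by
    intro i s h
    by_contra hs
    have h1 : ∀ r : R p, (frobR hφ)^[s] r = r := fun r => by
      have h2 := RingHom.congr_fun h (algebraMap (R p) (Rpi p π) r)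
      rw [frobPow_apply, frobPow_apply, Function.iterate_add_apply] at h2
      have h3 := φ.injective.iterate i h2
      rw [← frobPow_apply, frobPow_algebraMap hφ] at h3
      have h4 : ((r : R p) : ℂ_[p]) = (frobR hφ)^[s] r := congrArg (Kalg p).val h3
      exact Subtype.ext h4.symm
    have h2 : ∀ y : k p, y ^ p ^ s = y := fun y => by
      obtain ⟨r, rfl⟩ := RtoResidue_surjective y
      have := p_dvd_frobR_iterate_sub hφ s r
      rw [h1, ← RtoResidue_eq_zero_iff, map_sub, map_pow, sub_eq_zero] at this
      exact this.symm
    have hq : 1 < p ^ s := Nat.one_lt_pow hs (Fact.out : p.Prime).one_lt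
    have hdeg : (Polynomial.X ^ p ^ s - (Polynomial.X + Polynomial.C 1) : Polynomial (k p)).degree ≠ 0 := by
      rw [Polynomial.degree_sub_eq_left_of_degree_lt, Polynomial.degree_X_pow]
      · exact_mod_cast (zero_lt_one.trans hq).ne'
      · rw [Polynomial.degree_X_pow, Polynomial.degree_X_add_C]
        exact_mod_cast hq
    obtain ⟨y, hy⟩ := IsAlgClosed.exists_root _ hdeg
    rw [Polynomial.IsRoot, Polynomial.eval_sub, Polynomial.eval_pow, Polynomial.eval_X,
      Polynomial.eval_add, Polynomial.eval_X, Polynomial.eval_C, h2] at hy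
    simp at hy
  intro i j h
  rcases le_total i j with hij | hij
  · obtain ⟨s, rfl⟩ := Nat.exists_eq_add_of_le hij
    rw [key i s h, add_zero]
  · obtain ⟨s, rfl⟩ := Nat.exists_eq_add_of_le hij
    rw [key j s h.symm, add_zero]

theorem derivative_prod_pow_eval_zero {ι L : Type*} [CommRing L] (s : Finset ι)
    (u : ι → L) (a : ι → ℕ) :
    (Polynomial.derivative (∏ j ∈ s, (1 + Polynomial.C (u j) * Polynomial.X) ^ a j)).eval 0 =
      ∑ j ∈ s, a j * u j := by
  classical
  induction s using Finset.induction_on with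
  | empty => simp
  | insert i s hi ih =>
    rw [Finset.prod_insert hi, Finset.sum_insert hi, Polynomial.derivative_mul, Polynomial.eval_add,
      Polynomial.eval_mul, Polynomial.eval_mul, ih, Polynomial.derivative_pow]
    simp [Polynomial.eval_prod]

/-- Distinct monomials in the iterates of `φ` define distinct functions on `R_π`. -/
theorem eq_of_prod_frobPow_eq (hφ : IsFrobenius φ) {s : Finset ℕ} {a a' : ℕ → ℕ}
    (h : ∀ y : Rpi p π, ∏ j ∈ s, frobPow φ π j y ^ a j = ∏ j ∈ s, frobPow φ π j y ^ a' j) :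
    ∀ j ∈ s, a j = a' j := by
  have h1 : ∀ ξ : Rpi p π, ∑ j ∈ s, ((a j : Kalg p) - a' j) * frobPow φ π j ξ = 0 := fun ξ => by
    -- Put y = 1 + nξ. An identity for all integers n is one of polynomials in n, and its derivative
    -- at 0 turns the multiplicative relation into a linear one.
    have h2 : ∏ j ∈ s, (1 + Polynomial.C (frobPow φ π j ξ) * Polynomial.X) ^ a j =
        ∏ j ∈ s, (1 + Polynomial.C (frobPow φ π j ξ) * Polynomial.X) ^ a' j := by
      refine Polynomial.eq_of_infinite_eval_eq _ _ (Set.infinite_of_injective_forall_mem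
        (f := fun n : ℕ => (n : Kalg p)) Nat.cast_injective fun n => ?_)
      have := h (1 + n * ξ)
      simp only [map_add, map_one, map_mul, map_natCast] at this
      simp only [Set.mem_ofPred_eq, Polynomial.eval_prod, Polynomial.eval_pow, Polynomial.eval_add,
        Polynomial.eval_one, Polynomial.eval_mul, Polynomial.eval_C, Polynomial.eval_X, mul_comm _ (n : Kalg p)]
      exact this
    have h3 := congrArg (fun f => (Polynomial.derivative f).eval 0) h2
    simp only [derivative_prod_pow_eval_zero] at h3
    simp only [sub_mul, Finset.sum_sub_distrib, h3, sub_self]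
  -- Dedekind's independence of characters gives a j = a' j in K^alg, hence in ℕ by characteristic
  -- zero.
  have hinj : Function.Injective fun j => (frobPow φ π j : Rpi p π →* Kalg p) := fun i j hij =>
    frobPow_injective hφ (RingHom.ext fun x => DFunLike.congr_fun hij x)
  have hlin := (linearIndependent_monoidHom (Rpi p π) (Kalg p)).comp _ hinj
  have h2 := linearIndependent_iff'.1 hlin s (fun j => (a j : Kalg p) - a' j) (by
    funext ξ
    simpa using h1 ξ)
  intro j hj
  exact_mod_cast sub_eq_zero.1 (h2 j hj)

section

variable {d r : ℕ}

/-- The index of the point coordinate of a jet variable. -/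
def jetPt : (Fin d × Fin r) ⊕ Fin d → Fin d := Sum.elim Prod.fst id

/-- The order of a jet variable. -/
def jetOrd : (Fin d × Fin r) ⊕ Fin d → ℕ := Sum.elim (fun ij => ij.2 + 1) fun _ => 0

theorem RpiToKalg_jetCoord (hφ : IsFrobenius φ) (hπ : π ∈ PiSet p) (b : Fin d → Rpi p π)
    (s : (Fin d × Fin r) ⊕ Fin d) :
    RpiToKalg p π ((frobeniusRing hφ hπ).jetCoord r b s) =
      (fermatQuotient φ π)^[jetOrd s] (RpiToKalg p π (b (jetPt s))) := by
  rcases s with s | s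
  · exact RpiToKalg_deltaPi_iterate hφ hπ _ _
  · rfl

theorem jet_injective {s s' : (Fin d × Fin r) ⊕ Fin d} (h₁ : jetPt s = jetPt s')
    (h₂ : jetOrd s = jetOrd s') : s = s' := by
  rcases s with ⟨i, j⟩ | i <;> rcases s' with ⟨i', j'⟩ | i'
  · simp only [jetPt, jetOrd, Sum.elim_inl, Nat.add_right_cancel_iff, Fin.val_inj] at h₁ h₂
    rw [h₁, h₂]
  · simp [jetOrd] at h₂
  · simp [jetOrd] at h₂
  · exact congrArg Sum.inr h₁

/-- The monomial functions in the iterates of `φ`. -/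
noncomputable def frobMonomial (φ : Kalg p ≃+* Kalg p) (π : PadicAlgCl p)
    (γ : (Fin d × Fin r) ⊕ Fin d →₀ ℕ) : (Fin d → Rpi p π) →* Kalg p where
  toFun b := ∏ s, frobPow φ π (jetOrd s) (b (jetPt s)) ^ γ s
  map_one' := by simp
  map_mul' b b' := by
    simp only [Pi.mul_apply, map_mul, mul_pow, Finset.prod_mul_distrib]

theorem frobMonomial_injective (hφ : IsFrobenius φ) :
    Function.Injective (frobMonomial (d := d) (r := r) φ π) := by
  classical
  intro γ γ' h
  ext s₀
  -- Testing on tuples that are 1 except at the coordinate of s₀ reduces to monomials in the φ^j of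
  -- one variable.
  have h1 : ∀ (γ : (Fin d × Fin r) ⊕ Fin d →₀ ℕ) (y : Rpi p π),
      frobMonomial φ π γ (Function.update 1 (jetPt s₀) y) =
      ∏ j ∈ Finset.univ.image (jetOrd (d := d) (r := r)), frobPow φ π j y ^
        (∑ s with jetPt s = jetPt s₀ ∧ jetOrd s = j, γ s) := fun γ y => by
    change ∏ s, _ = _
    rw [← Finset.prod_fiberwise_of_maps_to (g := jetOrd)
      (fun s _ => Finset.mem_image_of_mem jetOrd (Finset.mem_univ s))]
    refine Finset.prod_congr rfl fun j _ => ?_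
    rw [← Finset.prod_pow_eq_pow_sum, Finset.prod_filter, Finset.prod_filter]
    refine Finset.prod_congr rfl fun s _ => ?_
    by_cases hs : jetPt s = jetPt s₀
    · by_cases hj : jetOrd s = j
      · simp [hs, hj]
      · simp [hj]
    · simp [hs]
  have h2 := eq_of_prod_frobPow_eq hφ
    (a := fun j => ∑ s with jetPt s = jetPt s₀ ∧ jetOrd s = j, γ s)
    (a' := fun j => ∑ s with jetPt s = jetPt s₀ ∧ jetOrd s = j, γ' s)
    (fun y => (h1 γ y).symm.trans ((DFunLike.congr_fun h _).trans (h1 γ' y))) (jetOrd s₀) (Finset.mem_image_of_mem _ (Finset.mem_univ s₀))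
  have h3 : (Finset.univ.filter fun s : (Fin d × Fin r) ⊕ Fin d =>
      jetPt s = jetPt s₀ ∧ jetOrd s = jetOrd s₀) = {s₀} := by
    ext s
    simp only [Finset.mem_filter, Finset.mem_univ, true_and, Finset.mem_singleton]
    exact ⟨fun hs => jet_injective hs.1 hs.2, fun hs => by rw [hs]; exact ⟨rfl, rfl⟩⟩
  simpa only [h3, Finset.sum_singleton] using h2

/-- The leading part of a polynomial that vanishes to high order along the jets of small points
vanishes on the leading parts of the jets. -/
theorem sum_leadingPart_eq_zero (hφ : IsFrobenius φ) (hπ : π ∈ PiSet p) {n N : ℕ} (hNn : N < n)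
    {F : MvPolynomial ((Fin d × Fin r) ⊕ Fin d) (Rpi p π)}
    (hmin : ∀ γ ∈ F.support, N ≤ Finsupp.degree γ)
    (hdvd : ∀ m, r < m → ∀ b : Fin d → Rpi p π, (p : Rpi p π) ^ ((m - r) * n) ∣
      MvPolynomial.eval ((frobeniusRing hφ hπ).jetCoord r fun i => (p : Rpi p π) ^ m * b i) F)
    (b : Fin d → Rpi p π) :
    ∑ γ ∈ F.support with Finsupp.degree γ = N, (RpiToKalgHom p π (F.coeff γ) *
      ∏ s, leadCoeff φ π (jetOrd s) ^ γ s) * frobMonomial φ π γ b = 0 := by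
  classical
  have hNn' : n - N ≠ 0 := by omega
  let T := RpiToKalgHom p π
  have hp0 := p_Kalg_ne_zero (p := p)
  let y : ℕ → (Fin d × Fin r) ⊕ Fin d → Kalg p := fun m s =>
    ((p : Kalg p) ^ m)⁻¹ * (fermatQuotient φ π)^[jetOrd s] ((p : Kalg p) ^ m * T (b (jetPt s)))
  let z : (Fin d × Fin r) ⊕ Fin d → Kalg p := fun s =>
    leadCoeff φ π (jetOrd s) * φ^[jetOrd s] (T (b (jetPt s)))
  have hy : ∀ s, Tendsto (fun m => y m s) atTop (𝓝 (z s)) := fun s =>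
    hφ.tendsto_fermatQuotient _ _
  have hlim : Tendsto (fun m => ∑ γ ∈ F.support, T (F.coeff γ) *
      ((p : Kalg p) ^ (m * (Finsupp.degree γ - N)) * ∏ s, y m s ^ γ s)) atTop
      (𝓝 (∑ γ ∈ F.support, T (F.coeff γ) *
        ((if Finsupp.degree γ = N then 1 else 0) * ∏ s, z s ^ γ s))) := by
    refine tendsto_finsetSum _ fun γ hγ => Tendsto.const_mul _ (Tendsto.mul ?_
      (tendsto_finsetProd _ fun s _ => (hy s).pow _))
    split_ifs with h
    · rw [h, Nat.sub_self]; simp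
    · have := hmin γ hγ
      exact tendsto_p_pow_Kalg (by omega)
  -- Scaling by p^(-mN), with N the least degree in F, makes the terms of degree N converge and
  -- kills those of higher degree.
  have hval : ∀ m, ∑ γ ∈ F.support, T (F.coeff γ) *
      ((p : Kalg p) ^ (m * (Finsupp.degree γ - N)) * ∏ s, y m s ^ γ s) =
      ((p : Kalg p) ^ (m * N))⁻¹ * T (MvPolynomial.eval
        ((frobeniusRing hφ hπ).jetCoord r fun i => (p : Rpi p π) ^ m * b i) F) := fun m => by
    have h1 : ∀ s, T ((frobeniusRing hφ hπ).jetCoord r (fun i => (p : Rpi p π) ^ m * b i) s) =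
        (p : Kalg p) ^ m * y m s := fun s => by
      refine (RpiToKalg_jetCoord hφ hπ _ s).trans ?_
      rw [mul_inv_cancel_left₀ (pow_ne_zero m hp0)]
      congr 1
    rw [MvPolynomial.eval_eq', map_sum, Finset.mul_sum]
    refine Finset.sum_congr rfl fun γ hγ => ?_
    rw [map_mul, map_prod, mul_left_comm (((p : Kalg p) ^ (m * N))⁻¹)]
    congr 1
    simp only [map_pow, h1, mul_pow, Finset.prod_mul_distrib]
    rw [← mul_assoc]
    congr 1
    rw [Finset.prod_pow_eq_pow_sum, ← Finsupp.degree_eq_sum, ← pow_mul,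
      eq_inv_mul_iff_mul_eq₀ (pow_ne_zero _ hp0), ← pow_add, ← mul_add,
      Nat.add_sub_cancel' (hmin γ hγ)]
  -- With m = r + (l + 1), the divisibility by p^((m-r)n) beats the factor p^(-mN) because n > N;
  -- the discrepancy p^(-rN) is constant.
  have hto0 : Tendsto (fun l => ((p : Kalg p) ^ ((r + (l + 1)) * N))⁻¹ * T (MvPolynomial.eval
        ((frobeniusRing hφ hπ).jetCoord r fun i => (p : Rpi p π) ^ (r + (l + 1)) * b i) F))
        atTop (𝓝 0) := by
    have h1 : Tendsto (fun l : ℕ => ‖((p : Kalg p) ^ (r * N))⁻¹‖ *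
        ‖(p : Kalg p) ^ ((l + 1) * (n - N))‖) atTop (𝓝 0) := by
      have := ((tendsto_p_pow_Kalg (p := p) hNn').comp (tendsto_add_atTop_nat 1)).norm.const_mul
        ‖((p : Kalg p) ^ (r * N))⁻¹‖
      rwa [norm_zero, mul_zero] at this
    refine squeeze_zero_norm (fun l => ?_) h1
    obtain ⟨c, hc⟩ := hdvd (r + (l + 1)) (by omega) b
    rw [hc, map_mul, map_pow, map_natCast, Nat.add_sub_cancel_left]
    have h2 : (l + 1) * n = (l + 1) * (n - N) + (l + 1) * N := by
      rw [← mul_add, Nat.sub_add_cancel (by omega)]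
    have h3 : ((p : Kalg p) ^ ((r + (l + 1)) * N))⁻¹ * ((p : Kalg p) ^ ((l + 1) * n) * T c) =
        ((p : Kalg p) ^ (r * N))⁻¹ * (p : Kalg p) ^ ((l + 1) * (n - N)) * T c := by
      rw [h2, add_mul r, pow_add, pow_add]
      field_simp
    rw [h3, norm_mul, norm_mul]
    exact mul_le_of_le_one_right (by positivity) c.2.2
  have hlim' := hlim.comp (tendsto_add_atTop_nat (r + 1))
  have h0 := tendsto_nhds_unique hlim' (hto0.congr fun l => by
    rw [← hval, Function.comp_apply, show l + (r + 1) = r + (l + 1) by ring])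
  rw [← h0, Finset.sum_filter]
  refine Finset.sum_congr rfl fun γ _ => ?_
  split_ifs with h
  · rw [one_mul, mul_assoc]
    congr 1
    simp only [z, mul_pow, Finset.prod_mul_distrib]
    congr 1
  · rw [zero_mul, mul_zero]

/-- The lowest-degree part of a nonzero F gives, in the limit of small points, a linear relation
between the distinct characters `frobMonomial`. Dedekind forces its coefficients to vanish, and the
factors `leadCoeff` are nonzero. -/
theorem jetIndependent (hφ : IsFrobenius φ) (hπ : π ∈ PiSet p) :
    (frobeniusRing hφ hπ).JetIndependent := by
  classical
  intro d r n F hdeg hdvd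
  by_contra hF
  obtain ⟨γ₀, hγ₀, hmin⟩ := F.support.exists_min_image Finsupp.degree
    (MvPolynomial.support_nonempty.2 hF)
  have hlin := (linearIndependent_monoidHom (Fin d → Rpi p π) (Kalg p)).comp _
    (frobMonomial_injective (d := d) (r := r) (π := π) hφ)
  have h1 := linearIndependent_iff'.1 hlin {γ ∈ F.support | Finsupp.degree γ = Finsupp.degree γ₀}
    (fun γ => RpiToKalgHom p π (F.coeff γ) * ∏ s, leadCoeff φ π (jetOrd s) ^ γ s) (by
      funext b
      simpa only [Finset.sum_apply, Pi.smul_apply, Pi.zero_apply, smul_eq_mul, Function.comp_apply] using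
        sum_leadingPart_eq_zero hφ hπ (hdeg γ₀ hγ₀) hmin hdvd b) γ₀ (Finset.mem_filter.2 ⟨hγ₀, rfl⟩)
  rcases mul_eq_zero.1 h1 with h2 | h2
  · exact MvPolynomial.mem_support_iff.1 hγ₀ (RpiToKalgHom_injective (h2.trans (map_zero _).symm))
  · obtain ⟨s, -, hs⟩ := Finset.prod_eq_zero_iff.1 h2
    exact leadCoeff_ne_zero hπ _ (eq_zero_of_pow_eq_zero hs)

end

end ArithDiff

namespace ArithDiff

/-! ### The fields `K_π` exhaust `K^alg` -/

variable {p : ℕ} [Fact p.Prime]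

theorem p_algCl_ne_zero : (p : PadicAlgCl p) ≠ 0 := by
  exact_mod_cast (Fact.out : p.Prime).ne_zero

theorem Kpi_le_of_mem {β : PadicAlgCl p} {F : IntermediateField (K p) ℂ_[p]}
    (h : (β : ℂ_[p]) ∈ F) : Kpi p β ≤ F :=
  IntermediateField.adjoin_le_iff.2 (Set.singleton_subset_iff.2 h)

/-- Krasner's lemma: every element of `K^alg` is rational over `K(β)` for some `β` algebraic over
`ℚ_p`. -/
theorem exists_mem_Kpi (α : Kalg p) : ∃ β : PadicAlgCl p, (α : ℂ_[p]) ∈ Kpi p β := by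
  classical
  have hintegral : IsIntegral (K p) α := Algebra.IsIntegral.isIntegral α
  -- The conjugates of α other than α itself. Any β closer to α than all of these generates α by
  -- Krasner's lemma.
  set S := ((minpoly (K p) α).map (algebraMap (K p) (Kalg p))).roots.toFinset.erase α with hS
  obtain ⟨ε, hε, hεS⟩ : ∃ ε : ℝ, 0 < ε ∧ ∀ x ∈ S, ε ≤ ‖α - x‖ := by
    rcases S.eq_empty_or_nonempty with h | h
    · exact ⟨1, one_pos, by simp [h]⟩
    · obtain ⟨x, hx, hmin⟩ := S.exists_min_image (fun x => ‖α - x‖) h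
      refine ⟨‖α - x‖, norm_pos_iff.2 (sub_ne_zero.2 ?_), hmin⟩
      exact (Finset.ne_of_mem_erase hx).symm
  obtain ⟨β, hβ⟩ := UniformSpace.Completion.denseRange_coe.exists_dist_lt (α : ℂ_[p]) hε
  rw [dist_eq_norm] at hβ
  have h1 : α ∈ IntermediateField.adjoin (K p) {piKalg β} := by
    refine IsKrasner.krasner (minpoly.irreducible hintegral).separable (IsAlgClosed.splits _)
      (Algebra.IsIntegral.isIntegral _) fun x hx hne => lt_of_lt_of_le ?_ (hεS x ?_)
    · exact hβ
    · rw [hS, Finset.mem_erase, Multiset.mem_toFinset,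
        Polynomial.mem_roots (Polynomial.map_ne_zero (minpoly.ne_zero hintegral)), Polynomial.IsRoot,
        Polynomial.eval_map]
      refine ⟨hne.symm, ?_⟩
      have := minpoly.aeval (K p) x
      rwa [← hx] at this
  refine ⟨β, ?_⟩
  have h2 : (IntermediateField.adjoin (K p) {piKalg β}).map (Kalg p).val = Kpi p β := by
    rw [IntermediateField.adjoin_map, Set.image_singleton]
    rfl
  rw [← h2]
  exact ⟨α, h1, rfl⟩

section Uniformizer

variable {L : IntermediateField ℚ_[p] (PadicAlgCl p)}

/-- Discreteness of the valuation from local compactness: the open unit ball of L is closed, hence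
compact, so the norm attains a maximum on it. -/
theorem exists_max_norm (L : IntermediateField ℚ_[p] (PadicAlgCl p)) [FiniteDimensional ℚ_[p] L] :
     ∃ ϖ ∈ L, 0 < ‖ϖ‖ ∧ ‖ϖ‖ < 1 ∧ ∀ x ∈ L, ‖x‖ < 1 → ‖x‖ ≤ ‖ϖ‖ := by
  let M : Submodule ℚ_[p] (PadicAlgCl p) := Subalgebra.toSubmodule L.toSubalgebra
  have hfd : FiniteDimensional ℚ_[p] M := inferInstanceAs (FiniteDimensional ℚ_[p] L)
  have hprop : ProperSpace M := FiniteDimensional.proper ℚ_[p] M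
  have hcomp : IsCompact (Metric.ball (0 : M) 1) :=
    (isCompact_closedBall (0 : M) 1).of_isClosed_subset (IsUltrametricDist.isClosed_ball 0 1)
      Metric.ball_subset_closedBall
  obtain ⟨x, hx, hmax⟩ := hcomp.exists_isMaxOn (f := fun x : M => ‖(x : PadicAlgCl p)‖)
    ⟨0, Metric.mem_ball_self one_pos⟩ (continuous_subtype_val.norm).continuousOn
  rw [mem_ball_zero_iff] at hx
  have hmax' : ∀ y ∈ L, ‖y‖ < 1 → ‖y‖ ≤ ‖(x : PadicAlgCl p)‖ := fun y hy h =>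
    isMaxOn_iff.1 hmax (⟨y, hy⟩ : M) (mem_ball_zero_iff.2 h)
  refine ⟨x, x.2, ?_, hx, hmax'⟩
  have := hmax' p (natCast_mem _ _) (by rw [norm_p_algCl]; exact inv_p_lt_one)
  rw [norm_p_algCl] at this
  exact (inv_pos.2 p_pos).trans_le this

theorem exists_norm_eq_zpow {ϖ : PadicAlgCl p} (hϖ : ϖ ∈ L) (h0 : 0 < ‖ϖ‖) (h1 : ‖ϖ‖ < 1)
    (hmax : ∀ x ∈ L, ‖x‖ < 1 → ‖x‖ ≤ ‖ϖ‖) {x : PadicAlgCl p} (hx : x ∈ L) (hx0 : x ≠ 0) :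
    ∃ n : ℤ, ‖x‖ = ‖ϖ‖ ^ n := by
  obtain ⟨n, hn1, hn2⟩ := exists_mem_Ioc_zpow (norm_pos_iff.2 hx0) ((one_lt_inv₀ h0).2 h1)
  refine ⟨-(n + 1), ?_⟩
  rw [inv_zpow'] at hn1 hn2
  have hpos : 0 < ‖ϖ‖ ^ (-(n + 1)) := zpow_pos h0 _
  refine hn2.antisymm (le_of_not_gt fun hlt => ?_)
  have h2 := hmax (x / ϖ ^ (-(n + 1))) (div_mem hx (zpow_mem hϖ _)) (by
    rw [norm_div, norm_zpow]; exact (div_lt_one hpos).2 hlt)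
  rw [norm_div, norm_zpow, div_le_iff₀ hpos, ← zpow_one_add₀ h0.ne'] at h2
  rw [show (1 : ℤ) + -(n + 1) = -n by ring] at h2
  exact absurd h2 (not_le.2 hn1)

/-- There is a uniformizer that generates the field over `ℚ_p`. -/
theorem exists_primitive_uniformizer (L : IntermediateField ℚ_[p] (PadicAlgCl p))
    [FiniteDimensional ℚ_[p] L] : ∃ ϖ ∈ L, 0 < ‖ϖ‖ ∧ ‖ϖ‖ < 1 ∧ (∀ x ∈ L, ‖x‖ < 1 → ‖x‖ ≤ ‖ϖ‖) ∧
      IntermediateField.adjoin ℚ_[p] {ϖ} = L := by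
  obtain ⟨ϖ, hϖ, h0, h1, hmax⟩ := exists_max_norm L
  obtain ⟨θ, hθ⟩ := Field.exists_primitive_element ℚ_[p] L
  have hfin : Finite (IntermediateField ℚ_[p] L) :=
    Field.finite_intermediateField_of_exists_primitive_element ℚ_[p] L ⟨θ, hθ⟩
  have hlim : Tendsto (fun n : ℕ => ‖(p : PadicAlgCl p) ^ n * θ‖) atTop (𝓝 0) := by
    have := (tendsto_pow_atTop_nhds_zero_of_lt_one (inv_pos.2 (p_pos (p := p))).le
      inv_p_lt_one).mul_const ‖(θ : PadicAlgCl p)‖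
    rw [zero_mul] at this
    refine this.congr fun n => ?_
    rw [norm_mul, norm_pow, norm_p_algCl]
  obtain ⟨N, hN⟩ := eventually_atTop.1 (hlim.eventually (gt_mem_nhds h0))
  -- There are finitely many intermediate fields, so two perturbations of ϖ by multiples of θ
  -- generate the same field, which then contains θ. The exponent N keeps the perturbation smaller
  -- than ϖ, so the result is still a uniformizer.
  obtain ⟨n, m, hnm, he⟩ := Finite.exists_ne_map_eq_of_infinite fun n : ℕ =>
    IntermediateField.adjoin ℚ_[p] {(⟨ϖ, hϖ⟩ + (p : L) ^ (N + n) * θ : L)}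
  set E := IntermediateField.adjoin ℚ_[p] {(⟨ϖ, hϖ⟩ + (p : L) ^ (N + n) * θ : L)} with hE
  have hp0 : (p : L) ≠ 0 := by exact_mod_cast (Fact.out : p.Prime).ne_zero
  have hθE : θ ∈ E := by
    have h2 : (⟨ϖ, hϖ⟩ + (p : L) ^ (N + n) * θ : L) ∈ E :=
      IntermediateField.mem_adjoin_simple_self _ _
    have h3 : (⟨ϖ, hϖ⟩ + (p : L) ^ (N + m) * θ : L) ∈ E := by
      rw [he]; exact IntermediateField.mem_adjoin_simple_self _ _
    have h4 := sub_mem h2 h3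
    rw [add_sub_add_left_eq_sub, ← sub_mul] at h4
    have h5 : (p : L) ^ (N + n) - (p : L) ^ (N + m) ≠ 0 := by
      rw [sub_ne_zero]
      intro h
      have : p ^ (N + n) = p ^ (N + m) := by exact_mod_cast h
      have := Nat.pow_right_injective (Fact.out : p.Prime).two_le this
      omega
    have h6 := div_mem h4 (sub_mem (pow_mem (natCast_mem E p) (N + n)) (pow_mem (natCast_mem E p) (N + m)))
    rwa [mul_div_cancel_left₀ _ h5] at h6
  have hEtop : E = ⊤ := by
    rw [eq_top_iff, ← hθ]
    exact IntermediateField.adjoin_le_iff.2 (Set.singleton_subset_iff.2 hθE)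
  set ϖ' : PadicAlgCl p := ϖ + (p : PadicAlgCl p) ^ (N + n) * θ with hϖ'
  have hnorm : ‖ϖ'‖ = ‖ϖ‖ := by
    refine norm_eq_of_norm_sub_lt ?_
    rw [hϖ', sub_add_cancel_left, norm_neg]
    exact hN _ (Nat.le_add_right _ _)
  refine ⟨ϖ', add_mem hϖ (mul_mem (pow_mem (natCast_mem _ _) _) θ.2), by rwa [hnorm],
    by rwa [hnorm], by rwa [hnorm], ?_⟩
  have h2 : E.map L.val = IntermediateField.adjoin ℚ_[p] {ϖ'} := by
    rw [hE, IntermediateField.adjoin_map, Set.image_singleton]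
    simp [hϖ']
  rw [← h2, hEtop, ← AlgHom.fieldRange_eq_map, IntermediateField.fieldRange_val]

/-- A finite extension of `ℚ_p` is generated over its maximal unramified subextension by the powers
of a uniformizer of exponent less than the ramification index. -/
theorem exists_sum_of_mem [FiniteDimensional ℚ_[p] L] {ϖ : PadicAlgCl p} (hϖ : ϖ ∈ L) (hϖ0 : ϖ ≠ 0)
    (hmax : ∀ x ∈ L, ‖x‖ < 1 → ‖x‖ ≤ ‖ϖ‖) {e : ℕ} (he : ‖ϖ‖ ^ e = (p : ℝ)⁻¹)
    {x : PadicAlgCl p} (hx : x ∈ L) :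
    ∃ c : ℕ → PadicAlgCl p, (∀ i, c i ∈ Qur p) ∧ x = ∑ i ∈ Finset.range e, c i * ϖ ^ i := by
  have hp0 := p_algCl_ne_zero (p := p)
  let S : Submodule ℚ_[p] (PadicAlgCl p) :=
    { carrier := {x | ∃ c : ℕ → PadicAlgCl p, (∀ i, c i ∈ L ∧ c i ∈ Qur p) ∧
        x = ∑ i ∈ Finset.range e, c i * ϖ ^ i}
      add_mem' := by
        rintro _ _ ⟨c, hc, rfl⟩ ⟨c', hc', rfl⟩
        refine ⟨fun i => c i + c' i, fun i => ⟨add_mem (hc i).1 (hc' i).1,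
          add_mem (hc i).2 (hc' i).2⟩, ?_⟩
        rw [← Finset.sum_add_distrib]
        exact Finset.sum_congr rfl fun i _ => by ring
      zero_mem' := ⟨fun _ => 0, fun _ => ⟨zero_mem _, zero_mem _⟩, by simp⟩
      smul_mem' := by
        rintro a _ ⟨c, hc, rfl⟩
        refine ⟨fun i => algebraMap ℚ_[p] (PadicAlgCl p) a * c i, fun i =>
          ⟨mul_mem (L.algebraMap_mem a) (hc i).1, mul_mem ((Qur p).algebraMap_mem a) (hc i).2⟩, ?_⟩
        rw [Algebra.smul_def, Finset.mul_sum]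
        exact Finset.sum_congr rfl fun i _ => by ring }
  have hSL : ∀ x ∈ S, x ∈ L := by
    rintro _ ⟨c, hc, rfl⟩
    exact sum_mem fun i _ => mul_mem (hc i).1 (pow_mem hϖ i)
  have hfd : FiniteDimensional ℚ_[p] S :=
    FiniteDimensional.of_injective (Submodule.inclusion
      (p := S) (p' := Subalgebra.toSubmodule L.toSubalgebra) hSL) (Submodule.inclusion_injective _)
  have hclosed := Submodule.closed_of_finiteDimensional S
  have hdigit : ∀ j : ℕ, ∀ x ∈ L, ‖x‖ ≤ 1 → ∃ c : ℕ → PadicAlgCl p,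
      (∀ i, c i ∈ L ∧ c i ∈ Qur p) ∧
      ∃ y ∈ L, ‖y‖ ≤ 1 ∧ x = ∑ i ∈ Finset.range j, c i * ϖ ^ i + ϖ ^ j * y := by
    intro j
    induction j with
    | zero => intro x hx h; exact ⟨fun _ => 0, fun _ => ⟨zero_mem _, zero_mem _⟩, x, hx, h, by simp⟩
    | succ j ih =>
      intro x hx h
      obtain ⟨c, hc, y, hy, hy1, rfl⟩ := ih x hx h
      obtain ⟨ζ, hζL, hζ, hlt⟩ := exists_teich L hy hy1
      refine ⟨Function.update c j ζ, fun i => ?_, (y - ζ) / ϖ, div_mem (sub_mem hy hζL) hϖ, ?_, ?_⟩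
      · by_cases hij : i = j
        · rw [hij, Function.update_self]; exact ⟨hζL, teich_mem_Qur hζ⟩
        · rw [Function.update_of_ne hij]; exact hc i
      · rw [norm_div]
        exact div_le_one_of_le₀ (hmax _ (sub_mem hy hζL) hlt) (norm_nonneg _)
      · rw [Finset.sum_range_succ, Function.update_self, pow_succ, mul_assoc,
          mul_div_cancel₀ _ hϖ0]
        have : ∑ i ∈ Finset.range j, Function.update c j ζ i * ϖ ^ i =
            ∑ i ∈ Finset.range j, c i * ϖ ^ i := Finset.sum_congr rfl fun i hi => by
          rw [Function.update_of_ne (Finset.mem_range.1 hi).ne]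
        rw [this]; ring
  have happrox : ∀ n : ℕ, ∀ x ∈ L, ‖x‖ ≤ 1 → ∃ w ∈ S, ‖w - x‖ ≤ ((p : ℝ)⁻¹) ^ n := by
    intro n
    induction n with
    | zero => intro x _ h; exact ⟨0, zero_mem _, by simpa using h⟩
    | succ n ih =>
      intro x hx h
      -- After e Teichmüller digits the remainder has the factor ϖ^e, of the norm of p, so the
      -- expansion restarts with p in place of ϖ^e.
      obtain ⟨c, hc, y, hy, hy1, rfl⟩ := hdigit e x hx h
      obtain ⟨w, hw, hwy⟩ := ih (ϖ ^ e * y / p)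
        (div_mem (mul_mem (pow_mem hϖ _) hy) (natCast_mem _ _)) (by
        rw [norm_div, norm_mul, norm_pow, he, norm_p_algCl]
        exact div_le_one_of_le₀ (mul_le_of_le_one_right (inv_pos.2 p_pos).le hy1)
          (inv_pos.2 p_pos).le)
      refine ⟨∑ i ∈ Finset.range e, c i * ϖ ^ i + (p : ℚ_[p]) • w,
        add_mem ⟨c, hc, rfl⟩ (S.smul_mem _ hw), ?_⟩
      have : ∑ i ∈ Finset.range e, c i * ϖ ^ i + (p : ℚ_[p]) • w -
          (∑ i ∈ Finset.range e, c i * ϖ ^ i + ϖ ^ e * y) = p * (w - ϖ ^ e * y / p) := by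
        rw [Algebra.smul_def, map_natCast, mul_sub, mul_div_cancel₀ _ hp0]; ring
      rw [this, norm_mul, norm_p_algCl, pow_succ']
      exact mul_le_mul_of_nonneg_left hwy (inv_pos.2 p_pos).le
  have hball : ∀ x ∈ L, ‖x‖ ≤ 1 → x ∈ S := by
    intro x hx h
    choose w hw hwx using fun n => happrox n x hx h
    have hlim : Tendsto w atTop (𝓝 x) := by
      rw [tendsto_iff_norm_sub_tendsto_zero]
      exact squeeze_zero (fun _ => norm_nonneg _) hwx
        (tendsto_pow_atTop_nhds_zero_of_lt_one (inv_pos.2 p_pos).le inv_p_lt_one)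
    exact hclosed.mem_of_tendsto hlim (Eventually.of_forall hw)
  have hxS : x ∈ S := by
    obtain ⟨n, hn⟩ := exists_pow_lt_of_lt_one
      (show 0 < (‖x‖ + 1)⁻¹ by positivity) (inv_p_lt_one (p := p))
    have h2 : ‖(p : PadicAlgCl p) ^ n * x‖ ≤ 1 := by
      rw [norm_mul, norm_pow, norm_p_algCl]
      have : ((p : ℝ)⁻¹) ^ n * ‖x‖ ≤ (‖x‖ + 1)⁻¹ * (‖x‖ + 1) :=
        mul_le_mul hn.le (by linarith) (norm_nonneg _) (by positivity)
      rwa [inv_mul_cancel₀ (by positivity)] at this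
    have h3 := S.smul_mem ((p : ℚ_[p]) ^ n)⁻¹
      (hball _ (mul_mem (pow_mem (natCast_mem _ _) n) hx) h2)
    rwa [Algebra.smul_def, map_inv₀, map_pow, map_natCast,
      inv_mul_cancel_left₀ (pow_ne_zero n hp0)] at h3
  obtain ⟨c, hc, hxc⟩ := hxS
  exact ⟨c, fun i => (hc i).2, hxc⟩

/-- The terms a i * ϖ^i have distinct norms and sum to ϖ^e. Comparing valuations modulo e makes the
constant term dominant, of norm p^(-1), and bounds the other coefficients by p^(-1). This is the
Eisenstein condition. -/
theorem mem_PiSet_of_norm {ϖ : PadicAlgCl p} {e : ℕ} (he : e ≠ 0) (hnorm : ‖ϖ‖ ^ e = (p : ℝ)⁻¹)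
    {a : ℕ → PadicAlgCl p} (ha : ∀ i, a i ∈ Qur p)
    (hexp : ϖ ^ e = ∑ i ∈ Finset.range e, a i * ϖ ^ i)
    (hgal : IsGalois ℚ_[p] (IntermediateField.adjoin ℚ_[p] {ϖ})) : ϖ ∈ PiSet p := by
  have hpos : 0 < ‖ϖ‖ := (norm_nonneg ϖ).lt_of_ne' fun h0 => by
    rw [h0, zero_pow he] at hnorm
    exact (inv_pos.2 (p_pos (p := p))).ne hnorm
  have hlt : ‖ϖ‖ < 1 := by
    by_contra! hcon
    have := one_le_pow₀ hcon (n := e)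
    rw [hnorm] at this
    exact absurd this (not_le.2 inv_p_lt_one)
  have hne : ∑ i ∈ Finset.range e, a i * ϖ ^ i ≠ 0 := by
    rw [← hexp]; exact pow_ne_zero _ (norm_pos_iff.1 hpos)
  obtain ⟨i, hi, ⟨n, hn⟩, hi', hmax⟩ := norm_sum_mul_pow he hnorm
    (fun i _ h => norm_of_mem_Qur (ha i) h) hne
  rw [← hexp, norm_pow] at hn hi' hmax
  have hi0 : i = 0 := by
    rw [← zpow_natCast] at hn
    have h' := zpow_right_injective₀ hpos hlt.ne hn
    have h3 : (e : ℤ) % e = ((i : ℤ) + e * n) % e := congrArg (· % (e : ℤ)) h'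
    rw [Int.emod_self, Int.add_mul_emod_self_left,
      Int.emod_eq_of_lt (by positivity) (by exact_mod_cast hi)] at h3
    exact_mod_cast h3.symm
  subst hi0
  rw [pow_zero, mul_one, hnorm] at hi'
  have hle : ∀ j < e, ‖a j‖ ≤ (p : ℝ)⁻¹ := fun j hj => by
    by_cases h0 : a j = 0
    · rw [h0, norm_zero]; exact (inv_pos.2 p_pos).le
    obtain ⟨n, hn⟩ := norm_of_mem_Qur (ha j) h0
    refine norm_le_inv_of_lt_one hn ?_
    have h1 := hmax j hj
    rw [norm_mul, norm_pow] at h1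
    by_contra! hcon
    have h2 : ‖ϖ‖ ^ e < ‖ϖ‖ ^ j := pow_lt_pow_right_of_lt_one₀ hpos hlt hj
    exact absurd (h2.trans_le (le_mul_of_one_le_left (by positivity) hcon)) (not_lt.2 h1)
  -- Only the coefficients of index below e are known to be integral; the others are replaced by 0.
  have hmem : ∀ j, (if j < e then a j else 0) ∈ Zur p := fun j => by
    split_ifs with h
    · exact ⟨ha j, (hle j h).trans inv_p_lt_one.le⟩
    · exact zero_mem _
  have hp0 := p_algCl_ne_zero (p := p)
  have hdvd : ∀ (n : ℕ) (x : Zur p), x ∈ Ideal.span {(p : Zur p)} ^ n ↔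
      ‖(x : PadicAlgCl p)‖ ≤ ((p : ℝ)⁻¹) ^ n := fun n x => by
    rw [Ideal.span_singleton_pow, Ideal.mem_span_singleton]
    constructor
    · rintro ⟨y, rfl⟩
      rw [Subring.coe_mul, Subring.coe_pow, SubringClass.coe_natCast, norm_mul, norm_pow,
        norm_p_algCl]
      exact mul_le_of_le_one_right (pow_nonneg (inv_pos.2 p_pos).le _) y.2.2
    · intro h
      refine ⟨⟨x / (p : PadicAlgCl p) ^ n, div_mem x.2.1 (pow_mem (natCast_mem _ _) _), ?_⟩,
        Subtype.ext ?_⟩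
      · rw [norm_div, norm_pow, norm_p_algCl]
        exact div_le_one_of_le₀ h (pow_nonneg (inv_pos.2 p_pos).le _)
      · rw [Subring.coe_mul, Subring.coe_pow, SubringClass.coe_natCast]
        exact (mul_div_cancel₀ _ (pow_ne_zero n hp0)).symm
  set Q : Polynomial (Zur p) := ∑ i ∈ Finset.range e, Polynomial.C ⟨_, hmem i⟩ * Polynomial.X ^ i
    with hQ
  have hQlt : Q.degree < (e : WithBot ℕ) := by
    refine (Polynomial.degree_sum_le _ _).trans_lt ((Finset.sup_lt_iff (WithBot.bot_lt_coe e)).2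
      fun i hi => (Polynomial.degree_C_mul_X_pow_le i _).trans_lt ?_)
    exact WithBot.coe_lt_coe.2 (Finset.mem_range.1 hi)
  have hQcoeff : ∀ j < e, ((Q.coeff j : Zur p) : PadicAlgCl p) = a j := fun j hj => by
    rw [hQ, Polynomial.finsetSum_coeff]
    simp only [Polynomial.coeff_C_mul_X_pow]
    rw [Finset.sum_ite_eq, if_pos (Finset.mem_range.2 hj)]
    exact if_pos hj
  have hmonic : (Polynomial.X ^ e - Q).Monic := Polynomial.monic_X_pow_sub hQlt
  have hdeg : (Polynomial.X ^ e - Q).natDegree = e := by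
    refine Polynomial.natDegree_eq_of_degree_eq_some ?_
    rw [Polynomial.degree_sub_eq_left_of_degree_lt]
    · exact Polynomial.degree_X_pow e
    · rwa [Polynomial.degree_X_pow]
  have hcoeff : ∀ j < e, (((Polynomial.X ^ e - Q).coeff j : Zur p) : PadicAlgCl p) = -a j :=
    fun j hj => by
      rw [Polynomial.coeff_sub, Polynomial.coeff_X_pow, if_neg hj.ne, zero_sub, Subring.coe_neg,
        hQcoeff j hj]
  refine ⟨⟨Polynomial.X ^ e - Q, hmonic, ⟨?_, fun {j} hj => ?_, ?_⟩, ?_⟩, hgal⟩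
  · rw [hmonic.leadingCoeff, ← pow_one (Ideal.span _), hdvd, pow_one, Subring.coe_one, norm_one]
    exact not_le.2 inv_p_lt_one
  · rw [hdeg] at hj
    rw [← pow_one (Ideal.span _), hdvd, pow_one, hcoeff j hj, norm_neg]
    exact hle j hj
  · rw [hdvd, hcoeff 0 (Nat.pos_of_ne_zero he), norm_neg, ← hi', not_le]
    exact pow_lt_self_of_lt_one₀ (inv_pos.2 p_pos) inv_p_lt_one one_lt_two
  · rw [map_sub, map_pow, Polynomial.aeval_X, hQ, map_sum, hexp, sub_eq_zero]
    refine Finset.sum_congr rfl fun i hi => ?_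
    rw [map_mul, map_pow, Polynomial.aeval_X, Polynomial.aeval_C]
    congr 1
    exact (if_pos (Finset.mem_range.1 hi)).symm

end Uniformizer

theorem exists_mem_PiSet (L : IntermediateField ℚ_[p] (PadicAlgCl p)) [FiniteDimensional ℚ_[p] L]
    [IsGalois ℚ_[p] L] : ∃ ϖ ∈ PiSet p, L = IntermediateField.adjoin ℚ_[p] {ϖ} := by
  obtain ⟨ϖ, hϖ, h0, h1, hmax, hgen⟩ := exists_primitive_uniformizer L
  obtain ⟨n, hn⟩ := exists_norm_eq_zpow hϖ h0 h1 hmax (natCast_mem L p) p_algCl_ne_zero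
  rw [norm_p_algCl] at hn
  have hn0 : 0 < n := by
    by_contra! hcon
    have : (1 : ℝ) ≤ ‖ϖ‖ ^ n := by
      rw [← zpow_zero ‖ϖ‖]
      exact (zpow_le_zpow_iff_right_of_lt_one₀ h0 h1).2 hcon
    rw [← hn] at this
    exact absurd this (not_le.2 inv_p_lt_one)
  obtain ⟨e, rfl⟩ := Int.eq_ofNat_of_zero_le hn0.le
  rw [zpow_natCast] at hn
  obtain ⟨a, ha, hexp⟩ := exists_sum_of_mem hϖ (norm_pos_iff.1 h0) hmax hn.symm (pow_mem hϖ e)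
  refine ⟨ϖ, mem_PiSet_of_norm (by omega) hn.symm ha hexp ?_, hgen.symm⟩
  rw [hgen]
  infer_instance

/-- Finitely many elements of `K^alg` lie in a common `K_π` with `π ∈ Π`. -/
theorem exists_forall_mem_Kpi {ι : Type*} [Finite ι] (α : ι → Kalg p) :
    ∃ π ∈ PiSet p, ∀ i, (α i : ℂ_[p]) ∈ Kpi p π := by
  choose β hβ using fun i => exists_mem_Kpi (α i)
  set E := IntermediateField.adjoin ℚ_[p] (Set.range β)
  have hE : FiniteDimensional ℚ_[p] E :=
    IntermediateField.finiteDimensional_adjoin fun x _ => Algebra.IsIntegral.isIntegral x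
  -- Membership in Π requires a Galois extension of ℚ_p, so the finite extension is first enlarged
  -- to its normal closure.
  set L := IntermediateField.normalClosure ℚ_[p] E (PadicAlgCl p)
  have hL : Normal ℚ_[p] L := inferInstance
  have hLf : FiniteDimensional ℚ_[p] L := inferInstance
  have hLg : IsGalois ℚ_[p] L := ⟨⟩
  obtain ⟨π, hπ, hLπ⟩ := exists_mem_PiSet L
  refine ⟨π, hπ, fun i => Kpi_le_of_mem (coe_mem_Kpi ?_) (hβ i)⟩
  rw [← hLπ]
  exact IntermediateField.le_normalClosure E (IntermediateField.subset_adjoin _ _ ⟨i, rfl⟩)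

end ArithDiff

namespace ArithDiff

/-! ### Étale algebras over affine space over `R` -/

variable {p : ℕ} [Fact p.Prime] {A : Type} [CommRing A] [Algebra (R p) A] {d : ℕ}
  {θ : MvPolynomial (Fin d) (R p) →+* A}

/-- Translating the coordinates preserves étaleness and moves P to the origin, as the Taylor
arguments require. -/
theorem exists_translate {R A : Type} [CommRing R] [CommRing A] [Algebra R A]
    {θ : MvPolynomial (Fin d) R →+* A} (hθ : θ.Etale)
    (hC : θ.comp MvPolynomial.C = algebraMap R A) (P : A →ₐ[R] R) :
    ∃ θ' : MvPolynomial (Fin d) R →+* A, θ'.Etale ∧ θ'.comp MvPolynomial.C = algebraMap R A ∧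
      ∀ i, P (θ' (MvPolynomial.X i)) = 0 := by
  let c : Fin d → R := fun i => P (θ (MvPolynomial.X i))
  let τ : MvPolynomial (Fin d) R →ₐ[R] MvPolynomial (Fin d) R :=
    MvPolynomial.aeval fun i => MvPolynomial.X i - MvPolynomial.C (c i)
  let σ : MvPolynomial (Fin d) R →ₐ[R] MvPolynomial (Fin d) R :=
    MvPolynomial.aeval fun i => MvPolynomial.X i + MvPolynomial.C (c i)
  have h1 : τ.comp σ = AlgHom.id R _ := MvPolynomial.algHom_ext fun i => by
    simp [τ, σ, MvPolynomial.algebraMap_eq]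
  have h2 : σ.comp τ = AlgHom.id R _ := MvPolynomial.algHom_ext fun i => by
    simp [τ, σ, MvPolynomial.algebraMap_eq]
  have hbij : Function.Bijective τ := Function.bijective_iff_has_inverse.2
    ⟨σ, fun x => DFunLike.congr_fun h2 x, fun x => DFunLike.congr_fun h1 x⟩
  have hθC : ∀ r, θ (MvPolynomial.C r) = algebraMap R A r := fun r => RingHom.congr_fun hC r
  refine ⟨θ.comp τ.toRingHom, RingHom.Etale.stableUnderComposition _ _
    (RingHom.Etale.of_bijective hbij) hθ, ?_, fun i => ?_⟩
  · ext r
    change θ (τ (MvPolynomial.C r)) = _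
    rw [← MvPolynomial.algebraMap_eq, τ.commutes, MvPolynomial.algebraMap_eq, hθC]
  · simp [τ, hθC, c]

theorem finiteType_of_etale (hθ : θ.Etale) (hC : θ.comp MvPolynomial.C = algebraMap (R p) A) :
    Algebra.FiniteType (R p) A := by
  have h1 : θ.FiniteType :=
    RingHom.FiniteType.of_finitePresentation (RingHom.Etale.iff_flat_and_formallyUnramified.1 hθ).2.2
  have h2 : (MvPolynomial.C : R p →+* MvPolynomial (Fin d) (R p)).FiniteType := by
    rw [← MvPolynomial.algebraMap_eq, RingHom.finiteType_algebraMap]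
    infer_instance
  have h3 := h1.comp h2
  rwa [hC, RingHom.finiteType_algebraMap] at h3

theorem formallyEtale_of_etale {B C : Type*} [CommRing B] [CommRing C] {θ : B →+* C}
    (hθ : θ.Etale) : θ.FormallyEtale := by
  algebraize [θ]
  exact (inferInstance : Algebra.FormallyEtale B C)

/-- A/p is a quotient of a polynomial ring over the field R/p. -/
theorem isNoetherianRing_quotient [Algebra.FiniteType (R p) A] :
    IsNoetherianRing (A ⧸ Ideal.span {(p : A)}) := by
  obtain ⟨n, q, hq⟩ := Algebra.FiniteType.iff_quotient_mvPolynomial''.1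
    (inferInstance : Algebra.FiniteType (R p) A)
  let := Ideal.Quotient.field (Ideal.span {(p : R p)})
  let g : R p ⧸ Ideal.span {(p : R p)} →+* A ⧸ Ideal.span {(p : A)} :=
    Ideal.Quotient.lift _ ((Ideal.Quotient.mk _).comp (algebraMap (R p) A)) fun r hr => by
      obtain ⟨y, rfl⟩ := Ideal.mem_span_singleton.1 hr
      rw [RingHom.comp_apply, Ideal.Quotient.eq_zero_iff_mem, map_mul, map_natCast]
      exact Ideal.mul_mem_right _ _ (Ideal.mem_span_singleton_self _)
  let G := MvPolynomial.eval₂Hom g fun i : Fin n =>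
    Ideal.Quotient.mk (Ideal.span {(p : A)}) (q (MvPolynomial.X i))
  have hG : G.comp (MvPolynomial.map (Ideal.Quotient.mk _)) =
      (Ideal.Quotient.mk (Ideal.span {(p : A)})).comp q.toRingHom := by
    refine MvPolynomial.ringHom_ext (fun r => ?_) fun i => ?_
    · simp only [G, g, RingHom.comp_apply, MvPolynomial.map_C, MvPolynomial.coe_eval₂Hom,
        MvPolynomial.eval₂_C, Ideal.Quotient.lift_mk]
      congr 1
      exact (q.commutes r).symm
    · simp [G]
  refine isNoetherianRing_of_surjective _ _ G fun y => ?_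
  obtain ⟨a, rfl⟩ := Ideal.Quotient.mk_surjective y
  obtain ⟨f, rfl⟩ := hq a
  exact ⟨_, RingHom.congr_fun hG f⟩

/-- The Nullstellensatz: a prime of an `R`-algebra of finite type over the closed point of `R` is
contained in the kernel of a homomorphism to `k`. -/
theorem exists_hom_residue [Algebra.FiniteType (R p) A] (𝔮 : Ideal A) (h𝔮 : 𝔮 ≠ ⊤)
    (hp : (p : A) ∈ 𝔮) :
    ∃ β : A →+* k p, β.comp (algebraMap (R p) A) = RtoResidue p ∧ 𝔮 ≤ RingHom.ker β := by
  obtain ⟨𝔪, hm, hle⟩ := Ideal.exists_le_maximal 𝔮 h𝔮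
  let := Ideal.Quotient.field 𝔪
  let u : R p →+* A ⧸ 𝔪 := (Ideal.Quotient.mk 𝔪).comp (algebraMap (R p) A)
  have hu : RingHom.ker (RtoResidue p) ≤ RingHom.ker u := by
    rw [ker_RtoResidue, Ideal.span_singleton_le_iff_mem, RingHom.mem_ker, RingHom.comp_apply,
      map_natCast, Ideal.Quotient.eq_zero_iff_mem]
    exact hle hp
  let v : k p →+* A ⧸ 𝔪 := RingHom.liftOfSurjective (RtoResidue p) RtoResidue_surjective ⟨u, hu⟩
  have hv : v.comp (RtoResidue p) = u :=
    RingHom.liftOfRightInverse_comp _ _ _ _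
  let := v.toAlgebra
  have hft : Algebra.FiniteType (k p) (A ⧸ 𝔪) := by
    have h1 : u.FiniteType := by
      refine RingHom.FiniteType.comp
        (RingHom.FiniteType.of_surjective _ Ideal.Quotient.mk_surjective) ?_
      rw [RingHom.finiteType_algebraMap]; infer_instance
    rw [← hv] at h1
    have h2 : v.FiniteType := RingHom.FiniteType.of_comp_finiteType h1
    exact h2
  have hfin : Module.Finite (k p) (A ⧸ 𝔪) := finite_of_finite_type_of_isJacobsonRing _ _
  have hbij : Function.Bijective v := IsAlgClosed.algebraMap_bijective_of_isIntegral
  let e := RingEquiv.ofBijective v hbij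
  refine ⟨(e.symm : (A ⧸ 𝔪) →+* k p).comp (Ideal.Quotient.mk 𝔪), ?_, fun x hx => ?_⟩
  · ext r
    change e.symm (u r) = _
    rw [RingEquiv.symm_apply_eq, ← hv]
    rfl
  · rw [RingHom.mem_ker, RingHom.comp_apply, Ideal.Quotient.eq_zero_iff_mem.2 (hle hx), map_zero]

/-- Points over the residue field lift to `R`. -/
theorem exists_lift_residue (hθ : θ.Etale) (hC : θ.comp MvPolynomial.C = algebraMap (R p) A)
    {β : A →+* k p} (hβ : β.comp (algebraMap (R p) A) = RtoResidue p) :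
    ∃ P : A →ₐ[R p] R p, ∀ s, RtoResidue p (P s) = β s := by
  let q : R p ⧸ Ideal.span {(p : R p)} →+* k p :=
    Ideal.Quotient.lift _ (RtoResidue p) fun r hr => by rwa [← ker_RtoResidue] at hr
  have hq : Function.Bijective q := by
    refine ⟨?_, fun y => ?_⟩
    · refine RingHom.lift_injective_of_ker_le_ideal _ _ ?_
      rw [ker_RtoResidue]
    · obtain ⟨r, rfl⟩ := RtoResidue_surjective y
      exact ⟨Ideal.Quotient.mk _ r, rfl⟩
  let e := RingEquiv.ofBijective q hq
  choose c hc using fun i => RtoResidue_surjective (β (θ (MvPolynomial.X i)))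
  let α : MvPolynomial (Fin d) (R p) →+* R p := MvPolynomial.eval c
  have hcomp : ((e.symm : k p →+* _).comp β).comp θ =
      (Ideal.Quotient.mk (Ideal.span {(p : R p)})).comp α := by
    refine MvPolynomial.ringHom_ext (fun r => ?_) fun i => ?_
    · change e.symm (β (θ (MvPolynomial.C r))) = Ideal.Quotient.mk _ (MvPolynomial.eval c _)
      rw [RingEquiv.symm_apply_eq, MvPolynomial.eval_C]
      have h1 : θ (MvPolynomial.C r) = algebraMap (R p) A r := RingHom.congr_fun hC r
      rw [h1]
      exact RingHom.congr_fun hβ r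
    · change e.symm (β (θ (MvPolynomial.X i))) = Ideal.Quotient.mk _ (MvPolynomial.eval c _)
      rw [RingEquiv.symm_apply_eq, MvPolynomial.eval_X]
      exact (hc i).symm
  have := isAdicComplete_R (p := p)
  obtain ⟨γ, hγ, hγ'⟩ := exists_lift_of_isAdicComplete (formallyEtale_of_etale hθ)
    (Ideal.span {(p : R p)}) α _ hcomp
  refine ⟨{ γ with commutes' := fun r => ?_ }, fun s => ?_⟩
  · have h1 : θ (MvPolynomial.C r) = algebraMap (R p) A r := RingHom.congr_fun hC r
    have h2 := RingHom.congr_fun hγ (MvPolynomial.C r)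
    rw [RingHom.comp_apply, h1] at h2
    refine Eq.trans h2 ?_
    exact MvPolynomial.eval_C r
  · have h1 := RingHom.congr_fun hγ' s
    have h2 := congrArg e h1
    change _ = e (e.symm (β s)) at h2
    rw [RingEquiv.apply_symm_apply] at h2
    exact h2

theorem not_isUnit_p : ¬ IsUnit (p : R p) := fun h => by
  rw [valRing_isUnit_iff, coe_valRing_natCast, norm_p] at h
  exact inv_p_lt_one.ne h

variable {π : PadicAlgCl p} {φ : Kalg p ≃+* Kalg p}

/-- A function on the `R_π`-points of an algebra given by a restricted power series in the
coordinates and their iterated Fermat quotients. -/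
def IsSeriesFunction (φ : Kalg p ≃+* Kalg p) (π : PadicAlgCl p)
    (h : (A →ₐ[R p] Rpi p π) → Rpi p π) : Prop :=
  ∃ (n : ℕ) (s : Fin n → A) (r : ℕ) (F : MvPowerSeries (Fin (r + 1) × Fin n) (Rpi p π)),
    MvPowerSeries.IsRestricted (fun _ => 1) F ∧
      ∀ a : A →ₐ[R p] Rpi p π,
        HasSum (fun m : Fin (r + 1) × Fin n →₀ ℕ =>
          ((MvPowerSeries.coeff m F : Rpi p π) : ℂ_[p]) *
            ∏ ji : Fin (r + 1) × Fin n,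
              ((((fermatQuotient φ π)^[(ji.1 : ℕ)] (RpiToKalg p π (a (s ji.2))) : Kalg p) :
                ℂ_[p])) ^ m ji)
          ((h a : Rpi p π) : ℂ_[p])

/-- Each monomial is a product of iterates δ^j s, which have finite order. Restrictedness leaves
finitely many coefficients outside ϖ^N, so the sum has finite order too. -/
theorem IsSeriesFunction.exists_mem_jetRing (hφ : IsFrobenius φ) (hπ : π ∈ PiSet p)
    {h : (A →ₐ[R p] Rpi p π) → Rpi p π} (hh : IsSeriesFunction φ π h)
    [Nonempty (A →ₐ[R p] Rpi p π)] (hθ : θ.Etale)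
    (hC : θ.comp MvPolynomial.C = algebraMap (R p) A) :
    ∃ r, h ∈ (frobeniusRing hφ hπ).jetRing (fun i => θ (MvPolynomial.X i)) r := by
  classical
  obtain ⟨n, s, r, F, hF, hsum⟩ := hh
  set D := frobeniusRing hφ hπ with hD
  refine ⟨r, ?_⟩
  have hϖ : ∀ N, D.ϖ ^ N ≠ 0 := fun N => pow_ne_zero N D.ne_zero
  have hnorm : ∀ N (x : Rpi p π), D.ϖ ^ N ∣ x ↔ ‖(x : ℂ_[p])‖ ≤ ‖π‖ ^ N := fun N x => by
    rw [valRing_dvd_iff (hϖ N), Subring.coe_pow, norm_pow]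
    change _ ≤ ‖(piRpi hπ : ℂ_[p])‖ ^ N ↔ _
    rw [norm_piRpi]
  have hfin : ∀ N, {m | ¬ D.ϖ ^ N ∣ MvPowerSeries.coeff m F}.Finite := fun N => by
    have h1 := (hF.eventually (gt_mem_nhds (pow_pos (norm_pi_pos hπ) N)))
    refine Set.Finite.subset h1 fun m hm => ?_
    intro hlt
    refine hm ((hnorm N _).2 ?_)
    have h2 : ‖MvPowerSeries.coeff m F‖ * m.prod (fun _ n => (1 : ℝ) ^ n) < ‖π‖ ^ N := hlt
    simp only [one_pow, Finsupp.prod_fun_one, mul_one] at h2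
    exact h2.le
  have hM1 : ∀ (m : Fin (r + 1) × Fin n →₀ ℕ) (a : A →ₐ[R p] Rpi p π),
      ((∏ ji : Fin (r + 1) × Fin n, D.δ^[(ji.1 : ℕ)] (a (s ji.2)) ^ m ji : Rpi p π) : ℂ_[p]) =
      ∏ ji : Fin (r + 1) × Fin n,
              ((((fermatQuotient φ π)^[(ji.1 : ℕ)] (RpiToKalg p π (a (s ji.2))) : Kalg p) :
                ℂ_[p])) ^ m ji := fun m a => by
    have h1 : ((∏ ji : Fin (r + 1) × Fin n, D.δ^[(ji.1 : ℕ)] (a (s ji.2)) ^ m ji : Rpi p π) :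
        ℂ_[p]) = ∏ ji : Fin (r + 1) × Fin n, ((D.δ^[(ji.1 : ℕ)] (a (s ji.2)) : Rpi p π) : ℂ_[p]) ^ m ji := by
      rw [← Subring.coe_subtype, map_prod]
      rfl
    rw [h1]
    refine Finset.prod_congr rfl fun ji _ => ?_
    congr 1
    exact congrArg (Kalg p).val (RpiToKalg_deltaPi_iterate hφ hπ ji.1 (a (s ji.2)))
  refine D.mem_jetRing_of_series (fun m => MvPowerSeries.coeff m F)
    (fun m a => ∏ ji : Fin (r + 1) × Fin n, D.δ^[(ji.1 : ℕ)] (a (s ji.2)) ^ m ji) (fun m => ?_)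
    (fun N => (hfin N).toFinset) (fun N m => by simp) fun N a => ?_
  · have h1 : (fun a : A →ₐ[R p] Rpi p π =>
        ∏ ji : Fin (r + 1) × Fin n, D.δ^[(ji.1 : ℕ)] (a (s ji.2)) ^ m ji) =
        ∏ ji : Fin (r + 1) × Fin n, (fun a : A →ₐ[R p] Rpi p π => D.δ^[(ji.1 : ℕ)] (a (s ji.2))) ^ m ji := by
      funext a
      simp [Finset.prod_apply]
    rw [h1]
    refine prod_mem fun ji _ => pow_mem (D.jetRing_mono _ (Nat.le_of_lt_succ ji.1.2)
      (D.δ_iterate_mem (formallyEtale_of_etale hθ) hC (fun _ => rfl) ji.1 (s ji.2))) _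
  · rw [hnorm]
    have h1 := hsum a
    have hco : (((h a - ∑ m ∈ (hfin N).toFinset, MvPowerSeries.coeff m F *
        ∏ ji : Fin (r + 1) × Fin n, D.δ^[(ji.1 : ℕ)] (a (s ji.2)) ^ m ji : Rpi p π)) : ℂ_[p]) =
        (h a : ℂ_[p]) - ∑ m ∈ (hfin N).toFinset, ((MvPowerSeries.coeff m F : Rpi p π) : ℂ_[p]) *
            ∏ ji : Fin (r + 1) × Fin n,
              ((((fermatQuotient φ π)^[(ji.1 : ℕ)] (RpiToKalg p π (a (s ji.2))) : Kalg p) :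
                ℂ_[p])) ^ m ji := by
      rw [AddSubgroupClass.coe_sub, ← Subring.coe_subtype, map_sum]
      congr 1
      refine Finset.sum_congr rfl fun m _ => ?_
      rw [map_mul, ← hM1 m a]
      rfl
    rw [hco]
    refine le_of_tendsto ((Tendsto.sub_const h1 _).norm)
      ((eventually_ge_atTop (hfin N).toFinset).mono fun S hS => ?_)
    rw [← Finset.sum_sdiff hS, add_sub_cancel_right]
    refine IsUltrametricDist.norm_sum_le_of_forall_le_of_nonneg
      (pow_nonneg (norm_nonneg _) _) fun m hm => ?_
    rw [← hM1 m a, norm_mul]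
    have h2 : D.ϖ ^ N ∣ MvPowerSeries.coeff m F := by
      by_contra hcon
      exact (Finset.mem_sdiff.1 hm).2 ((hfin N).mem_toFinset.2 hcon)
    exact (mul_le_of_le_one_right (norm_nonneg _)
      (∏ ji : Fin (r + 1) × Fin n, D.δ^[(ji.1 : ℕ)] (a (s ji.2)) ^ m ji : Rpi p π).2.2).trans
      ((hnorm N _).1 h2)

/-- A `δ_π`-function on an étale scheme over affine space with integral reduction that vanishes on
one residue disk is zero. -/
theorem IsSeriesFunction.eq_zero (hφ : IsFrobenius φ) (hπ : π ∈ PiSet p) (hθ : θ.Etale)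
    (hC : θ.comp MvPolynomial.C = algebraMap (R p) A) (hprime : (Ideal.span {(p : A)}).IsPrime)
    {β : A →+* k p} (hβ : β.comp (algebraMap (R p) A) = RtoResidue p)
    {h : (A →ₐ[R p] Rpi p π) → Rpi p π} (hh : IsSeriesFunction φ π h)
    (hvan : ∀ a : A →ₐ[R p] Rpi p π,
      (∀ s, IsLocalRing.residue (Ralg p) (RpiToRalg p π (a s)) = β s) → h a = 0) : h = 0 := by
  obtain ⟨P, hP⟩ := exists_lift_residue hθ hC hβ
  obtain ⟨θ', hθ', hC', hP'⟩ := exists_translate hθ hC P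
  have := finiteType_of_etale hθ hC
  have := isNoetherianRing_quotient (p := p) (A := A)
  have : Nonempty (A →ₐ[R p] Rpi p π) := ⟨(Algebra.ofId (R p) (Rpi p π)).comp P⟩
  obtain ⟨r, hr⟩ := hh.exists_mem_jetRing hφ hπ hθ' hC'
  refine (frobeniusRing hφ hπ).eq_zero_of_vanish (jetIndependent hφ hπ)
    (formallyEtale_of_etale hθ') hC' (fun _ => rfl) P hP'
    (dvd_of_forall_mem_pow P not_isUnit_p) hr fun a ha => hvan a fun s => ?_
  rw [← hP s]
  change _ = IsLocalRing.residue (Ralg p) (RtoRalg p (P s))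
  rw [← sub_eq_zero, ← map_sub, IsLocalRing.residue_eq_zero_iff, valRing_mem_maximalIdeal]
  exact (piRpi_dvd_iff hπ).1 (ha s)

/-- A prime over the closed point of `R` of an étale algebra over affine space has a principal
neighbourhood with integral reduction. -/
theorem exists_notMem_isPrime (hθ : θ.Etale) (hC : θ.comp MvPolynomial.C = algebraMap (R p) A)
    {𝔮 : Ideal A} (h𝔮 : 𝔮.IsPrime) (hp : (p : A) ∈ 𝔮) :
    ∃ e ∉ 𝔮, ∀ (B : Type) [CommRing B] [Algebra A B] [IsLocalization.Away e B],
      (Ideal.span {(p : B)}).IsPrime := by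
  have := finiteType_of_etale hθ hC
  obtain ⟨β, hβ, hle⟩ := exists_hom_residue 𝔮 h𝔮.ne_top hp
  obtain ⟨P, hP⟩ := exists_lift_residue hθ hC hβ
  obtain ⟨θ', hθ', hC', hP'⟩ := exists_translate hθ hC P
  have := isNoetherianRing_quotient (p := p) (A := A)
  have : (Ideal.span {(p : R p)}).IsPrime := isMaximal_span_p.isPrime
  obtain ⟨e, he, hloc⟩ := exists_isPrime_localization (p := p) (formallyEtale_of_etale hθ') hC'
    (fun _ => rfl) P hP'
  refine ⟨e, fun h => he ?_, hloc⟩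
  have h1 : β e = 0 := hle h
  rw [← hP, RtoResidue_eq_zero_iff] at h1
  exact Ideal.mem_span_singleton.2 h1

end ArithDiff

namespace ArithDiff

/-! ### Points of affine schemes -/

namespace Points

variable {A B C : Type} [CommRing A] [CommRing B] [CommRing C] {V : Scheme.{0}}
  {f : V ⟶ Spec (CommRingCat.of A)} {ι : A →+* B}

/-- Evaluation of functions at a point. -/
noncomputable def toHom (x : Points f ι) : Γ(V, ⊤) →+* B :=
  (Scheme.ΓSpecIso (CommRingCat.of B)).hom.hom.comp x.1.appTop.hom

theorem value_eq (x : Points f ι) (s : Γ(V, ⊤)) : x.value s = x.toHom s := rfl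

theorem toHom_comp (x : Points f ι) : x.toHom.comp (structureMap f) = ι := by
  have h1 : (Scheme.ΓSpecIso (CommRingCat.of A)).inv ≫ f.appTop ≫ x.1.appTop ≫
      (Scheme.ΓSpecIso (CommRingCat.of B)).hom = CommRingCat.ofHom ι := by
    rw [← Scheme.Hom.comp_appTop_assoc, x.2, Scheme.ΓSpecIso_naturality, Iso.inv_hom_id_assoc]
  have h2 := congrArg CommRingCat.Hom.hom h1
  rw [← Category.assoc] at h2
  exact h2

theorem toHom_map (x : Points f ι) (j : B →+* C) : (x.map j).toHom = j.comp x.toHom := by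
  have h1 : (Spec.map (CommRingCat.ofHom j) ≫ x.1).appTop ≫
      (Scheme.ΓSpecIso (CommRingCat.of C)).hom =
      (x.1.appTop ≫ (Scheme.ΓSpecIso (CommRingCat.of B)).hom) ≫ CommRingCat.ofHom j := by
    rw [Scheme.Hom.comp_appTop, Category.assoc, Scheme.ΓSpecIso_naturality, Category.assoc]
  exact congrArg CommRingCat.Hom.hom h1

theorem ext_toHom [IsAffine V] {x y : Points f ι} (h : x.toHom = y.toHom) : x = y := by
  refine Subtype.ext (ext_of_isAffine ?_)
  have h1 : x.1.appTop ≫ (Scheme.ΓSpecIso (CommRingCat.of B)).hom =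
      y.1.appTop ≫ (Scheme.ΓSpecIso (CommRingCat.of B)).hom := CommRingCat.hom_ext h
  exact (cancel_mono _).1 h1

theorem exists_toHom_eq [IsAffine V] (a : Γ(V, ⊤) →+* B) (h : a.comp (structureMap f) = ι) :
    ∃ x : Points f ι, x.toHom = a := by
  have h1 : V.isoSpec.inv.appTop = (Scheme.ΓSpecIso Γ(V, ⊤)).inv := by
    have h2 := congrArg Scheme.Hom.appTop V.isoSpec_inv_toSpecΓ
    rw [Scheme.Hom.comp_appTop, Scheme.toSpecΓ_appTop] at h2
    rw [← Iso.hom_comp_eq_id]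
    exact h2
  have h2 : (Spec.map (CommRingCat.ofHom a) ≫ V.isoSpec.inv).appTop ≫
      (Scheme.ΓSpecIso (CommRingCat.of B)).hom = CommRingCat.ofHom a := by
    rw [Scheme.Hom.comp_appTop, h1, Category.assoc, Scheme.ΓSpecIso_naturality]
    exact Iso.inv_hom_id_assoc (Scheme.ΓSpecIso Γ(V, ⊤)) (CommRingCat.ofHom a)
  refine ⟨⟨Spec.map (CommRingCat.ofHom a) ≫ V.isoSpec.inv, ?_⟩, congrArg CommRingCat.Hom.hom h2⟩
  refine ext_of_isAffine ((cancel_mono (Scheme.ΓSpecIso (CommRingCat.of B)).hom).1 ?_)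
  rw [Scheme.ΓSpecIso_naturality, Scheme.Hom.comp_appTop, Category.assoc, h2, ← Iso.inv_comp_eq]
  rw [← h]
  rfl

theorem ofOpen_map {U : V.Opens} (x : Points (U.ι ≫ f) ι) (j : B →+* C) :
    (x.map j).ofOpen = x.ofOpen.map j := Subtype.ext (Category.assoc _ _ _)

/-- The image of the closed point under a point with values in a local ring. -/
noncomputable def center [IsLocalRing B] (x : Points f ι) : V := x.1 (IsLocalRing.closedPoint B)

theorem map_center [IsLocalRing A] [IsLocalRing B] [IsLocalHom ι] (x : Points f ι) :
    f x.center = IsLocalRing.closedPoint A := by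
  have h1 : f x.center = (x.1 ≫ f) (IsLocalRing.closedPoint B) := rfl
  rw [h1, x.2]
  exact IsLocalRing.comap_closedPoint ι

theorem center_map [IsLocalRing B] [IsLocalRing C] (x : Points f ι) (j : B →+* C) [IsLocalHom j] :
    (x.map j).center = x.center := by
  change x.1 (PrimeSpectrum.comap j (IsLocalRing.closedPoint C)) = _
  rw [IsLocalRing.comap_closedPoint j]
  rfl

theorem center_ofOpen_mem [IsLocalRing B] {U : V.Opens} (x : Points (U.ι ≫ f) ι) :
    x.ofOpen.center ∈ U := by
  have h1 : x.ofOpen.center = U.ι (x.1 (IsLocalRing.closedPoint B)) := rfl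
  rw [h1]
  exact (x.1 (IsLocalRing.closedPoint B)).2

/-- The only open subset of the spectrum of a local ring that contains the closed point is the whole
spectrum. -/
theorem exists_ofOpen_eq [IsLocalRing B] {U : V.Opens} (x : Points f ι) (h : x.center ∈ U) :
    ∃ y : Points (U.ι ≫ f) ι, y.ofOpen = x := by
  have h1 : x.1 ⁻¹ᵁ U = ⊤ := by
    have := (IsLocalRing.closedPoint_mem_iff (x.1 ⁻¹ᵁ U)).1 h
    exact this
  have h2 : Set.range x.1 ⊆ Set.range U.ι := by
    rintro _ ⟨y, rfl⟩
    rw [Scheme.Opens.range_ι]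
    have : y ∈ x.1 ⁻¹ᵁ U := by rw [h1]; trivial
    exact this
  refine ⟨⟨IsOpenImmersion.lift U.ι x.1 h2, ?_⟩, Subtype.ext (IsOpenImmersion.lift_fac _ _ _)⟩
  rw [← Category.assoc, IsOpenImmersion.lift_fac, x.2]

end Points

variable {p : ℕ} [Fact p.Prime]

instance isLocalHom_RtoRalg : IsLocalHom (RtoRalg p) where
  map_nonunit r h := by
    rw [valRing_isUnit_iff] at h ⊢
    exact h

instance isLocalHom_RtoResidue : IsLocalHom (RtoResidue p) := by
  unfold RtoResidue
  infer_instance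

theorem closedPoint_asIdeal : (IsLocalRing.closedPoint (R p)).asIdeal = Ideal.span {(p : R p)} :=
  (IsLocalRing.eq_maximalIdeal isMaximal_span_p).symm

/-- The fibre is the image of the first projection from the base change to R/p, whose spectrum maps
onto the closed point. -/
theorem isPreconnected_preimage_closedPoint {V : Scheme.{0}}
    (f : V ⟶ Spec (CommRingCat.of (R p))) (hconn : ConnectedSpace (reductionModP f)) :
    _root_.IsPreconnected (f ⁻¹' {IsLocalRing.closedPoint (R p)}) := by
  set q := Spec.map (CommRingCat.ofHom (Ideal.Quotient.mk (Ideal.span {(p : R p)}))) with hq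
  have h1 : Set.range q = {IsLocalRing.closedPoint (R p)} := by
    have h2 : Set.range q = PrimeSpectrum.zeroLocus
        (RingHom.ker (Ideal.Quotient.mk (Ideal.span {(p : R p)})) : Set (R p)) :=
      range_comap_of_surjective _ _ Ideal.Quotient.mk_surjective
    rw [h2, Ideal.mk_ker]
    ext x
    refine ⟨fun hx => ?_, ?_⟩
    · refine PrimeSpectrum.ext ?_
      rw [closedPoint_asIdeal]
      exact (isMaximal_span_p.eq_of_le x.2.ne_top hx).symm
    · rintro rfl
      exact closedPoint_asIdeal.ge
  rw [← h1, ← Scheme.Pullback.range_fst]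
  have : PreconnectedSpace ↥(Limits.pullback f q) := hconn.toPreconnectedSpace
  exact isPreconnected_range (Limits.pullback.fst f q).continuous

end ArithDiff

/-! ### Coordinate opens around points of the closed fibre -/

namespace ArithDiff

variable {p : ℕ} [Fact p.Prime] {V : Scheme.{0}} {f : V ⟶ Spec (CommRingCat.of (R p))}

theorem le_preimage_top (f : V ⟶ Spec (CommRingCat.of (R p))) (U : V.Opens) : U ≤ f ⁻¹ᵁ ⊤ :=
  fun _ _ => trivial

/-- The structure map of the sections over an open subset. -/
noncomputable def sectionsMap (f : V ⟶ Spec (CommRingCat.of (R p))) (U : V.Opens) :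
    R p →+* Γ(V, U) :=
  ((Scheme.ΓSpecIso (CommRingCat.of (R p))).inv ≫ f.appLE ⊤ U (le_preimage_top f U)).hom

theorem structureMap_eq_sectionsMap (U : V.Opens) :
    structureMap (U.ι ≫ f) = U.topIso.inv.hom.comp (sectionsMap f U) := by
  have h1 : (Scheme.ΓSpecIso (CommRingCat.of (R p))).inv ≫ (U.ι ≫ f).appTop =
      ((Scheme.ΓSpecIso (CommRingCat.of (R p))).inv ≫ f.appLE ⊤ U (le_preimage_top f U)) ≫ U.topIso.inv := by
    rw [Category.assoc]
    congr 1
    simp only [Scheme.Opens.topIso_inv, Scheme.Hom.comp_appTop, Scheme.Opens.ι_appTop,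
      Scheme.Hom.appLE]
    refine Eq.trans ?_ (Category.assoc _ _ _).symm
    exact congrArg (f.appTop ≫ ·) (V.presheaf.map_comp _ _)
  exact congrArg CommRingCat.Hom.hom h1

theorem sectionsMap_res {U W : V.Opens} (h : W ≤ U) :
    (V.presheaf.map (homOfLE h).op).hom.comp (sectionsMap f U) = sectionsMap f W := by
  have h1 : ((Scheme.ΓSpecIso (CommRingCat.of (R p))).inv ≫ f.appLE ⊤ U (le_preimage_top f U)) ≫
      V.presheaf.map (homOfLE h).op =
      (Scheme.ΓSpecIso (CommRingCat.of (R p))).inv ≫ f.appLE ⊤ W (le_preimage_top f W) := by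
    rw [Category.assoc, Scheme.Hom.appLE_map]
  exact congrArg CommRingCat.Hom.hom h1

theorem notMem_basicOpen_p {U : V.Opens} {x : V}
    (hx : f x = IsLocalRing.closedPoint (R p)) : x ∉ V.basicOpen (p : Γ(V, U)) := by
  intro h
  have h1 : (p : Γ(V, U)) = f.appLE ⊤ U (le_preimage_top f U) (p : Γ(Spec (CommRingCat.of (R p)), ⊤)) :=
    (map_natCast (f.appLE ⊤ U (le_preimage_top f U)).hom p).symm
  rw [h1, Scheme.basicOpen_appLE] at h
  have h2 : f x ∈ (Spec (CommRingCat.of (R p))).basicOpen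
      (p : Γ(Spec (CommRingCat.of (R p)), ⊤)) := h.2
  rw [basicOpen_eq_of_affine', hx] at h2
  have h3 : (p : R p) ∉ (IsLocalRing.closedPoint (R p)).asIdeal := by
    have h4 := map_natCast (Scheme.ΓSpecIso (CommRingCat.of (R p))).hom.hom p
    rw [← h4]
    exact h2
  rw [closedPoint_asIdeal] at h3
  exact h3 (Ideal.mem_span_singleton_self _)

theorem bijective_topIso_inv (U : V.Opens) : Function.Bijective U.topIso.inv.hom :=
  U.topIso.symm.commRingCatIsoToRingEquiv.bijective

theorem finiteType_structureMap [Smooth f] {U : V.Opens} (hU : IsAffineOpen U) :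
    (structureMap (U.ι ≫ f)).FiniteType := by
  have h1 := f.smooth_appLE (isAffineOpen_top _) hU (le_preimage_top f U)
  have h2 : (f.appLE ⊤ U (le_preimage_top f U)).hom.FiniteType :=
    RingHom.FiniteType.of_finitePresentation h1.finitePresentation
  rw [structureMap_eq_sectionsMap]
  refine RingHom.FiniteType.comp (RingHom.FiniteType.of_surjective _ (bijective_topIso_inv U).2)
    (RingHom.FiniteType.comp h2 (RingHom.FiniteType.of_surjective _ ?_))
  exact (Scheme.ΓSpecIso (CommRingCat.of (R p))).symm.commRingCatIsoToRingEquiv.surjective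

/-- The `k`-points are dense in the closed fibre. -/
theorem exists_residue_point [Smooth f] {W : V.Opens} {x : V} (hxW : x ∈ W)
    (hx : f x = IsLocalRing.closedPoint (R p)) :
    ∃ Q : Points f (RtoResidue p), Q.center ∈ W := by
  obtain ⟨_, ⟨(U : V.Opens), hU, rfl⟩, hxU, hUW⟩ :=
    V.isBasis_affineOpens.exists_subset_of_mem_open hxW W.2
  have : IsAffine U := hU
  have hunit : ¬ IsUnit (p : Γ(U, ⊤)) := fun h => by
    have h1 : IsUnit (p : Γ(V, U)) := by
      have h2 := h.map U.topIso.hom.hom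
      rwa [map_natCast] at h2
    refine notMem_basicOpen_p hx (U := U) ?_
    rw [Scheme.basicOpen_of_isUnit _ h1]
    exact hxU
  let := (structureMap (U.ι ≫ f)).toAlgebra
  have : Algebra.FiniteType (R p) Γ(U, ⊤) := finiteType_structureMap hU
  obtain ⟨β, hβ, -⟩ := exists_hom_residue (p := p) (Ideal.span {(p : Γ(U, ⊤))})
    (fun h => hunit (Ideal.span_singleton_eq_top.1 h)) (Ideal.mem_span_singleton_self _)
  obtain ⟨Q, -⟩ := Points.exists_toHom_eq (f := U.ι ≫ f) β hβ
  exact ⟨Q.ofOpen, hUW Q.center_ofOpen_mem⟩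

/-- An affine open subset with étale coordinates and integral reduction. -/
structure IsCoordinateOpen (f : V ⟶ Spec (CommRingCat.of (R p))) (U : V.Opens) : Prop where
  isAffineOpen : IsAffineOpen U
  exists_etale : ∃ (d : ℕ) (θ : MvPolynomial (Fin d) (R p) →+* Γ(U, ⊤)), θ.Etale ∧
    θ.comp MvPolynomial.C = structureMap (U.ι ≫ f)
  isPrime_span : (Ideal.span {(p : Γ(U, ⊤))}).IsPrime

theorem exists_etale_sections [Smooth f] {x : V} (hx : f x = IsLocalRing.closedPoint (R p)) :
    ∃ U : V.Opens, IsAffineOpen U ∧ x ∈ U ∧ ∃ (d : ℕ) (θ : MvPolynomial (Fin d) (R p) →+* Γ(V, U)),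
      θ.Etale ∧ θ.comp MvPolynomial.C = sectionsMap f U := by
  obtain ⟨W, -, U, hU, hxU, e, hs⟩ := Smooth.exists_isStandardSmooth f x
  -- The open W of the base contains the closed point of the local scheme Spec R.
  obtain rfl : W = ⊤ := by
    refine (IsLocalRing.closedPoint_mem_iff (R := R p) W).1 ?_
    rw [← hx]
    exact e hxU
  obtain ⟨d, θ, hC, hθ⟩ := hs.exists_etale_mvPolynomial
  set c := (Scheme.ΓSpecIso (CommRingCat.of (R p))).symm.commRingCatIsoToRingEquiv
  refine ⟨U, hU, hxU, d, θ.comp (MvPolynomial.mapEquiv (Fin d) c : _ →+* _),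
    RingHom.Etale.stableUnderComposition _ _ (RingHom.Etale.of_bijective
      (MvPolynomial.mapEquiv (Fin d) c).bijective) hθ, ?_⟩
  ext1 r
  change θ (MvPolynomial.map (c : _ →+* _) (MvPolynomial.C r)) = _
  rw [MvPolynomial.map_C]
  exact RingHom.congr_fun hC (c r)

/-- Take étale coordinates near x and apply `exists_notMem_isPrime` to the prime of x. Passing to
the basic open of the resulting e makes the reduction integral and keeps the coordinates étale. -/
theorem exists_isCoordinateOpen [Smooth f] {x : V} (hx : f x = IsLocalRing.closedPoint (R p)) :
    ∃ U : V.Opens, x ∈ U ∧ IsCoordinateOpen f U := by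
  obtain ⟨U, hU, hxU, d, θ, hθ, hC⟩ := exists_etale_sections hx
  let := (sectionsMap f U).toAlgebra
  set 𝔮 : Ideal Γ(V, U) :=
    (IsLocalRing.maximalIdeal (V.presheaf.stalk x)).comap (V.presheaf.germ U x hxU).hom with h𝔮
  have hmem (e : Γ(V, U)) : e ∈ 𝔮 ↔ x ∉ V.basicOpen e := by
    rw [Scheme.mem_basicOpen _ _ _ hxU]
    rfl
  obtain ⟨e, he, hprime⟩ := exists_notMem_isPrime hθ hC (𝔮 := 𝔮) inferInstance
    ((hmem _).2 (notMem_basicOpen_p hx))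
  rw [hmem, not_not] at he
  have hloc := hU.isLocalization_basicOpen e
  have hres : (algebraMap Γ(V, U) Γ(V, V.basicOpen e)).Etale :=
    RingHom.etale_algebraMap.2 (Algebra.Etale.of_isLocalizationAway e)
  refine ⟨V.basicOpen e, he, hU.basicOpen e,
    ⟨d, (V.basicOpen e).topIso.inv.hom.comp ((algebraMap Γ(V, U) Γ(V, V.basicOpen e)).comp θ),
      RingHom.Etale.stableUnderComposition _ _
        (RingHom.Etale.stableUnderComposition _ _ hθ hres)
        (RingHom.Etale.of_bijective (bijective_topIso_inv _)), ?_⟩, ?_⟩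
  · rw [structureMap_eq_sectionsMap, RingHom.comp_assoc, RingHom.comp_assoc, hC,
      ← sectionsMap_res (V.basicOpen_le e)]
    rfl
  · have h1 := hprime Γ(V, V.basicOpen e)
    have h2 := Ideal.comap_isPrime (V.basicOpen e).topIso.hom.hom
      (Ideal.span {(p : Γ(V, V.basicOpen e))})
    convert h2 using 1
    set c := (V.basicOpen e).topIso.commRingCatIsoToRingEquiv
    ext y
    rw [Ideal.mem_comap, Ideal.mem_span_singleton, Ideal.mem_span_singleton]
    rw [← map_dvd_iff c, map_natCast]
    rfl

end ArithDiff

/-! ### Vanishing on a coordinate open and propagation along the closed fibre -/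

namespace ArithDiff

variable {p : ℕ} [Fact p.Prime] {φ : Kalg p ≃+* Kalg p}

/-- Every homomorphism from a finite type algebra to `R^alg` has values in some `R_π`. -/
theorem exists_factor_Rpi {A : Type} [CommRing A] [Algebra (R p) A] [Algebra.FiniteType (R p) A]
    (a : A →+* Ralg p) (ha : a.comp (algebraMap (R p) A) = RtoRalg p) :
    ∃ π ∈ PiSet p, ∃ b : A →+* Rpi p π, b.comp (algebraMap (R p) A) = RtoRpi p π ∧
      (RpiToRalg p π).comp b = a := by
  obtain ⟨n, q, hq⟩ := Algebra.FiniteType.iff_quotient_mvPolynomial''.1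
    (inferInstance : Algebra.FiniteType (R p) A)
  obtain ⟨π, hπ, hmem⟩ := exists_forall_mem_Kpi (p := p)
    fun i : Fin n => (⟨a (q (MvPolynomial.X i)), (a (q (MvPolynomial.X i))).2.1⟩ : Kalg p)
  have h1 (y : A) : (a y : ℂ_[p]) ∈ Kpi p π := by
    obtain ⟨P, rfl⟩ := hq y
    induction P using MvPolynomial.induction_on with
    | C r =>
      rw [← MvPolynomial.algebraMap_eq, AlgHom.commutes]
      have h2 : a (algebraMap (R p) A r) = RtoRalg p r := RingHom.congr_fun ha r
      rw [h2]
      exact K_le p (Kpi p π) r.2.1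
    | add P Q hP hQ =>
      rw [map_add, map_add]
      exact add_mem hP hQ
    | mul_X P i hP =>
      rw [map_mul, map_mul]
      exact mul_mem hP (hmem i)
  refine ⟨π, hπ, ((Ralg p).subtype.comp a).codRestrict (Rpi p π) fun y => ⟨h1 y, (a y).2.2⟩, ?_, ?_⟩
  · ext r
    exact congrArg (Ralg p).subtype (RingHom.congr_fun ha r)
  · ext y
    rfl

variable {V : Scheme.{0}} {f : V ⟶ Spec (CommRingCat.of (R p))}

/-- P factors through R_π for some π in Π. On U(R_π), g is p^(-ν) times a δ_π-function, whose
vanishing on the disk of Q forces it to be zero. The choice of π, and with it ν, may depend on P. -/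
theorem IsCoordinateOpen.eq_zero (hφ : IsFrobenius φ) {g : Points f (RtoRalg p) → Kalg p}
    (hg : IsDeltaAlgFunction φ f g) {U : V.Opens} (hU : IsCoordinateOpen f U)
    {Q : Points f (RtoResidue p)} (hQ : Q.center ∈ U) (hvan : ∀ P ∈ unitBall Q, g P = 0)
    {P : Points f (RtoRalg p)} (hP : P.center ∈ U) : g P = 0 := by
  obtain ⟨haff, ⟨d, θ, hθ, hC⟩, hprime⟩ := hU
  have : IsAffine U := haff
  obtain ⟨Q, rfl⟩ := Q.exists_ofOpen_eq hQ
  obtain ⟨P, rfl⟩ := P.exists_ofOpen_eq hP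
  let := (structureMap (U.ι ≫ f)).toAlgebra
  have := finiteType_of_etale hθ hC
  obtain ⟨π, hπ, b, hb, hbP⟩ := exists_factor_Rpi P.toHom P.toHom_comp
  obtain ⟨ν, gν, hδ, hgν⟩ := hg π hπ
  have hpt (a : Γ(U, ⊤) →ₐ[R p] Rpi p π) :
      ∃ x : Points (U.ι ≫ f) (RtoRpi p π), x.toHom = a :=
    Points.exists_toHom_eq (a : Γ(U, ⊤) →+* Rpi p π) a.comp_algebraMap
  choose pt hpt using hpt
  have hseries : IsSeriesFunction φ π fun a => gν (pt a).ofOpen := by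
    obtain ⟨n, s, -, r, F, hF, hsum⟩ := hδ U haff
    refine ⟨n, s, r, F, hF, fun a => ?_⟩
    convert hsum (pt a) using 10
    rw [Points.value_eq, hpt]
    rfl
  have hzero := hseries.eq_zero hφ hπ hθ hC hprime Q.toHom_comp fun a ha => by
    have h1 : g (toAlg (pt a).ofOpen) = 0 := by
      refine hvan _ ?_
      have h2 : ((pt a).map (RpiToRalg p π)).map (IsLocalRing.residue (Ralg p)) = Q := by
        refine Points.ext_toHom ?_
        rw [Points.toHom_map, Points.toHom_map, hpt]
        ext s
        exact ha s
      change ((pt a).ofOpen.map (RpiToRalg p π)).map (IsLocalRing.residue (Ralg p)) = _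
      rw [← Points.ofOpen_map, ← Points.ofOpen_map]
      exact congrArg Points.ofOpen h2
    have hpν : ((p : Kalg p) ^ ν)⁻¹ ≠ 0 := inv_ne_zero (pow_ne_zero ν p_Kalg_ne_zero)
    have h3 := (mul_eq_zero.1 ((hgν _).symm.trans h1)).resolve_left hpν
    exact Subtype.ext (congrArg (Kalg p).val h3)
  let a : Γ(U, ⊤) →ₐ[R p] Rpi p π := { b with commutes' := fun r => RingHom.congr_fun hb r }
  have h1 : toAlg (pt a).ofOpen = P.ofOpen := by
    change (pt a).ofOpen.map (RpiToRalg p π) = _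
    rw [← Points.ofOpen_map]
    congr 1
    refine Points.ext_toHom ?_
    rw [Points.toHom_map, hpt]
    exact hbP
  rw [← h1, hgν]
  have h2 : gν (pt a).ofOpen = 0 := congrFun hzero a
  rw [h2]
  exact mul_zero _

/-- The coordinate opens on which g vanishes and those on which it does not have unions covering the
closed fibre. If both unions met the fibre, connectedness would make a member of one meet a member
of the other there. -/
theorem eq_zero_of_vanish_unitBall (hφ : IsFrobenius φ) [Smooth f]
    (hconn : ConnectedSpace (reductionModP f)) {g : Points f (RtoRalg p) → Kalg p}
    (hg : IsDeltaAlgFunction φ f g) (Q : Points f (RtoResidue p))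
    (hvan : ∀ P ∈ unitBall Q, g P = 0) (P : Points f (RtoRalg p)) : g P = 0 := by
  let Vanishes (U : V.Opens) : Prop := ∀ P : Points f (RtoRalg p), P.center ∈ U → g P = 0
  let Z : V.Opens := sSup {U | IsCoordinateOpen f U ∧ Vanishes U}
  let N : V.Opens := sSup {U | IsCoordinateOpen f U ∧ ¬ Vanishes U}
  obtain ⟨U, hQU, hU⟩ := exists_isCoordinateOpen Q.map_center
  have hQZ : Q.center ∈ Z :=
    TopologicalSpace.Opens.mem_sSup.2 ⟨U, ⟨hU, fun _ hP => hU.eq_zero hφ hg hQU hvan hP⟩, hQU⟩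
  have hcover : f ⁻¹' {IsLocalRing.closedPoint (R p)} ⊆ (Z : Set V) ∪ N := fun x hx => by
    obtain ⟨U, hxU, hU⟩ := exists_isCoordinateOpen (f := f) (x := x) hx
    by_cases h : Vanishes U
    · exact Or.inl (TopologicalSpace.Opens.mem_sSup.2 ⟨U, ⟨hU, h⟩, hxU⟩)
    · exact Or.inr (TopologicalSpace.Opens.mem_sSup.2 ⟨U, ⟨hU, h⟩, hxU⟩)
  have hPZ : P.center ∈ Z := by
    by_contra hPZ
    have hPN : P.center ∈ N := (hcover P.map_center).resolve_left hPZ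
    obtain ⟨x, hx, hxZ, hxN⟩ := isPreconnected_preimage_closedPoint f hconn Z N Z.2 N.2 hcover
      ⟨_, Q.map_center, hQZ⟩ ⟨_, P.map_center, hPN⟩
    obtain ⟨U, ⟨-, hZ⟩, hxU⟩ := TopologicalSpace.Opens.mem_sSup.1 hxZ
    obtain ⟨W, ⟨hW, hN⟩, hxW⟩ := TopologicalSpace.Opens.mem_sSup.1 hxN
    -- The ball of a k-point T in U ⊓ W lies over U, where g vanishes. The identity principle on W
    -- then contradicts the choice of W.
    obtain ⟨T, hT⟩ := exists_residue_point (f := f) (W := U ⊓ W) ⟨hxU, hxW⟩ hx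
    refine hN fun _ hP => hW.eq_zero hφ hg hT.2 (fun P' hP' => hZ P' ?_) hP
    have h1 : (P'.map (IsLocalRing.residue (Ralg p))).center = P'.center := P'.center_map _
    rw [← h1, show P'.map (IsLocalRing.residue (Ralg p)) = T from hP']
    exact hT.1
  obtain ⟨U, ⟨-, hZ⟩, hPU⟩ := TopologicalSpace.Opens.mem_sSup.1 hPZ
  exact hZ P hPU

end ArithDiff

theorem proposition4p3 (p : ℕ) [Fact p.Prime] (hp : 5 ≤ p)
    (φ : ArithDiff.Kalg p ≃+* ArithDiff.Kalg p) (hφ : ArithDiff.IsFrobenius φ)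
    (V : Scheme.{0}) (f : V ⟶ Spec (CommRingCat.of (ArithDiff.R p))) (hf : Smooth f)
    (hconn : ConnectedSpace (ArithDiff.reductionModP f))
    (g : ArithDiff.Points f (ArithDiff.RtoRalg p) → ArithDiff.Kalg p)
    (hg : ArithDiff.IsDeltaAlgFunction φ f g)
    (Pbar : ArithDiff.Points f (ArithDiff.RtoResidue p))
    (hvan : ∀ P ∈ ArithDiff.unitBall Pbar, g P = 0) :
    ∀ P : ArithDiff.Points f (ArithDiff.RtoRalg p), g P = 0 := by
  have := hf
  exact ArithDiff.eq_zero_of_vanish_unitBall hφ hconn hg Pbar hvan
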